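/- Work in a virtual equipment $\mathbb X$, i.e. a virtual double category (objects, tight-cells forming a category, loose-cells $p \colon B \nrightarrow A$, and 2-cells $p_1,\dots,p_n \Rightarrow q$, $n \ge 0$) with all loose-identities $A(1,1)$ and all restrictions $p(f,g)$; write $E(f,g)$ for the restriction of $E(1,1)$ along tight-cells $f,g$ into $E$. Composition of tight-cells in diagrammatic order is written $(f \mathbin{;} g)$. **Definitions.** Let $j \colon A \to E$ be a tight-cell. * A *$j$-monad* $T$ is a tight-cell $t \colon A \to E$ with a 2-cell $\eta \colon j \Rightarrow t$ (the unit) and a 2-cell $\dagger \colon E(j,t) \Rightarrow E(t,t)$ (the extension operator) satisfying the two unit laws and the associativity law. A *$T$-algebra with domain $D$* is a tight-cell $e \colon D \to E$ with a 2-cell $\alpha \colon E(j,e) \Rightarrow E(t,e)$ satisfying the unit law (precomposing $\alpha$ with $\eta$ yields the identity) and the extension law. For loose-cells $p_1,\dots,p_n$ composing from $D'$ to $D$, a *$(p_1,\dots,p_n)$-graded morphism* from $(e,\alpha)$ (with domain $D$) to $(e',\alpha')$ (with domain $D'$) is a 2-cell $E(1,e),p_1,\dots,p_n \Rightarrow E(1,e')$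 whose restrictions along $j$ and $t$ commute with $\alpha$ and $\alpha'$. Such 2-cells correspond to 2-cells $p_1,\dots,p_n \Rightarrow E(e,e')$; for a tight-cell $u \colon E \to E'$, postcomposing the latter with the action $E(e,e') \Rightarrow E'((e;u),(e';u))$ of $u$ defines the *postcomposition by $u$* of the former. * A $T$-algebra $(u_T \colon \mathbf{Alg}(T) \to E, \alpha_T)$ is an *algebra object* for $T$ when (1) for every $T$-algebra $(e \colon D \to E,\alpha)$ there is a unique tight-cell $h \colon D \to \mathbf{Alg}(T)$ with $(h;u_T) = e$ and $\alpha_T(1,h) = \alpha$; and (2) for $T$-algebras $(e,\alpha)$, $(e',\alpha')$ with corresponding tight-cells $h$, $h'$, every graded morphism $E(1,e),p_1,\dots,p_n \Rightarrow E(1,e')$ is the postcomposition by $u_T$ of a unique 2-cell $\mathbf{Alg}(T)(1,h),p_1,\dots,p_n \Rightarrow \mathbf{Alg}(T)(1,h')$. * A *$j$-adjunction* $\ell \dashv_j r$, for $\ell \colon A \to C$ and $r \colon C \to E$, is a pair of mutually inverse 2-cells $\sharp \colon C(\ell,1) \Rightarrow E(j,r)$ and $\flat \colon E(j,r) \Rightarrow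 C(\ell,1)$. It *induces* the $j$-monad with carrier $(\ell;r)$, unit the transpose under $\sharp$ of the identity on $\ell$, and extension operator $E(j,(\ell;r)) \xrightarrow{\flat(1,\ell)} C(\ell,\ell) \xrightarrow{r} E((\ell;r),(\ell;r))$; one says that it is a *resolution* of this $j$-monad. A *morphism of resolutions* from $\ell \dashv_j r$ (apex $C$) to $\ell_1 \dashv_j r_1$ (apex $C_1$) is a tight-cell $c \colon C \to C_1$ with $(\ell;c) = \ell_1$ and $(c;r_1) = r$ that is compatible with the transposition operators, i.e. $\sharp$ is the composite $C(\ell,1) \xrightarrow{c} C_1(\ell_1,c) \xrightarrow{\sharp_1(1,c)} E(j,r)$. * If $T$ admits an algebra object, $f_T \colon A \to \mathbf{Alg}(T)$ denotes the tight-cell induced by the $T$-algebra $(t,\dagger)$; there is a $j$-adjunction $f_T \dashv_j u_T$, with $\sharp$ the composite $\mathbf{Alg}(T)(f_T,1) \xrightarrow{u_T} E(t,u_T) \xrightarrow{E(\eta,u_T)} E(j,u_T)$, which is a resolution of $T$. A $j$-adjunction inducing a $j$-monad $T$ is *strictly $j$-monadic* when $T$ admits an algebra object and the $j$-adjunction is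 isomorphic to $f_T \dashv_j u_T$ in the category of resolutions of $T$. * Let $\ell' \dashv_j r'$ be a $j$-adjunction with apex $D$ and transposition operators $\sharp',\flat'$. Given an $\ell'$-monad $T = (t,\eta,\dagger)$ (on $\ell' \colon A \to D$), the *postcomposite* $(T;r')$ is the $j$-monad with carrier $(t;r')$, unit the transpose of $\eta$ under $\sharp'$, and extension operator $E(j,(t;r')) \xrightarrow{\flat'(1,t)} D(\ell',t) \xrightarrow{\dagger} D(t,t) \xrightarrow{r'} E((t;r'),(t;r'))$. Every $T$-algebra $(x,\alpha)$ yields a $(T;r')$-algebra $(x;r')$, its *postcomposition by $r'$*, with extension operator $E(j,(x;r')) \xrightarrow{\flat'(1,x)} D(\ell',x) \xrightarrow{\alpha} D(t,x) \xrightarrow{r'} E((t;r'),(x;r'))$. Given an $\ell'$-adjunction $\ell \dashv_{\ell'} r$ with operators $\sharp,\flat$, its *pasting* with $\ell' \dashv_j r'$ is the $j$-adjunction $\ell \dashv_j (r;r')$ with operators $\sharp'(1,r)\circ\sharp$ and $\flat\circ\flat'(1,r)$. **Theorem.** 1. Let $j \colon A \to E$ be a tight-cell, let $T'$ be a $j$-monad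 with an algebra object $u_{T'} \colon \mathbf{Alg}(T') \to E$, let $\ell \colon A \to C$ and $r \colon C \to \mathbf{Alg}(T')$ be tight-cells with $\ell \dashv_{f_{T'}} r$, and let $T$ be the $f_{T'}$-monad induced by this relative adjunction. Then postcomposition by $u_{T'}$ is, for every object $D$, a bijection from the $T$-algebras with domain $D$ to the $(T;u_{T'})$-algebras with domain $D$; and, for all $T$-algebras $(x,\alpha)$, $(x',\alpha')$ and all chains $p_1,\dots,p_n$ ($n \ge 0$) of loose-cells between their domains, postcomposition by $u_{T'}$ is a well-defined bijection from the $(p_1,\dots,p_n)$-graded morphisms $(x,\alpha) \to (x',\alpha')$ to the $(p_1,\dots,p_n)$-graded morphisms between the corresponding $(T;u_{T'})$-algebras. 2. Let $\ell' \dashv_j r'$ be a strictly $j$-monadic $j$-adjunction, with $\ell' \colon A \to D$ and $r' \colon D \to E$, and let $\ell \colon A \to C$ and $r \colon C \to D$ be tight-cells. Then $\ell$ and $r$ are the left and right adjoints of a strictly $\ell'$-monadic $\ell'$-adjunction if and only if $\ell$ and $(r;r')$ are the left and right adjoints of a strictly $j$-monadic $j$-adjunction. Moreover, a given $\ell'$-adjunction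 $\ell \dashv_{\ell'} r$ is strictly $\ell'$-monadic if and only if its pasting $\ell \dashv_j (r;r')$ with $\ell' \dashv_j r'$ is strictly $j$-monadic. -/

import Mathlib

open CategoryTheory

universe u v w z

/-- Chains of composable loose-cells. We write `L A B` for the loose-cells `p : B ⇸ A`, so that
a chain is read from left to right, as in `p₁(x₀, x₁), …, pₙ(xₙ₋₁, xₙ)`. -/
inductive LooseChain {Ob : Type u} (L : Ob → Ob → Type w) : Ob → Ob → Type (max u w)
  | nil (A : Ob) : LooseChain L A A
  | cons {A B C : Ob} (p : L A B) (ps : LooseChain L B C) : LooseChain L A C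

namespace LooseChain

variable {Ob : Type u} {L : Ob → Ob → Type w}

/-- Concatenation of chains. -/
def append {A B C : Ob} : LooseChain L A B → LooseChain L B C → LooseChain L A C
  | nil _, qs => qs
  | cons p ps, qs => cons p (append ps qs)

/-- The chain consisting of one loose-cell. -/
abbrev one {A B : Ob} (p : L A B) : LooseChain L A B := cons p (nil B)

theorem nil_append {A B : Ob} (ps : LooseChain L A B) : (nil A).append ps = ps := rfl

theorem append_nil {A B : Ob} (ps : LooseChain L A B) : ps.append (nil B) = ps := by
  induction ps with
  | nil => rfl
  | cons p ps ih => simp only [append, ih]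

theorem append_assoc {A B C D : Ob} (ps : LooseChain L A B) (qs : LooseChain L B C)
    (rs : LooseChain L C D) : (ps.append qs).append rs = ps.append (qs.append rs) := by
  induction ps with
  | nil => rfl
  | cons p ps ih => simp only [append, ih]

end LooseChain

/-- Horizontally composable sequences of 2-cells, for a family `K` of 2-cells: an element of
`CellSeq K f ps g qs` has one 2-cell for each loose-cell in the chain `qs`, adjacent 2-cells share
a tight-cell, and `ps` is the concatenation of the sources. (The proof `h` in `cons` only names the
concatenation, so that no transport along associativity of concatenation is ever needed.) -/
inductive CellSeq {Ob : Type u} [Category.{v} Ob] {L : Ob → Ob → Type w}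
    (K : ∀ ⦃A B A' B' : Ob⦄, (A ⟶ A') → LooseChain L A B → (B ⟶ B') → L A' B' → Type z) :
    ∀ {A B A' B' : Ob}, (A ⟶ A') → LooseChain L A B → (B ⟶ B') → LooseChain L A' B' →
      Type (max u v w z)
  | nil {A A' : Ob} (f : A ⟶ A') : CellSeq K f (.nil A) f (.nil A')
  | cons {A B C A' B' C' : Ob} {f : A ⟶ A'} {g : B ⟶ B'} {k : C ⟶ C'}
      {ps : LooseChain L A B} {ps' : LooseChain L B C} {q : L A' B'} {qs : LooseChain L B' C'}
      {rs : LooseChain L A C} (φ : K f ps g q) (S : CellSeq K g ps' k qs)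
      (h : ps.append ps' = rs) : CellSeq K f rs k (.cons q qs)

namespace CellSeq

variable {Ob : Type u} [Category.{v} Ob] {L : Ob → Ob → Type w}
  {K : ∀ ⦃A B A' B' : Ob⦄, (A ⟶ A') → LooseChain L A B → (B ⟶ B') → L A' B' → Type z}

/-- The sequence consisting of one 2-cell. -/
abbrev one {A B A' B' : Ob} {f : A ⟶ A'} {g : B ⟶ B'} {ps : LooseChain L A B} {q : L A' B'}
    (φ : K f ps g q) : CellSeq K f ps g (.one q) :=
  cons φ (nil g) ps.append_nil

/-- Transport along equalities of chains. -/
def cast {A B A' B' : Ob} {f : A ⟶ A'} {g : B ⟶ B'} {ps ps' : LooseChain L A B}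
    {qs qs' : LooseChain L A' B'} (S : CellSeq K f ps g qs) (h : ps = ps') (h' : qs = qs') :
    CellSeq K f ps' g qs' := by
  subst h; subst h'; exact S

/-- Concatenation of sequences of 2-cells. -/
def append {A B C A' B' C' : Ob} {f : A ⟶ A'} {g : B ⟶ B'} {k : C ⟶ C'}
    {ps : LooseChain L A B} {ps' : LooseChain L B C} {qs : LooseChain L A' B'}
    {qs' : LooseChain L B' C'} {rs : LooseChain L A C} {rs' : LooseChain L A' C'} :
    CellSeq K f ps g qs → CellSeq K g ps' k qs' → ps.append ps' = rs → qs.append qs' = rs' →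
    CellSeq K f rs k rs'
  | nil _, S', h, h' => S'.cast h h'
  | cons φ S e, S', h, h' =>
    (cons φ (S.append S' rfl rfl)
      (by rw [← h, ← e, LooseChain.append_assoc])).cast rfl h'

/-- The sequence of identity 2-cells on a chain. -/
def ids (ι : ∀ {A B : Ob} (p : L A B), K (𝟙 A) (.one p) (𝟙 B) p) :
    ∀ {A B : Ob} (ps : LooseChain L A B), CellSeq K (𝟙 A) ps (𝟙 B) ps
  | _, _, .nil A => nil (𝟙 A)
  | _, _, .cons p ps => cons (ι p) (ids ι ps) rfl

end CellSeq

/-- Sequences of 2-cells `φ`, each together with a sequence of 2-cells into the source of `φ`. -/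
inductive CellSeqTwo {Ob : Type u} [Category.{v} Ob] {L : Ob → Ob → Type w}
    (K : ∀ ⦃A B A' B' : Ob⦄, (A ⟶ A') → LooseChain L A B → (B ⟶ B') → L A' B' → Type z) :
    ∀ {A B A' B' A'' B'' : Ob}, (A ⟶ A') → (A' ⟶ A'') → LooseChain L A B → LooseChain L A' B' →
      (B ⟶ B') → (B' ⟶ B'') → LooseChain L A'' B'' → Type (max u v w z)
  | nil {A A' A'' : Ob} (f : A ⟶ A') (f' : A' ⟶ A'') :
      CellSeqTwo K f f' (.nil A) (.nil A') f f' (.nil A'')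
  | cons {A B C A' B' C' A'' B'' C'' : Ob} {f : A ⟶ A'} {f' : A' ⟶ A''} {g : B ⟶ B'}
      {g' : B' ⟶ B''} {k : C ⟶ C'} {k' : C' ⟶ C''} {ps : LooseChain L A B}
      {qs : LooseChain L A' B'} {ps' : LooseChain L B C} {qs' : LooseChain L B' C'}
      {r : L A'' B''} {rs : LooseChain L B'' C''}
      {ps'' : LooseChain L A C} {qs'' : LooseChain L A' C'}
      (S : CellSeq K f ps g qs) (φ : K f' qs g' r) (R : CellSeqTwo K g g' ps' qs' k k' rs)
      (h : ps.append ps' = ps'') (h' : qs.append qs' = qs'') :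
      CellSeqTwo K f f' ps'' qs'' k k' (.cons r rs)

namespace CellSeqTwo

variable {Ob : Type u} [Category.{v} Ob] {L : Ob → Ob → Type w}
  {K : ∀ ⦃A B A' B' : Ob⦄, (A ⟶ A') → LooseChain L A B → (B ⟶ B') → L A' B' → Type z}

/-- The concatenation of the upper sequences. -/
def top {A B A' B' A'' B'' : Ob} {f : A ⟶ A'} {f' : A' ⟶ A''} {ps : LooseChain L A B}
    {qs : LooseChain L A' B'} {g : B ⟶ B'} {g' : B' ⟶ B''} {rs : LooseChain L A'' B''} :
    CellSeqTwo K f f' ps qs g g' rs → CellSeq K f ps g qs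
  | nil f _ => .nil f
  | cons S _ R h h' => S.append R.top h h'

/-- The sequence of the lower 2-cells. -/
def bottom {A B A' B' A'' B'' : Ob} {f : A ⟶ A'} {f' : A' ⟶ A''} {ps : LooseChain L A B}
    {qs : LooseChain L A' B'} {g : B ⟶ B'} {g' : B' ⟶ B''} {rs : LooseChain L A'' B''} :
    CellSeqTwo K f f' ps qs g g' rs → CellSeq K f' qs g' rs
  | nil _ f' => .nil f'
  | cons _ φ R _ h' => .cons φ R.bottom h'

/-- The sequence of the composites of the lower 2-cells with the upper sequences. -/
def total
    (comp : ∀ {A B A' B' A'' B'' : Ob} {f : A ⟶ A'} {ps : LooseChain L A B} {g : B ⟶ B'}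
      {qs : LooseChain L A' B'} {f' : A' ⟶ A''} {g' : B' ⟶ B''} {r : L A'' B''}
      {f'' : A ⟶ A''} {g'' : B ⟶ B''}, CellSeq K f ps g qs → K f' qs g' r →
      f ≫ f' = f'' → g ≫ g' = g'' → K f'' ps g'' r)
    {A B A' B' A'' B'' : Ob} {f : A ⟶ A'} {f' : A' ⟶ A''} {ps : LooseChain L A B}
    {qs : LooseChain L A' B'} {g : B ⟶ B'} {g' : B' ⟶ B''} {rs : LooseChain L A'' B''} :
    CellSeqTwo K f f' ps qs g g' rs → CellSeq K (f ≫ f') ps (g ≫ g') rs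
  | nil f f' => .nil (f ≫ f')
  | cons S φ R h _ => .cons (comp S φ rfl rfl) (R.total comp) h

end CellSeqTwo

/-- A virtual double category: a category of objects and tight-cells, together with loose-cells
(`Loose A B` being the loose-cells `B ⇸ A`) and 2-cells
`φ : p₁, …, pₙ ⇒ q` framed by tight-cells `f₀ : A₀ ⟶ B₀` and `fₙ : Aₙ ⟶ Bₙ`, which compose in the
manner of a multicategory. In `cellComp`, the proofs `f ≫ f' = f''` and `g ≫ g' = g''` only name the
frame of the composite. -/
class VirtualDoubleCategory (Ob : Type u) extends Category.{v} Ob where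
  Loose : Ob → Ob → Type w
  Cell : ∀ ⦃A B A' B' : Ob⦄, (A ⟶ A') → LooseChain Loose A B → (B ⟶ B') → Loose A' B' → Type z
  /-- The identity 2-cell on a loose-cell. -/
  idCell : ∀ {A B : Ob} (p : Loose A B), Cell (𝟙 A) (.one p) (𝟙 B) p
  /-- The composite of a 2-cell with a sequence of 2-cells into its source. -/
  cellComp : ∀ {A B A' B' A'' B'' : Ob} {f : A ⟶ A'} {ps : LooseChain Loose A B} {g : B ⟶ B'}
    {qs : LooseChain Loose A' B'} {f' : A' ⟶ A''} {g' : B' ⟶ B''} {r : Loose A'' B''}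
    {f'' : A ⟶ A''} {g'' : B ⟶ B''}, CellSeq Cell f ps g qs → Cell f' qs g' r →
    f ≫ f' = f'' → g ≫ g' = g'' → Cell f'' ps g'' r
  ids_cellComp : ∀ {A B A' B' : Ob} {f : A ⟶ A'} {ps : LooseChain Loose A B} {g : B ⟶ B'}
    {q : Loose A' B'} (φ : Cell f ps g q),
    cellComp (CellSeq.ids idCell ps) φ (Category.id_comp f) (Category.id_comp g) = φ
  cellComp_idCell : ∀ {A B A' B' : Ob} {f : A ⟶ A'} {ps : LooseChain Loose A B} {g : B ⟶ B'}
    {q : Loose A' B'} (φ : Cell f ps g q),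
    cellComp (CellSeq.one φ) (idCell q) (Category.comp_id f) (Category.comp_id g) = φ
  cellComp_assoc : ∀ {A B A' B' A'' B'' A''' B''' : Ob} {f : A ⟶ A'} {f' : A' ⟶ A''}
    {ps : LooseChain Loose A B} {qs : LooseChain Loose A' B'} {g : B ⟶ B'} {g' : B' ⟶ B''}
    {rs : LooseChain Loose A'' B''} {f'' : A'' ⟶ A'''} {g'' : B'' ⟶ B'''} {s : Loose A''' B'''}
    (R : CellSeqTwo Cell f f' ps qs g g' rs) (φ : Cell f'' rs g'' s),
    cellComp R.top (cellComp R.bottom φ rfl rfl) rfl rfl =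
      cellComp (R.total cellComp) φ (Category.assoc f f' f'') (Category.assoc g g' g'')

namespace CellSeq

variable {Ob : Type u} [Category.{v} Ob] {L : Ob → Ob → Type w}
  {K : ∀ ⦃A B A' B' : Ob⦄, (A ⟶ A') → LooseChain L A B → (B ⟶ B') → L A' B' → Type z}

theorem cons_heq {A B C A' B' C' : Ob} {f : A ⟶ A'} {g : B ⟶ B'} {k : C ⟶ C'}
    {ps : LooseChain L A B} {ps' x : LooseChain L B C} {q : L A' B'} {qs y : LooseChain L B' C'}
    {rs : LooseChain L A C} (φ : K f ps g q) (S : CellSeq K g ps' k qs) (T : CellSeq K g x k y)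
    (hx : x = ps') (hy : y = qs) (hT : T ≍ S) (h : ps.append x = rs) :
    cons φ T h ≍ cons φ S rfl := by
  subst hx; subst hy; subst h
  rw [eq_of_heq hT]

theorem append_nil_heq {A B A' B' : Ob} {f : A ⟶ A'} {g : B ⟶ B'} {ps : LooseChain L A B}
    {qs : LooseChain L A' B'} (S : CellSeq K f ps g qs) :
    ∀ {ps' : LooseChain L A B} {qs' : LooseChain L A' B'} (h : ps.append (.nil B) = ps')
      (h' : qs.append (.nil B') = qs'), S.append (nil g) h h' ≍ S := by
  induction S with
  | nil f => intro ps' qs' h h'; subst h; subst h'; rfl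
  | cons φ S e ih =>
    intro ps' qs' h h'
    subst h; subst h'
    subst e
    exact cons_heq φ S _ (LooseChain.append_nil _) (LooseChain.append_nil _) (ih rfl rfl) _

theorem append_nil {A B A' B' : Ob} {f : A ⟶ A'} {g : B ⟶ B'} {ps : LooseChain L A B}
    {qs : LooseChain L A' B'} (S : CellSeq K f ps g qs) (h : ps.append (.nil B) = ps)
    (h' : qs.append (.nil B') = qs) : S.append (nil g) h h' = S :=
  eq_of_heq (S.append_nil_heq h h')

end CellSeq

namespace VirtualDoubleCategory

variable {X : Type u} [VirtualDoubleCategory.{u, v, w, z} X]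

/-- A 2-cell `κ : r ⇒ p` framed by `f` and `g` is cartesian, so that `r` is the restriction
`p(f, g)`. -/
def IsCartesian {A B A' B' : X} {f : A ⟶ A'} {g : B ⟶ B'} {r : Loose A B} {p : Loose A' B'}
    (κ : Cell f (.one r) g p) : Prop :=
  ∀ {W Z : X} (h : W ⟶ A) (k : Z ⟶ B) (ps : LooseChain Loose W Z) (φ : Cell (h ≫ f) ps (k ≫ g) p),
    ∃! ψ : Cell h ps k r, cellComp (.one ψ) κ rfl rfl = φ

/-- A nullary 2-cell `ι : ⇒ I` exhibits `I` as the loose-identity on `A`. -/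
def IsLooseIdentity {A : X} {I : Loose A A} (ι : Cell (𝟙 A) (.nil A) (𝟙 A) I) : Prop :=
  ∀ {B C B' C' : X} (ps : LooseChain Loose B A) (qs : LooseChain Loose A C) (f : B ⟶ B')
    (g : C ⟶ C') (r : Loose B' C') (φ : Cell f (ps.append qs) g r),
    ∃! ψ : Cell f (ps.append (.cons I qs)) g r,
      cellComp ((CellSeq.ids idCell ps).append (.cons ι (CellSeq.ids idCell qs) rfl) rfl rfl) ψ
        (Category.id_comp f) (Category.id_comp g) = φ

/-- Composite of a 2-cell with a unary 2-cell. -/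
notation:max "comp₁" φ:max ψ:max h:max k:max => cellComp (CellSeq.one φ) ψ h k

/-- Composite of a pair of 2-cells with a binary 2-cell. -/
notation:max "comp₂" φ:max χ:max ψ:max e:max h:max k:max =>
  cellComp (CellSeq.cons φ (CellSeq.one χ) e) ψ h k

/-! ### Composition of 2-cells -/

section Calculus

variable {A B C A' B' C' A'' B'' C'' : X}

theorem comp_comp₁ {A''' B''' : X} {f : A ⟶ A'} {ps : LooseChain Loose A B} {g : B ⟶ B'}
    {qs : LooseChain Loose A' B'} {f' : A' ⟶ A''} {g' : B' ⟶ B''} {r : Loose A'' B''}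
    {k : A'' ⟶ A'''} {l : B'' ⟶ B'''} {s : Loose A''' B'''}
    {x : A' ⟶ A'''} {y : B' ⟶ B'''} {x' : A ⟶ A'''} {y' : B ⟶ B'''}
    {a : A ⟶ A''} {b : B ⟶ B''}
    (S : CellSeq Cell f ps g qs) (φ : Cell f' qs g' r) (ψ : Cell k (.one r) l s)
    (e₁ : f' ≫ k = x) (e₂ : g' ≫ l = y) (e₃ : f ≫ x = x') (e₄ : g ≫ y = y')
    (e₅ : f ≫ f' = a) (e₆ : g ≫ g' = b) :
    cellComp S (comp₁ φ ψ e₁ e₂) e₃ e₄ =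
      comp₁ (cellComp S φ e₅ e₆) ψ (by rw [← e₅, ← e₃, ← e₁, Category.assoc])
        (by rw [← e₆, ← e₄, ← e₂, Category.assoc]) := by
  subst e₁ e₂ e₃ e₄ e₅ e₆
  have := cellComp_assoc (.cons S φ (.nil g g') (LooseChain.append_nil _)
    (LooseChain.append_nil _)) ψ
  simp only [CellSeqTwo.top, CellSeqTwo.bottom, CellSeqTwo.total, CellSeq.append_nil] at this
  exact this

theorem nil_comp_nil {A''' B''' : X} {f : A ⟶ A'} {f' : A' ⟶ A''} {k : A'' ⟶ A'''} {l : A'' ⟶ B'''}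
    {s : Loose A''' B'''} {x : A' ⟶ A'''} {y : A' ⟶ B'''} {x' : A ⟶ A'''} {y' : A ⟶ B'''}
    {a : A ⟶ A''} (φ : Cell k (.nil A'') l s)
    (e₁ : f' ≫ k = x) (e₂ : f' ≫ l = y) (e₃ : f ≫ x = x') (e₄ : f ≫ y = y') (e₅ : f ≫ f' = a) :
    cellComp (.nil f) (cellComp (.nil f') φ e₁ e₂) e₃ e₄ =
      cellComp (.nil a) φ (by rw [← e₅, ← e₃, ← e₁, Category.assoc])
        (by rw [← e₅, ← e₄, ← e₂, Category.assoc]) := by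
  subst e₁ e₂ e₃ e₄ e₅
  exact cellComp_assoc (.nil f f') φ

theorem append_comp₂ {A''' C''' : X} {f : A ⟶ A'} {ps : LooseChain Loose A B} {g : B ⟶ B'}
    {ps' : LooseChain Loose A' B'} {qs : LooseChain Loose B C} {k : C ⟶ C'}
    {qs' : LooseChain Loose B' C'} {rs : LooseChain Loose A C} {rs' : LooseChain Loose A' C'}
    {f' : A' ⟶ A''} {g' : B' ⟶ B''} {k' : C' ⟶ C''} {p : Loose A'' B''} {q : Loose B'' C''}
    {l : A'' ⟶ A'''} {m : C'' ⟶ C'''} {r : Loose A''' C'''}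
    {x : A' ⟶ A'''} {y : C' ⟶ C'''} {x' : A ⟶ A'''} {y' : C ⟶ C'''}
    {a : A ⟶ A''} {b : B ⟶ B''} {c : C ⟶ C''}
    (S : CellSeq Cell f ps g ps') (S' : CellSeq Cell g qs k qs')
    (φ : Cell f' ps' g' p) (χ : Cell g' qs' k' q) (ψ : Cell l (.cons p (.one q)) m r)
    (e : ps.append qs = rs) (e' : ps'.append qs' = rs')
    (e₁ : f' ≫ l = x) (e₂ : k' ≫ m = y) (e₃ : f ≫ x = x') (e₄ : k ≫ y = y')
    (e₅ : f ≫ f' = a) (e₆ : g ≫ g' = b) (e₇ : k ≫ k' = c) :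
    cellComp (S.append S' e e') (comp₂ φ χ ψ e' e₁ e₂) e₃ e₄ =
      comp₂ (cellComp S φ e₅ e₆) (cellComp S' χ e₆ e₇) ψ e
        (by rw [← e₅, ← e₃, ← e₁, Category.assoc]) (by rw [← e₇, ← e₄, ← e₂, Category.assoc]) := by
  subst e₁ e₂ e₃ e₄ e₅ e₆ e₇
  have := cellComp_assoc (.cons S φ (.cons S' χ (.nil k k') (LooseChain.append_nil _)
    (LooseChain.append_nil _)) e e') ψ
  simp only [CellSeqTwo.top, CellSeqTwo.bottom, CellSeqTwo.total, CellSeq.append_nil] at this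
  exact this

end Calculus

end VirtualDoubleCategory

open VirtualDoubleCategory

/-- A virtual equipment: a virtual double category with loose-identities `A(1, 1)` and
restrictions `p(f, g)`. -/
class VirtualEquipment (Ob : Type u) [VirtualDoubleCategory.{u, v, w, z} Ob] where
  looseId : ∀ A : Ob, Loose A A
  looseIdCell : ∀ A : Ob, Cell (𝟙 A) (.nil A) (𝟙 A) (looseId A)
  isLooseIdentity : ∀ A : Ob, IsLooseIdentity (looseIdCell A)
  res : ∀ {A B A' B' : Ob} (_ : Loose A' B') (_ : A ⟶ A') (_ : B ⟶ B'), Loose A B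
  resCell : ∀ {A B A' B' : Ob} (p : Loose A' B') (f : A ⟶ A') (g : B ⟶ B'),
    Cell f (.one (res p f g)) g p
  isCartesian : ∀ {A B A' B' : Ob} (p : Loose A' B') (f : A ⟶ A') (g : B ⟶ B'),
    IsCartesian (resCell p f g)

namespace VirtualEquipment

variable {X : Type u} [VirtualDoubleCategory.{u, v, w, z} X] [VirtualEquipment X]

/-! ### Homs, and 2-cells into loose-identities -/

/-- The loose-cell `E(f, g)`: the restriction of the loose-identity on `E` along `f` and `g`. -/
def Hom {A B E : X} (f : A ⟶ E) (g : B ⟶ E) : Loose A B :=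
  res (looseId E) f g

/-- The cartesian 2-cell `E(f, g) ⇒ E(1, 1)`. -/
def cart {A B E : X} (f : A ⟶ E) (g : B ⟶ E) : Cell f (.one (Hom f g)) g (looseId E) :=
  resCell (looseId E) f g

/-- A 2-cell into `E(1, 1)` with frame `(f', g')`, where `f' = h ≫ f` and `g' = k ≫ g`,
corresponds to a 2-cell into `E(f, g)` with frame `(h, k)`. -/
noncomputable def lift {W Z A B E : X} {f : A ⟶ E} {g : B ⟶ E} {h : W ⟶ A} {k : Z ⟶ B}
    {f' : W ⟶ E} {g' : Z ⟶ E} {ps : LooseChain Loose W Z} (φ : Cell f' ps g' (looseId E))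
    (e : h ≫ f = f') (e' : k ≫ g = g') : Cell h ps k (Hom f g) :=
  (isCartesian (looseId E) f g h k ps (by rw [e, e']; exact φ)).choose

section Lift

variable {W Z A B E : X} {f : A ⟶ E} {g : B ⟶ E} {h : W ⟶ A} {k : Z ⟶ B}
    {f' : W ⟶ E} {g' : Z ⟶ E} {ps : LooseChain Loose W Z}

theorem lift_cart (φ : Cell f' ps g' (looseId E)) (e : h ≫ f = f') (e' : k ≫ g = g') :
    comp₁ (lift φ e e') (cart f g) e e' = φ := by
  subst e e'
  exact (isCartesian (looseId E) f g h k ps φ).choose_spec.1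

theorem cart_ext {ψ ψ' : Cell h ps k (Hom f g)} (e : h ≫ f = f') (e' : k ≫ g = g')
    (H : comp₁ ψ (cart f g) e e' = comp₁ ψ' (cart f g) e e') : ψ = ψ' := by
  subst e e'
  exact (isCartesian (looseId E) f g h k ps _).unique H rfl

theorem lift_comp_cart (ψ : Cell h ps k (Hom f g)) (e : h ≫ f = f') (e' : k ≫ g = g') :
    lift (comp₁ ψ (cart f g) e e') e e' = ψ :=
  cart_ext e e' (lift_cart _ e e')

end Lift

theorem cons_ext {B C B' C' : X} {qs : LooseChain Loose B C} {f : B ⟶ B'} {g : C ⟶ C'}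
    {r : Loose B' C'} {ψ ψ' : Cell f (.cons (looseId B) qs) g r}
    (H : cellComp (.cons (looseIdCell B) (CellSeq.ids idCell qs) rfl) ψ
        (Category.id_comp f) (Category.id_comp g) =
      cellComp (.cons (looseIdCell B) (CellSeq.ids idCell qs) rfl) ψ'
        (Category.id_comp f) (Category.id_comp g)) : ψ = ψ' :=
  (isLooseIdentity B (.nil B) qs f g r _).unique H rfl

theorem pair_ext {A B A' B' : X} {p : Loose A B} {f : A ⟶ A'} {g : B ⟶ B'}
    {r : Loose A' B'} {ψ ψ' : Cell f (.cons p (.one (looseId B))) g r}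
    (H : cellComp (.cons (idCell p) (.one (looseIdCell B)) rfl) ψ
        (Category.id_comp f) (Category.id_comp g) =
      cellComp (.cons (idCell p) (.one (looseIdCell B)) rfl) ψ'
        (Category.id_comp f) (Category.id_comp g)) : ψ = ψ' :=
  (isLooseIdentity B (.one p) (.nil B) f g r _).unique H rfl

/-- The composition `E(1, 1), E(1, 1) ⇒ E(1, 1)`. -/
noncomputable def looseIdMul (E : X) :
    Cell (𝟙 E) (.cons (looseId E) (.one (looseId E))) (𝟙 E) (looseId E) :=
  (isLooseIdentity E (.nil E) (.one (looseId E)) (𝟙 E) (𝟙 E) (looseId E)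
    (idCell (looseId E))).choose

theorem looseIdCell_looseIdMul (E : X) :
    cellComp (.cons (looseIdCell E) (CellSeq.ids idCell (.one (looseId E))) rfl) (looseIdMul E)
      (Category.id_comp _) (Category.id_comp _) = idCell (looseId E) :=
  (isLooseIdentity E (.nil E) (.one (looseId E)) (𝟙 E) (𝟙 E) (looseId E)
    (idCell (looseId E))).choose_spec.1

/-- The identity on `f`, as a nullary 2-cell into `E(1, 1)`. -/
def cellOne {A E : X} (f : A ⟶ E) : Cell f (.nil A) f (looseId E) :=
  cellComp (.nil f) (looseIdCell E) (Category.comp_id f) (Category.comp_id f)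

/-- The composite of 2-cells `ps ⇒ E(f, g)` and `qs ⇒ E(g, h)`, presented as 2-cells into
`E(1, 1)`. -/
noncomputable def cellMul {A B C E : X} {f : A ⟶ E} {g : B ⟶ E} {h : C ⟶ E}
    {ps : LooseChain Loose A B} {qs : LooseChain Loose B C} {rs : LooseChain Loose A C}
    (a : Cell f ps g (looseId E)) (b : Cell g qs h (looseId E)) (e : ps.append qs = rs) :
    Cell f rs h (looseId E) :=
  comp₂ a b (looseIdMul E) e (Category.comp_id f) (Category.comp_id h)

theorem cellMul_natural {A B C A' B' C' E : X} {f : A' ⟶ E} {g : B' ⟶ E} {h : C' ⟶ E}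
    {f' : A ⟶ A'} {g' : B ⟶ B'} {h' : C ⟶ C'} {f'' : A ⟶ E} {g'' : B ⟶ E} {h'' : C ⟶ E}
    {ps : LooseChain Loose A' B'} {qs : LooseChain Loose B' C'} {rs : LooseChain Loose A' C'}
    {ps' : LooseChain Loose A B} {qs' : LooseChain Loose B C} {rs' : LooseChain Loose A C}
    (S : CellSeq Cell f' ps' g' ps) (S' : CellSeq Cell g' qs' h' qs)
    (a : Cell f ps g (looseId E)) (b : Cell g qs h (looseId E)) (e : ps.append qs = rs)
    (e' : ps'.append qs' = rs') (e₁ : f' ≫ f = f'') (e₂ : g' ≫ g = g'') (e₃ : h' ≫ h = h'') :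
    cellComp (S.append S' e' e) (cellMul a b e) e₁ e₃ =
      cellMul (cellComp S a e₁ e₂) (cellComp S' b e₂ e₃) e' :=
  append_comp₂ S S' a b (looseIdMul E) e' e _ _ e₁ e₃ e₁ e₂ e₃

theorem cellOne_cellMul {A B E : X} {f : A ⟶ E} {g : B ⟶ E} {ps : LooseChain Loose A B}
    (a : Cell f ps g (looseId E)) (e : (LooseChain.nil A).append ps = ps) :
    cellMul (cellOne f) a e = a := by
  have h := append_comp₂ (.nil f) (.one a) (looseIdCell E) (idCell (looseId E)) (looseIdMul E)
    e rfl (Category.id_comp _) (Category.id_comp _) (Category.comp_id f) (Category.comp_id g)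
    (Category.comp_id f) (Category.comp_id f) (Category.comp_id g)
  rw [cellComp_idCell] at h
  refine h.symm.trans ?_
  have h2 := looseIdCell_looseIdMul E
  refine Eq.trans (congrArg (fun x => cellComp _ x _ _) h2) (cellComp_idCell a)

theorem looseIdMul_looseIdCell (E : X) :
    comp₂ (idCell (looseId E)) (looseIdCell E) (looseIdMul E) rfl (Category.id_comp _)
      (Category.id_comp _) = idCell (looseId E) := by
  apply cons_ext
  have h := append_comp₂ (.one (looseIdCell E)) (.nil (𝟙 E)) (idCell (looseId E)) (looseIdCell E)
    (looseIdMul E) rfl rfl (Category.id_comp _) (Category.id_comp _) (Category.id_comp _)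
    (Category.id_comp _) (Category.comp_id _) (Category.id_comp _) (Category.id_comp _)
  rw [cellComp_idCell] at h
  refine Eq.trans h ?_
  have h3 := cellOne_cellMul (looseIdCell E) rfl
  have h4 : cellOne (𝟙 E) = looseIdCell E := ids_cellComp (looseIdCell E)
  rw [h4] at h3
  have h5 : cellComp (.nil (𝟙 E)) (looseIdCell E) (Category.id_comp _) (Category.id_comp _) =
    looseIdCell E := ids_cellComp (looseIdCell E)
  rw [h5]
  exact h3.trans (cellComp_idCell (looseIdCell E)).symm

theorem cellMul_cellOne {A B E : X} {f : A ⟶ E} {g : B ⟶ E} {ps : LooseChain Loose A B}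
    (a : Cell f ps g (looseId E)) (e : ps.append (.nil B) = ps) :
    cellMul a (cellOne g) e = a := by
  have h := append_comp₂ (.one a) (.nil g) (idCell (looseId E)) (looseIdCell E) (looseIdMul E)
    e rfl (Category.id_comp _) (Category.id_comp _) (Category.comp_id f) (Category.comp_id g)
    (Category.comp_id f) (Category.comp_id g) (Category.comp_id g)
  rw [cellComp_idCell] at h
  refine h.symm.trans ?_
  refine Eq.trans (congrArg (fun x => cellComp _ x _ _) (looseIdMul_looseIdCell E)) ?_
  exact Eq.trans (congrArg (fun S => cellComp S (idCell (looseId E)) _ _)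
    (CellSeq.append_nil (.one a) e rfl)) (cellComp_idCell a)

theorem looseIdMul_assoc_aux (E : X) :
    comp₂ (looseIdMul E) (idCell (looseId E)) (looseIdMul E) rfl (Category.id_comp _) (Category.id_comp _) =
      comp₂ (idCell (looseId E)) (looseIdMul E) (looseIdMul E) rfl (Category.id_comp _) (Category.id_comp _) := by
  apply cons_ext
  have h1 := append_comp₂ (.cons (looseIdCell E) (CellSeq.ids idCell (.one (looseId E))) rfl)
    (CellSeq.ids idCell (.one (looseId E))) (looseIdMul E) (idCell (looseId E)) (looseIdMul E) rfl rfl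
    (Category.id_comp _) (Category.id_comp _) (Category.id_comp _)
    (Category.id_comp _) (Category.comp_id _) (Category.id_comp _) (Category.id_comp _)
  have h2 := append_comp₂ (.one (looseIdCell E))
    (CellSeq.ids idCell (.cons (looseId E) (.one (looseId E)))) (idCell (looseId E)) (looseIdMul E)
    (looseIdMul E) rfl rfl
    (Category.id_comp _) (Category.id_comp _) (Category.id_comp _)
    (Category.id_comp _) (Category.comp_id _) (Category.id_comp _) (Category.id_comp _)
  refine h1.trans (Eq.trans ?_ h2.symm)
  have e1 := looseIdCell_looseIdMul E
  rw [e1, cellComp_idCell, ids_cellComp, ids_cellComp]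
  have h3 := cellOne_cellMul (looseIdMul E) rfl
  have h4 : cellOne (𝟙 E) = looseIdCell E := ids_cellComp (looseIdCell E)
  rw [h4] at h3
  refine Eq.trans ?_ h3.symm
  exact ids_cellComp (looseIdMul E)

theorem cellMul_assoc {A B C D E : X} {f : A ⟶ E} {g : B ⟶ E} {h : C ⟶ E} {k : D ⟶ E}
    {ps : LooseChain Loose A B} {qs : LooseChain Loose B C} {rs : LooseChain Loose C D}
    {x : LooseChain Loose A C} {y : LooseChain Loose B D} {t : LooseChain Loose A D}
    (a : Cell f ps g (looseId E)) (b : Cell g qs h (looseId E)) (c : Cell h rs k (looseId E))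
    (e₁ : ps.append qs = x) (e₂ : x.append rs = t) (e₃ : qs.append rs = y)
    (e₄ : ps.append y = t) :
    cellMul (cellMul a b e₁) c e₂ = cellMul a (cellMul b c e₃) e₄ := by
  have h1 := append_comp₂ (.cons a (.one b) e₁) (.one c) (looseIdMul E) (idCell (looseId E)) (looseIdMul E)
    e₂ rfl (Category.id_comp _) (Category.id_comp _) (Category.comp_id _) (Category.comp_id _)
    (Category.comp_id _) (Category.comp_id _) (Category.comp_id _)
  have h2 := append_comp₂ (.one a) (.cons b (.one c) e₃) (idCell (looseId E)) (looseIdMul E) (looseIdMul E)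
    e₄ rfl (Category.id_comp _) (Category.id_comp _) (Category.comp_id _) (Category.comp_id _)
    (Category.comp_id _) (Category.comp_id _) (Category.comp_id _)
  rw [cellComp_idCell] at h1 h2
  refine h1.symm.trans (Eq.trans ?_ h2)
  subst e₁
  subst e₃
  exact congrArg (fun x => cellComp (.cons a (.cons b (.one c) rfl) e₄) x (Category.comp_id _)
    (Category.comp_id _)) (looseIdMul_assoc_aux E)

/-- The action of `u : M ⟶ E` on loose-identities, `M(1, 1) ⇒ E(1, 1)` with frame `(u, u)`. -/
noncomputable def functoriality {M E : X} (u : M ⟶ E) : Cell u (.one (looseId M)) u (looseId E) :=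
  (isLooseIdentity M (.nil M) (.nil M) u u (looseId E) (cellOne u)).choose

theorem looseIdCell_functoriality {M E : X} (u : M ⟶ E) :
    comp₁ (looseIdCell M) (functoriality u) (Category.id_comp u) (Category.id_comp u) = cellOne u :=
  (isLooseIdentity M (.nil M) (.nil M) u u (looseId E) (cellOne u)).choose_spec.1

/-- The action of `u : M ⟶ E` on 2-cells into `M(1, 1)`. -/
noncomputable def push {A B M E : X} (u : M ⟶ E) {f : A ⟶ M} {g : B ⟶ M} {f' : A ⟶ E} {g' : B ⟶ E}
    {ps : LooseChain Loose A B} (a : Cell f ps g (looseId M)) (e : f ≫ u = f') (e' : g ≫ u = g') :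
    Cell f' ps g' (looseId E) :=
  comp₁ a (functoriality u) e e'

theorem push_natural {A B A' B' M E : X} (u : M ⟶ E) {f : A' ⟶ M} {g : B' ⟶ M} {f' : A' ⟶ E}
    {g' : B' ⟶ E} {h : A ⟶ A'} {k : B ⟶ B'} {x : A ⟶ M} {y : B ⟶ M} {x' : A ⟶ E} {y' : B ⟶ E}
    {ps : LooseChain Loose A' B'} {qs : LooseChain Loose A B} (S : CellSeq Cell h qs k ps)
    (a : Cell f ps g (looseId M)) (e : f ≫ u = f') (e' : g ≫ u = g') (e₁ : h ≫ f' = x')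
    (e₂ : k ≫ g' = y') (e₃ : h ≫ f = x) (e₄ : k ≫ g = y) :
    cellComp S (push u a e e') e₁ e₂ =
      push u (cellComp S a e₃ e₄) (by rw [← e₃, ← e₁, ← e, Category.assoc])
        (by rw [← e₄, ← e₂, ← e', Category.assoc]) :=
  comp_comp₁ S a _ e e' e₁ e₂ e₃ e₄

theorem push_cellOne {A M E : X} (u : M ⟶ E) {f : A ⟶ M} {f' : A ⟶ E} (e e' : f ≫ u = f') :
    push u (cellOne f) e e' = cellOne f' := by
  have h := comp_comp₁ (.nil f) (looseIdCell M) (functoriality u) (Category.id_comp _)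
    (Category.id_comp _) e e (Category.comp_id f) (Category.comp_id f)
  refine h.symm.trans ?_
  rw [looseIdCell_functoriality]
  exact nil_comp_nil (looseIdCell E) (Category.comp_id _) (Category.comp_id _) e e e

theorem looseIdMul_functoriality {M E : X} (u : M ⟶ E) :
    comp₁ (looseIdMul M) (functoriality u) (Category.id_comp _) (Category.id_comp _) =
      cellMul (functoriality u) (functoriality u) rfl := by
  apply cons_ext
  have h1 := comp_comp₁
    (.cons (looseIdCell M) (CellSeq.ids idCell (.one (looseId M))) rfl) (looseIdMul M) (functoriality u)
    (Category.id_comp _) (Category.id_comp _) (Category.id_comp _) (Category.id_comp _)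
    (Category.id_comp _) (Category.id_comp _)
  rw [looseIdCell_looseIdMul] at h1
  have h2 := cellMul_natural (.one (looseIdCell M)) (CellSeq.ids idCell (.one (looseId M)))
    (functoriality u) (functoriality u) rfl rfl (Category.id_comp _) (Category.id_comp _)
    (Category.id_comp _)
  rw [ids_cellComp] at h2
  have e2 : cellComp (.one (looseIdCell M)) (functoriality u) (Category.id_comp u)
    (Category.id_comp u) = cellOne u := looseIdCell_functoriality u
  rw [e2] at h2
  refine h1.trans (Eq.trans ?_ h2.symm)
  have h3 := cellOne_cellMul (functoriality u) rfl
  refine Eq.trans ?_ h3.symm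
  exact ids_cellComp (functoriality u)

theorem push_cellMul {A B C M E : X} (u : M ⟶ E) {f : A ⟶ M} {g : B ⟶ M} {h : C ⟶ M}
    {f' : A ⟶ E} {g' : B ⟶ E} {h' : C ⟶ E}
    {ps : LooseChain Loose A B} {qs : LooseChain Loose B C} {rs : LooseChain Loose A C}
    (a : Cell f ps g (looseId M)) (b : Cell g qs h (looseId M)) (e : ps.append qs = rs)
    (e₁ : f ≫ u = f') (e₂ : g ≫ u = g') (e₃ : h ≫ u = h') :
    push u (cellMul a b e) e₁ e₃ = cellMul (push u a e₁ e₂) (push u b e₂ e₃) e := by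
  have h1 := comp_comp₁ (.cons a (.one b) e) (looseIdMul M) (functoriality u) (Category.id_comp _)
    (Category.id_comp _) e₁ e₃ (Category.comp_id _) (Category.comp_id _)
  refine h1.symm.trans ?_
  rw [looseIdMul_functoriality]
  exact cellMul_natural (.one a) (.one b) (functoriality u) (functoriality u) rfl e e₁ e₂ e₃

/-! ### Actions of 2-cells between homs -/

/-- The action of a 2-cell `φ : E(f, g) ⇒ E'(f', g')` on 2-cells into `E(f, g)`, the latter
presented as 2-cells `a` into `E(1, 1)` with frame `(f, k ≫ g)`. -/
noncomputable def act {A B C E E' : X} {f : A ⟶ E} {g : C ⟶ E} {f' : A ⟶ E'} {g' : C ⟶ E'}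
    (φ : Cell (𝟙 A) (.one (Hom f g)) (𝟙 C) (Hom f' g')) {k : B ⟶ C} {x : B ⟶ E} {x' : B ⟶ E'}
    {ps : LooseChain Loose A B} (a : Cell f ps x (looseId E)) (e : k ≫ g = x) (e' : k ≫ g' = x') :
    Cell f' ps x' (looseId E') :=
  comp₁ (lift a (Category.id_comp f) e)
    (comp₁ φ (cart f' g') (Category.id_comp f') (Category.id_comp g')) (Category.id_comp f') e'

section Act

variable {A B C E E' : X} {f : A ⟶ E} {g : C ⟶ E} {f' : A ⟶ E'} {g' : C ⟶ E'}
  (φ : Cell (𝟙 A) (.one (Hom f g)) (𝟙 C) (Hom f' g')) {k : B ⟶ C} {x : B ⟶ E} {x' : B ⟶ E'}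

theorem act_natural {B' : X} {l : B' ⟶ B} {y : B' ⟶ E} {y' : B' ⟶ E'} {m : B' ⟶ C}
    {ps : LooseChain Loose A B} {qs : LooseChain Loose A B'} (S : CellSeq Cell (𝟙 A) qs l ps)
    (a : Cell f ps x (looseId E)) (e : k ≫ g = x) (e' : k ≫ g' = x') (e₁ : l ≫ x' = y')
    (e₂ : l ≫ x = y) (e₃ : l ≫ k = m) :
    cellComp S (act φ a e e') (Category.id_comp f') e₁ =
      act φ (k := m) (cellComp S a (Category.id_comp f) e₂)
        (by rw [← e₃, ← e₂, ← e, Category.assoc]) (by rw [← e₃, ← e₁, ← e', Category.assoc]) := by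
  have h1 := comp_comp₁ S (lift a (Category.id_comp f) e)
    (comp₁ φ (cart f' g') (Category.id_comp f') (Category.id_comp g')) (Category.id_comp f') e'
    (Category.id_comp f') e₁ (Category.id_comp _) e₃
  refine h1.trans ?_
  unfold act
  congr 2
  apply cart_ext (Category.id_comp f) (g' := y) (by rw [← e₃, ← e₂, ← e, Category.assoc])
  rw [lift_cart]
  have h2 := comp_comp₁ S (lift a (Category.id_comp f) e) (cart f g) (Category.id_comp f) e
    (Category.id_comp f) e₂ (Category.id_comp _) e₃
  rw [← h2, lift_cart]

theorem act_comp_cart {ps : LooseChain Loose A B} (ψ : Cell (𝟙 A) ps k (Hom f g))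
    (e : k ≫ g = x) (e' : k ≫ g' = x') :
    act φ (comp₁ ψ (cart f g) (Category.id_comp f) e) e e' =
      comp₁ ψ (comp₁ φ (cart f' g') (Category.id_comp f') (Category.id_comp g'))
        (Category.id_comp f') e' := by
  unfold act
  rw [lift_comp_cart]

theorem act_cart : act φ (cart f g) (Category.id_comp g) (Category.id_comp g') =
    comp₁ φ (cart f' g') (Category.id_comp f') (Category.id_comp g') := by
  have h := act_comp_cart φ (idCell (Hom f g)) (Category.id_comp g) (Category.id_comp g')
  have h1 : comp₁ (idCell (Hom f g)) (cart f g) (Category.id_comp f) (Category.id_comp g) =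
    cart f g := ids_cellComp _
  rw [h1] at h
  exact h.trans (ids_cellComp _)

theorem act_cellMul_push {D : X} {l : D ⟶ C} {y : D ⟶ E} {y' : D ⟶ E'}
    {ps : LooseChain Loose A B} {qs : LooseChain Loose B D} {rs : LooseChain Loose A D}
    (a : Cell f ps x (looseId E)) (b : Cell k qs l (looseId C)) (h : ps.append qs = rs)
    (e : k ≫ g = x) (e' : k ≫ g' = x') (e₁ : l ≫ g = y) (e₁' : l ≫ g' = y') :
    act φ (cellMul a (push g b e e₁) h) e₁ e₁' =
      cellMul (act φ a e e') (push g' b e' e₁') h := by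
  have univ : act φ (cellMul (cart f g) (functoriality g)
      (rs := .cons (Hom f g) (.one (looseId C))) rfl) (Category.id_comp g) (Category.id_comp g') =
        cellMul (act φ (cart f g) (Category.id_comp g) (Category.id_comp g')) (functoriality g') rfl := by
    apply pair_ext
    have h1 := act_natural φ (.cons (idCell (Hom f g)) (.one (looseIdCell C)) rfl)
      (cellMul (cart f g) (functoriality g) (rs := .cons (Hom f g) (.one (looseId C))) rfl) (Category.id_comp g) (Category.id_comp g')
      (Category.id_comp _) (Category.id_comp _) (Category.id_comp _)
    refine h1.trans ?_
    have h2 := cellMul_natural (.one (idCell (Hom f g))) (.one (looseIdCell C))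
      (cart f g) (functoriality g) (rs := .cons (Hom f g) (.one (looseId C)))
      (rs' := .one (Hom f g)) rfl (LooseChain.append_nil _) (Category.id_comp _) (Category.id_comp _)
      (Category.id_comp _)
    have h3 := cellMul_natural (.one (idCell (Hom f g))) (.one (looseIdCell C))
      (act φ (cart f g) (Category.id_comp g) (Category.id_comp g')) (functoriality g')
      (rs := .cons (Hom f g) (.one (looseId C))) (rs' := .one (Hom f g)) rfl (LooseChain.append_nil _)
      (Category.id_comp _) (Category.id_comp _) (Category.id_comp _)
    have h4 : comp₁ (idCell (Hom f g)) (cart f g) (Category.id_comp f) (Category.id_comp g) =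
      cart f g := ids_cellComp _
    have h5 := ids_cellComp (act φ (cart f g) (Category.id_comp g) (Category.id_comp g'))
    rw [looseIdCell_functoriality, h4] at h2
    rw [looseIdCell_functoriality] at h3
    refine Eq.trans ?_ (h3.trans ((cellMul_cellOne _ _).trans h5)).symm
    exact congrArg (fun z => act φ z (Category.id_comp g) (Category.id_comp g')) (h2.trans (cellMul_cellOne _ _))
  have h1 := act_natural φ (.cons (lift a (Category.id_comp f) e) (.one b) h)
      (cellMul (cart f g) (functoriality g) (rs := .cons (Hom f g) (.one (looseId C))) rfl) (Category.id_comp g) (Category.id_comp g')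
      e₁' e₁ (Category.comp_id l)
  have h2 := cellMul_natural (.one (lift a (Category.id_comp f) e)) (.one b)
      (cart f g) (functoriality g) (rs := .cons (Hom f g) (.one (looseId C))) rfl h (Category.id_comp _) e e₁
  have h3 := cellMul_natural (.one (lift a (Category.id_comp f) e)) (.one b)
      (act φ (cart f g) (Category.id_comp g) (Category.id_comp g')) (functoriality g')
      (rs := .cons (Hom f g) (.one (looseId C))) rfl h
      (Category.id_comp _) e' e₁'
  rw [lift_cart] at h2
  rw [univ] at h1
  refine Eq.trans ?_ (h1.symm.trans ?_)
  · exact congrArg (fun z => act φ z e₁ e₁') h2.symm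
  · refine h3.trans ?_
    rw [act_cart]
    rfl

end Act

/-- Two 2-cells out of `E(f, g)` are equal when they act in the same way. -/
theorem comp_cart_eq_act {A C E E' : X} {f : A ⟶ E} {g : C ⟶ E} {f' : A ⟶ E'} {g' : C ⟶ E'}
    {φ ψ : Cell (𝟙 A) (.one (Hom f g)) (𝟙 C) (Hom f' g')}
    (H : act φ (cart f g) (Category.id_comp g) (Category.id_comp g') =
      act ψ (cart f g) (Category.id_comp g) (Category.id_comp g')) : φ = ψ := by
  rw [act_cart, act_cart] at H
  exact cart_ext _ _ H

theorem act_lift {A B C E E' : X} {f : A ⟶ E} {g : C ⟶ E} {f' : A ⟶ E'} {g' : C ⟶ E'}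
    (Φ : Cell f' (.one (Hom f g)) g' (looseId E')) {k : B ⟶ C} {x : B ⟶ E} {x' : B ⟶ E'}
    {ps : LooseChain Loose A B} (a : Cell f ps x (looseId E)) (e : k ≫ g = x) (e' : k ≫ g' = x') :
    act (lift Φ (Category.id_comp f') (Category.id_comp g')) a e e' =
      comp₁ (lift a (Category.id_comp f) e) Φ (Category.id_comp f') e' := by
  unfold act
  rw [lift_cart]

theorem act_act {A B C E E' E'' : X} {f : A ⟶ E} {g : C ⟶ E} {f' : A ⟶ E'} {g' : C ⟶ E'}
    {f'' : A ⟶ E''} {g'' : C ⟶ E''}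
    (φ : Cell (𝟙 A) (.one (Hom f g)) (𝟙 C) (Hom f' g'))
    (ψ : Cell (𝟙 A) (.one (Hom f' g')) (𝟙 C) (Hom f'' g''))
    {k : B ⟶ C} {x : B ⟶ E} {x' : B ⟶ E'} {x'' : B ⟶ E''}
    {ps : LooseChain Loose A B} (a : Cell f ps x (looseId E)) (e : k ≫ g = x) (e' : k ≫ g' = x')
    (e'' : k ≫ g'' = x'') :
    act (comp₁ φ ψ (Category.id_comp (𝟙 A)) (Category.id_comp (𝟙 C))) a e e'' =
      act ψ (act φ a e e') e' e'' := by
  have h1 : act φ a e e' = comp₁ (comp₁ (lift a (Category.id_comp f) e) φ (Category.id_comp _)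
      (Category.comp_id k)) (cart f' g') (Category.id_comp f') e' :=
    comp_comp₁ _ φ (cart f' g') _ _ _ _ _ _
  rw [h1, act_comp_cart]
  have h2 := comp_comp₁ (.one φ) ψ (cart f'' g'') (Category.id_comp _) (Category.id_comp _)
    (Category.id_comp _) (Category.id_comp _) (Category.id_comp (𝟙 A)) (Category.id_comp (𝟙 C))
  have h3 := comp_comp₁ (.one (lift a (Category.id_comp f) e)) φ
    (comp₁ ψ (cart f'' g'') (Category.id_comp f'') (Category.id_comp g''))
    (Category.id_comp _) (Category.id_comp _) (Category.id_comp _) e'' (Category.id_comp _)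
    (Category.comp_id k)
  unfold act
  rw [← h3, ← h2]

theorem act_id {A B C E : X} {f : A ⟶ E} {g : C ⟶ E} {k : B ⟶ C} {x : B ⟶ E}
    {ps : LooseChain Loose A B} (a : Cell f ps x (looseId E)) (e : k ≫ g = x) :
    act (idCell (Hom f g)) a e e = a := by
  have h : comp₁ (idCell (Hom f g)) (cart f g) (Category.id_comp f) (Category.id_comp g) =
    cart f g := ids_cellComp _
  unfold act
  rw [h, lift_cart]

/-- The composition `E(f, g), E(g, h) ⇒ E(f, h)`. -/
noncomputable def compHom {A B C E : X} (f : A ⟶ E) (g : B ⟶ E) (h : C ⟶ E) :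
    Cell (𝟙 A) (.cons (Hom f g) (.one (Hom g h))) (𝟙 C) (Hom f h) :=
  lift (cellMul (cart f g) (cart g h) rfl) (Category.id_comp f) (Category.id_comp h)

/-- The identity `⇒ E(f, f)`. -/
noncomputable def idHom {A E : X} (f : A ⟶ E) : Cell (𝟙 A) (.nil A) (𝟙 A) (Hom f f) :=
  lift (cellOne f) (Category.id_comp f) (Category.id_comp f)

/-- The action `M(f, g) ⇒ E(f', g')` of `u : M ⟶ E`, where `f' = f ≫ u` and `g' = g ≫ u`. -/
noncomputable def mapHom {A B M E : X} (u : M ⟶ E) (f : A ⟶ M) (g : B ⟶ M) {f' : A ⟶ E}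
    {g' : B ⟶ E} (e : f ≫ u = f') (e' : g ≫ u = g') :
    Cell (𝟙 A) (.one (Hom f g)) (𝟙 B) (Hom f' g') :=
  lift (push u (cart f g) e e') (Category.id_comp f') (Category.id_comp g')

/-- 2-cells `f ⇒ g` between tight-cells. -/
abbrev TightTwoCell {A E : X} (f g : A ⟶ E) : Type z :=
  Cell f (.nil A) g (looseId E)

/-- The 2-cell `⇒ E(f, g)` corresponding to a 2-cell `f ⇒ g`. -/
noncomputable def nameCell {A E : X} {f g : A ⟶ E} (η : TightTwoCell f g) :
    Cell (𝟙 A) (.nil A) (𝟙 A) (Hom f g) :=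
  lift η (Category.id_comp f) (Category.id_comp g)

/-- The 2-cell `E(η, h) : E(g, h) ⇒ E(f, h)` given by precomposition with `η : f ⇒ g`. -/
noncomputable def preHom {A B E : X} {f g : A ⟶ E} (η : TightTwoCell f g) (h : B ⟶ E) :
    Cell (𝟙 A) (.one (Hom g h)) (𝟙 B) (Hom f h) :=
  lift (cellMul η (cart g h) (LooseChain.nil_append _)) (Category.id_comp f) (Category.id_comp h)

/-- The restriction `φ(1, h) : E(f, x) ⇒ E'(f', x')` of a 2-cell `φ : E(f, g) ⇒ E'(f', g')`,
where `x = h ≫ g` and `x' = h ≫ g'`. -/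
noncomputable def resRight {A B C E E' : X} {f : A ⟶ E} {g : C ⟶ E} {f' : A ⟶ E'} {g' : C ⟶ E'}
    (φ : Cell (𝟙 A) (.one (Hom f g)) (𝟙 C) (Hom f' g')) (h : B ⟶ C) {x : B ⟶ E} {x' : B ⟶ E'}
    (e : h ≫ g = x) (e' : h ≫ g' = x') : Cell (𝟙 A) (.one (Hom f x)) (𝟙 B) (Hom f' x') :=
  lift (act φ (cart f x) e e') (Category.id_comp f') (Category.id_comp x')

theorem act_resRight {A B B' C E E' : X} {f : A ⟶ E} {g : C ⟶ E} {f' : A ⟶ E'} {g' : C ⟶ E'}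
    (φ : Cell (𝟙 A) (.one (Hom f g)) (𝟙 C) (Hom f' g')) (h : B ⟶ C) {x : B ⟶ E} {x' : B ⟶ E'}
    (e : h ≫ g = x) (e' : h ≫ g' = x') {k : B' ⟶ B} {y : B' ⟶ E} {y' : B' ⟶ E'}
    {ps : LooseChain Loose A B'} (a : Cell f ps y (looseId E)) (e₁ : k ≫ x = y) (e₂ : k ≫ x' = y')
    {l : B' ⟶ C} (e₃ : k ≫ h = l) :
    act (resRight φ h e e') a e₁ e₂ = act φ a (k := l)
      (by rw [← e₃, Category.assoc, e, e₁]) (by rw [← e₃, Category.assoc, e', e₂]) := by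
  unfold resRight
  rw [act_lift, act_natural φ _ _ e e' e₂ e₁ e₃, lift_cart]

theorem act_mapHom {A B B' M E : X} (u : M ⟶ E) (f : A ⟶ M) (g : B ⟶ M) {f' : A ⟶ E}
    {g' : B ⟶ E} (e : f ≫ u = f') (e' : g ≫ u = g') {k : B' ⟶ B} {y : B' ⟶ M} {y' : B' ⟶ E}
    {ps : LooseChain Loose A B'} (a : Cell f ps y (looseId M)) (e₁ : k ≫ g = y)
    (e₂ : k ≫ g' = y') :
    act (mapHom u f g e e') a e₁ e₂ = push u a e (by rw [← e₁, ← e₂, ← e', Category.assoc]) := by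
  unfold mapHom
  rw [act_lift, push_natural u _ _ e e' _ e₂ (Category.id_comp f) e₁, lift_cart]

theorem act_preHom {A B B' E : X} {f g : A ⟶ E} (η : TightTwoCell f g) (h : B ⟶ E)
    {k : B' ⟶ B} {y : B' ⟶ E} {ps : LooseChain Loose A B'} (a : Cell g ps y (looseId E))
    (e : k ≫ h = y) : act (preHom η h) a e e = cellMul (rs := ps) η a (LooseChain.nil_append _) := by
  unfold preHom
  rw [act_lift]
  have h1 := cellMul_natural (.nil (𝟙 A)) (.one (lift a (Category.id_comp g) e)) η (cart g h)
    (rs := .one (Hom g h)) (rs' := ps) rfl rfl (Category.id_comp f) (Category.id_comp g) e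
  rw [lift_cart] at h1
  have h2 : cellComp (.nil (𝟙 A)) η (Category.id_comp f) (Category.id_comp g) = η :=
    ids_cellComp η
  rw [h2] at h1
  exact h1

theorem comp₂_compHom {A B C A' B' C' E : X} {f : A' ⟶ E} {g : B' ⟶ E} {h : C' ⟶ E}
    {k : A ⟶ A'} {l : B ⟶ B'} {m : C ⟶ C'} {x : A ⟶ E} {y : B ⟶ E} {w : C ⟶ E}
    {ps : LooseChain Loose A B} {qs : LooseChain Loose B C} {rs : LooseChain Loose A C}
    (α : Cell k ps l (Hom f g)) (β : Cell l qs m (Hom g h)) (e : ps.append qs = rs)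
    (e₁ : k ≫ f = x) (e₂ : l ≫ g = y) (e₃ : m ≫ h = w) :
    comp₁ (comp₂ α β (compHom f g h) e (Category.comp_id k) (Category.comp_id m)) (cart f h) e₁ e₃ =
      cellMul (comp₁ α (cart f g) e₁ e₂) (comp₁ β (cart g h) e₂ e₃) e := by
  have h1 := comp_comp₁ (.cons α (.one β) e) (compHom f g h) (cart f h) (Category.id_comp f)
    (Category.id_comp h) e₁ e₃ (Category.comp_id k) (Category.comp_id m)
  refine h1.symm.trans ?_
  unfold compHom
  rw [lift_cart]
  exact cellMul_natural (.one α) (.one β) (cart f g) (cart g h) rfl e e₁ e₂ e₃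

/-! ### The algebra laws in terms of 2-cells into loose-identities -/

section Laws

variable {A D E : X} {j t : A ⟶ E} {d : D ⟶ E}

theorem unit_law_iff (η : TightTwoCell j t)
    (φ : Cell (𝟙 A) (.one (Hom j d)) (𝟙 D) (Hom t d)) :
    comp₁ φ (preHom η d) (Category.id_comp _) (Category.id_comp _) = idCell (Hom j d) ↔
      cellMul (rs := .one (Hom j d)) η
        (act φ (cart j d) (Category.id_comp d) (Category.id_comp d)) (LooseChain.nil_append _) = cart j d := by
  have key : act (comp₁ φ (preHom η d) (Category.id_comp _) (Category.id_comp _)) (cart j d)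
      (Category.id_comp d) (Category.id_comp d) =
      cellMul (rs := .one (Hom j d)) η
        (act φ (cart j d) (Category.id_comp d) (Category.id_comp d)) (LooseChain.nil_append _) := by
    rw [act_act φ (preHom η d) (cart j d) _ (Category.id_comp d), act_preHom]
  rw [← key]
  constructor
  · intro h
    rw [h, act_id]
  · intro h
    apply comp_cart_eq_act
    rw [h, act_id]

theorem unit_law_general (η : TightTwoCell j t)
    (φ : Cell (𝟙 A) (.one (Hom j d)) (𝟙 D) (Hom t d))
    (H : comp₁ φ (preHom η d) (Category.id_comp _) (Category.id_comp _) = idCell (Hom j d))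
    {B : X} {k : B ⟶ D} {x : B ⟶ E} {ps : LooseChain Loose A B} (y : Cell j ps x (looseId E))
    (e : k ≫ d = x) : cellMul (rs := ps) η (act φ y e e) (LooseChain.nil_append _) = y := by
  rw [← act_preHom η d (act φ y e e) e, ← act_act φ (preHom η d) y e e e, H, act_id]

theorem ext_law_iff (τ : Cell (𝟙 A) (.one (Hom j t)) (𝟙 A) (Hom t t))
    (φ : Cell (𝟙 A) (.one (Hom j d)) (𝟙 D) (Hom t d)) :
    comp₁ (comp₂ (idCell (Hom j t)) φ (compHom j t d) rfl (Category.id_comp _)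
        (Category.id_comp _)) φ (Category.id_comp _) (Category.id_comp _) =
      comp₂ τ φ (compHom t t d) rfl (Category.id_comp _) (Category.id_comp _) ↔
    act φ (cellMul (cart j t) (act φ (cart j d) (Category.id_comp d) (Category.id_comp d)) rfl)
        (Category.id_comp d) (Category.id_comp d) =
      cellMul (act τ (cart j t) (Category.id_comp t) (Category.id_comp t))
        (act φ (cart j d) (Category.id_comp d) (Category.id_comp d)) rfl := by
  have h0 : comp₁ (idCell (Hom j t)) (cart j t) (Category.id_comp j) (Category.id_comp t) =
    cart j t := ids_cellComp _
  have h1 := comp₂_compHom (idCell (Hom j t)) φ rfl (Category.id_comp j) (Category.id_comp t)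
    (Category.id_comp d)
  have h2 := comp₂_compHom τ φ rfl (Category.id_comp t) (Category.id_comp t) (Category.id_comp d)
  rw [h0] at h1
  rw [act_cart, act_cart, ← h2, ← h1, act_comp_cart]
  rw [comp_comp₁ _ φ (cart t d) _ _ _ _ (Category.id_comp _) (Category.id_comp _)]
  constructor
  · intro h
    exact congrArg (fun z => comp₁ z (cart t d) (Category.id_comp t) (Category.id_comp d)) h
  · intro h
    exact cart_ext _ _ h

theorem ext_law_general (τ : Cell (𝟙 A) (.one (Hom j t)) (𝟙 A) (Hom t t))
    (φ : Cell (𝟙 A) (.one (Hom j d)) (𝟙 D) (Hom t d))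
    (H : comp₁ (comp₂ (idCell (Hom j t)) φ (compHom j t d) rfl (Category.id_comp _)
        (Category.id_comp _)) φ (Category.id_comp _) (Category.id_comp _) =
      comp₂ τ φ (compHom t t d) rfl (Category.id_comp _) (Category.id_comp _))
    {B : X} {k : B ⟶ D} {x : B ⟶ E} {ps : LooseChain Loose A A} {qs : LooseChain Loose A B}
    {rs : LooseChain Loose A B}
    (a : Cell j ps t (looseId E)) (y : Cell j qs x (looseId E)) (h : ps.append qs = rs)
    (e : k ≫ d = x) :
    act φ (cellMul a (act φ y e e) h) e e =
      cellMul (act τ a (Category.id_comp t) (Category.id_comp t)) (act φ y e e) h := by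
  rw [ext_law_iff] at H
  let S : CellSeq Cell (𝟙 A) ps (𝟙 A) (.one (Hom j t)) :=
    .one (lift a (Category.id_comp j) (Category.id_comp t))
  let S' : CellSeq Cell (𝟙 A) qs k (.one (Hom j d)) := .one (lift y (Category.id_comp j) e)
  have hy : cellComp S' (act φ (cart j d) (Category.id_comp d) (Category.id_comp d))
      (Category.id_comp t) e = act φ y e e := by
    rw [act_natural φ S' _ _ _ e e (Category.comp_id k)]
    congr 1
    exact lift_cart y _ _
  have ha : cellComp S (act τ (cart j t) (Category.id_comp t) (Category.id_comp t))
      (Category.id_comp t) (Category.id_comp t) =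
      act τ a (Category.id_comp t) (Category.id_comp t) := by
    rw [act_natural τ S _ _ _ (Category.id_comp t) (Category.id_comp t) (Category.comp_id _)]
    congr 1
    exact lift_cart a _ _
  have ha' : cellComp S (cart j t) (Category.id_comp j) (Category.id_comp t) = a :=
    lift_cart a _ _
  have h1 := cellMul_natural S S' (act τ (cart j t) (Category.id_comp t) (Category.id_comp t))
    (act φ (cart j d) (Category.id_comp d) (Category.id_comp d)) rfl h (Category.id_comp t)
    (Category.id_comp t) e
  have h2 := cellMul_natural S S' (cart j t)
    (act φ (cart j d) (Category.id_comp d) (Category.id_comp d)) rfl h (Category.id_comp j)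
    (Category.id_comp t) e
  rw [ha, hy, ← H] at h1
  rw [ha', hy] at h2
  rw [← h1, ← h2, act_natural φ _ _ _ _ e e (Category.comp_id k)]

end Laws

theorem functoriality_id (E : X) : functoriality (𝟙 E) = idCell (looseId E) := by
  apply cons_ext
  have h1 := looseIdCell_functoriality (𝟙 E)
  have h2 : cellOne (𝟙 E) = looseIdCell E := ids_cellComp (looseIdCell E)
  exact h1.trans (h2.trans (cellComp_idCell (looseIdCell E)).symm)

theorem push_id {A B E : X} {f : A ⟶ E} {g : B ⟶ E} {ps : LooseChain Loose A B}
    (a : Cell f ps g (looseId E)) (e : f ≫ 𝟙 E = f) (e' : g ≫ 𝟙 E = g) : push (𝟙 E) a e e' = a := by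
  unfold push
  rw [functoriality_id, cellComp_idCell]

end VirtualEquipment

open VirtualEquipment

section RelativeMonads

variable {X : Type u} [VirtualDoubleCategory.{u, v, w, z} X] [VirtualEquipment X]

/-- A relative monad with root `j`. -/
structure RelativeMonad {A E : X} (j : A ⟶ E) where
  carrier : A ⟶ E
  unit : TightTwoCell j carrier
  /-- The extension operator `E(j, t) ⇒ E(t, t)`. -/
  ext : Cell (𝟙 A) (.one (Hom j carrier)) (𝟙 A) (Hom carrier carrier)
  ext_unit : comp₁ ext (preHom unit carrier) (Category.id_comp _) (Category.id_comp _) =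
    idCell (Hom j carrier)
  unit_ext : comp₁ (nameCell unit) ext (Category.id_comp _) (Category.id_comp _) = idHom carrier
  assoc : comp₁ (comp₂ (idCell (Hom j carrier)) ext (compHom j carrier carrier) rfl
      (Category.id_comp _) (Category.id_comp _)) ext (Category.id_comp _) (Category.id_comp _) =
    comp₂ ext ext (compHom carrier carrier carrier) rfl (Category.id_comp _) (Category.id_comp _)

/-- An algebra with domain `D` for a relative monad. -/
structure RelativeMonad.Algebra {A E : X} {j : A ⟶ E} (T : RelativeMonad j) (D : X) where
  carrier : D ⟶ E
  /-- The extension operator `E(j, e) ⇒ E(t, e)`. -/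
  ext : Cell (𝟙 A) (.one (Hom j carrier)) (𝟙 D) (Hom T.carrier carrier)
  ext_unit : comp₁ ext (preHom T.unit carrier) (Category.id_comp _) (Category.id_comp _) =
    idCell (Hom j carrier)
  assoc : comp₁ (comp₂ (idCell (Hom j T.carrier)) ext (compHom j T.carrier carrier) rfl
      (Category.id_comp _) (Category.id_comp _)) ext (Category.id_comp _) (Category.id_comp _) =
    comp₂ T.ext ext (compHom T.carrier T.carrier carrier) rfl (Category.id_comp _)
      (Category.id_comp _)

/-- The restriction `E(f, e), p₁, …, pₙ ⇒ E(f, e')` along `f` of a 2-cell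
`E(1, e), p₁, …, pₙ ⇒ E(1, e')`. -/
noncomputable def resLeft {A D D' E : X} {e : D ⟶ E} {e' : D' ⟶ E} {ps : LooseChain Loose D D'}
    (ε : Cell (𝟙 E) (.cons (Hom (𝟙 E) e) ps) (𝟙 D') (Hom (𝟙 E) e')) (f : A ⟶ E) :
    Cell (𝟙 A) (.cons (Hom f e) ps) (𝟙 D') (Hom f e') :=
  lift (cellComp
      (.cons (lift (cart f e) (Category.comp_id f) (Category.id_comp e) :
        Cell f (.one (Hom f e)) (𝟙 D) (Hom (𝟙 E) e)) (CellSeq.ids idCell ps) rfl)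
      (comp₁ ε (cart (𝟙 E) e') (Category.id_comp (𝟙 E)) (Category.id_comp e'))
      (Category.comp_id f) (Category.id_comp e'))
    (Category.id_comp f) (Category.id_comp e')

/-- A `(p₁, …, pₙ)`-graded morphism of algebras: a 2-cell `E(1, e), p₁, …, pₙ ⇒ E(1, e')`
compatible with the extension operators. -/
structure GradedMorphism {A E : X} {j : A ⟶ E} {T : RelativeMonad j} {D D' : X}
    (a : T.Algebra D) (b : T.Algebra D') (ps : LooseChain Loose D D') where
  cell : Cell (𝟙 E) (.cons (Hom (𝟙 E) a.carrier) ps) (𝟙 D') (Hom (𝟙 E) b.carrier)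
  compat : comp₁ (resLeft cell j) b.ext (Category.id_comp _) (Category.id_comp _) =
    cellComp (.cons a.ext (CellSeq.ids idCell ps) rfl) (resLeft cell T.carrier)
      (Category.id_comp _) (Category.id_comp _)

/-- The 2-cell `E(1, e), p₁, …, pₙ ⇒ E(1, e')` corresponding to `p₁, …, pₙ ⇒ E(e, e')`. -/
noncomputable def expand {D D' E : X} {e : D ⟶ E} {e' : D' ⟶ E} {ps : LooseChain Loose D D'}
    (φ : Cell (𝟙 D) ps (𝟙 D') (Hom e e')) :
    Cell (𝟙 E) (.cons (Hom (𝟙 E) e) ps) (𝟙 D') (Hom (𝟙 E) e') :=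
  comp₂ (idCell (Hom (𝟙 E) e)) φ (compHom (𝟙 E) e e') rfl (Category.id_comp _) (Category.id_comp _)

/-- The 2-cell `p₁, …, pₙ ⇒ E(e, e')` corresponding to `E(1, e), p₁, …, pₙ ⇒ E(1, e')`, given by
evaluation at the identity on `e`. -/
noncomputable def extract {D D' E : X} {e : D ⟶ E} {e' : D' ⟶ E} {ps : LooseChain Loose D D'}
    (ε : Cell (𝟙 E) (.cons (Hom (𝟙 E) e) ps) (𝟙 D') (Hom (𝟙 E) e')) :
    Cell (𝟙 D) ps (𝟙 D') (Hom e e') :=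
  lift (cellComp
      (.cons (lift (cellOne e) (Category.comp_id e) (Category.id_comp e) :
        Cell e (.nil D) (𝟙 D) (Hom (𝟙 E) e)) (CellSeq.ids idCell ps) rfl)
      (comp₁ ε (cart (𝟙 E) e') (Category.id_comp (𝟙 E)) (Category.id_comp e'))
      (Category.comp_id e) (Category.id_comp e'))
    (Category.id_comp e) (Category.id_comp e')

/-- Postcomposition by `u : M ⟶ E` of a 2-cell `σ : M(1, x), p₁, …, pₙ ⇒ M(1, x')`: the 2-cell
`E(1, e), p₁, …, pₙ ⇒ E(1, e')`, where `e = x ≫ u` and `e' = x' ≫ u`, that corresponds to the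
composite of `p₁, …, pₙ ⇒ M(x, x')` with the action `M(x, x') ⇒ E(e, e')` of `u`. -/
noncomputable def whisker {D D' M E : X} (u : M ⟶ E) {x : D ⟶ M} {x' : D' ⟶ M} {e : D ⟶ E}
    {e' : D' ⟶ E} (h : x ≫ u = e) (h' : x' ≫ u = e') {ps : LooseChain Loose D D'}
    (σ : Cell (𝟙 M) (.cons (Hom (𝟙 M) x) ps) (𝟙 D') (Hom (𝟙 M) x')) :
    Cell (𝟙 E) (.cons (Hom (𝟙 E) e) ps) (𝟙 D') (Hom (𝟙 E) e') :=
  expand (comp₁ (extract σ) (mapHom u x x' h h') (Category.id_comp _) (Category.id_comp _))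

namespace RelativeMonad

variable {A E : X} {j : A ⟶ E} {T : RelativeMonad j}

/-- A tight-cell `h` into the domain of an algebra `(u, υ)` mediates an algebra `(e, α)` when
`h ≫ u = e` and `υ(1, h) = α`. -/
def Algebra.Mediates {M D : X} (U : T.Algebra M) (a : T.Algebra D) (h : D ⟶ M) : Prop :=
  ∃ e : h ≫ U.carrier = a.carrier, resRight U.ext h e e = a.ext

/-- Algebra objects. -/
structure IsAlgebraObject {M : X} (U : T.Algebra M) : Prop where
  existsUnique_tight : ∀ {D : X} (a : T.Algebra D), ∃! h : D ⟶ M, U.Mediates a h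
  existsUnique_cell : ∀ {D D' : X} (a : T.Algebra D) (b : T.Algebra D') {h : D ⟶ M} {h' : D' ⟶ M}
    (m : U.Mediates a h) (m' : U.Mediates b h') {ps : LooseChain Loose D D'}
    (ε : GradedMorphism a b ps),
    ∃! σ : Cell (𝟙 M) (.cons (Hom (𝟙 M) h) ps) (𝟙 D') (Hom (𝟙 M) h'),
      whisker U.carrier m.choose m'.choose σ = ε.cell

end RelativeMonad

/-- A relative adjunction `l ⊣ r` with root `j`. -/
structure RelativeAdjunction {A C E : X} (j : A ⟶ E) (l : A ⟶ C) (r : C ⟶ E) where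
  /-- The transposition operator `C(l, 1) ⇒ E(j, r)`. -/
  sharp : Cell (𝟙 A) (.one (Hom l (𝟙 C))) (𝟙 C) (Hom j r)
  /-- The transposition operator `E(j, r) ⇒ C(l, 1)`. -/
  flat : Cell (𝟙 A) (.one (Hom j r)) (𝟙 C) (Hom l (𝟙 C))
  sharp_flat : comp₁ sharp flat (Category.id_comp _) (Category.id_comp _) = idCell _
  flat_sharp : comp₁ flat sharp (Category.id_comp _) (Category.id_comp _) = idCell _

namespace RelativeAdjunction

variable {A C E : X} {j : A ⟶ E} {l : A ⟶ C} {r : C ⟶ E} (adj : RelativeAdjunction j l r)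

theorem act_flat_sharp {B : X} {ps : LooseChain Loose A B} {x : B ⟶ C} {y : B ⟶ E}
    (a : Cell l ps x (looseId C)) (e : x ≫ 𝟙 C = x) (e' : x ≫ r = y) :
    act adj.flat (act adj.sharp a e e') e' e = a := by
  rw [← act_act, adj.sharp_flat, act_id]

theorem act_sharp_flat {B : X} {ps : LooseChain Loose A B} {x : B ⟶ C} {y : B ⟶ E}
    (a : Cell j ps y (looseId E)) (e : x ≫ 𝟙 C = x) (e' : x ≫ r = y) :
    act adj.sharp (act adj.flat a e' e) e e' = a := by
  rw [← act_act, adj.flat_sharp, act_id]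

theorem act_sharp_cellMul {B D : X} {ps : LooseChain Loose A B} {qs : LooseChain Loose B D}
    {rs : LooseChain Loose A D} {x : B ⟶ C} {y : D ⟶ C} {x' : B ⟶ E} {y' : D ⟶ E}
    (a : Cell l ps x (looseId C)) (b : Cell x qs y (looseId C)) (h : ps.append qs = rs)
    (e : x ≫ r = x') (e' : y ≫ r = y') :
    act adj.sharp (cellMul a b h) (Category.comp_id y) e' =
      cellMul (act adj.sharp a (Category.comp_id x) e) (push r b e e') h := by
  have := act_cellMul_push adj.sharp a b h (Category.comp_id x) e (Category.comp_id y) e'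
  rwa [push_id] at this

theorem act_flat_cellMul {B D : X} {ps : LooseChain Loose A B} {qs : LooseChain Loose B D}
    {rs : LooseChain Loose A D} {x : B ⟶ C} {y : D ⟶ C} {x' : B ⟶ E} {y' : D ⟶ E}
    (a : Cell j ps x' (looseId E)) (b : Cell x qs y (looseId C)) (h : ps.append qs = rs)
    (e : x ≫ r = x') (e' : y ≫ r = y') :
    act adj.flat (cellMul a (push r b e e') h) e' (Category.comp_id y) =
      cellMul (act adj.flat a e (Category.comp_id x)) b h := by
  have := act_cellMul_push adj.flat a b h e (Category.comp_id x) e' (Category.comp_id y)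
  rwa [push_id] at this

/-- Postcomposition by `r` of an operator `φ : C(l, x) ⇒ C(t, x)`: the composite
`E(j, x r) ≅ C(l, x) ⇒ C(t, x) ⇒ E(t r, x r)` of the transposition operator, `φ`, and the action
of `r`. -/
noncomputable def postcompExt {D : X} {t : A ⟶ C} {x : D ⟶ C}
    (φ : Cell (𝟙 A) (.one (Hom l x)) (𝟙 D) (Hom t x)) :
    Cell (𝟙 A) (.one (Hom j (x ≫ r))) (𝟙 D) (Hom (t ≫ r) (x ≫ r)) :=
  comp₁ (comp₁ (resRight adj.flat x rfl (Category.comp_id x)) φ (Category.id_comp _)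
    (Category.id_comp _)) (mapHom r t x rfl rfl) (Category.id_comp _) (Category.id_comp _)

theorem act_postcompExt {B D : X} {t : A ⟶ C} {x : D ⟶ C}
    (φ : Cell (𝟙 A) (.one (Hom l x)) (𝟙 D) (Hom t x)) {ps : LooseChain Loose A B} {k : B ⟶ D}
    {y : B ⟶ C} {y' : B ⟶ E} (a : Cell j ps y' (looseId E)) (e : k ≫ x ≫ r = y') (h : k ≫ x = y)
    (h' : y ≫ r = y') :
    act (adj.postcompExt φ) a e e =
      push r (act φ (act adj.flat a h' (Category.comp_id y)) h h) rfl h' := by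
  unfold postcompExt
  rw [act_act _ _ _ e h e, act_act _ _ _ e h h, act_resRight _ _ _ _ _ _ _ h, act_mapHom]

theorem postcompExt_unit {D : X} {t : A ⟶ C} {x : D ⟶ C} (η : TightTwoCell l t)
    (φ : Cell (𝟙 A) (.one (Hom l x)) (𝟙 D) (Hom t x))
    (H : comp₁ φ (preHom η x) (Category.id_comp _) (Category.id_comp _) = idCell (Hom l x)) :
    comp₁ (adj.postcompExt φ) (preHom (act adj.sharp η (Category.comp_id t) rfl) (x ≫ r))
      (Category.id_comp _) (Category.id_comp _) = idCell (Hom j (x ≫ r)) := by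
  rw [unit_law_iff, act_postcompExt adj φ _ _ (Category.id_comp _) rfl,
    ← act_sharp_cellMul, unit_law_general _ _ H, act_sharp_flat]

theorem postcompExt_assoc {D : X} {t : A ⟶ C} {x : D ⟶ C}
    (τ : Cell (𝟙 A) (.one (Hom l t)) (𝟙 A) (Hom t t))
    (φ : Cell (𝟙 A) (.one (Hom l x)) (𝟙 D) (Hom t x))
    (H : comp₁ (comp₂ (idCell (Hom l t)) φ (compHom l t x) rfl (Category.id_comp _)
        (Category.id_comp _)) φ (Category.id_comp _) (Category.id_comp _) =
      comp₂ τ φ (compHom t t x) rfl (Category.id_comp _) (Category.id_comp _)) :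
    comp₁ (comp₂ (idCell (Hom j (t ≫ r))) (adj.postcompExt φ) (compHom j (t ≫ r) (x ≫ r)) rfl
        (Category.id_comp _) (Category.id_comp _)) (adj.postcompExt φ) (Category.id_comp _)
        (Category.id_comp _) =
      comp₂ (adj.postcompExt τ) (adj.postcompExt φ) (compHom (t ≫ r) (t ≫ r) (x ≫ r)) rfl
        (Category.id_comp _) (Category.id_comp _) := by
  rw [ext_law_iff, act_postcompExt adj φ _ _ (Category.id_comp _) rfl,
    act_postcompExt adj φ _ _ (Category.id_comp _) rfl,
    act_postcompExt adj τ _ _ (Category.id_comp _) rfl, act_flat_cellMul,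
    ext_law_general _ _ H, push_cellMul]

/-- The postcomposition of an `l`-relative monad by the right adjoint of `l ⊣ r`, which is a
`j`-relative monad. -/
noncomputable def postcompMonad (T : RelativeMonad l) : RelativeMonad j where
  carrier := T.carrier ≫ r
  unit := act adj.sharp T.unit (Category.comp_id _) rfl
  ext := adj.postcompExt T.ext
  ext_unit := adj.postcompExt_unit T.unit T.ext T.ext_unit
  unit_ext := by
    apply cart_ext (Category.id_comp _) (Category.id_comp _)
    have h1 := comp_comp₁ (.one (nameCell (act adj.sharp T.unit (Category.comp_id _) rfl)))
      (adj.postcompExt T.ext) (cart (T.carrier ≫ r) (T.carrier ≫ r)) (Category.id_comp _)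
      (Category.id_comp _) (Category.id_comp _) (Category.id_comp _) (Category.id_comp _)
      (Category.id_comp _)
    rw [← h1]
    have h2 := comp_comp₁ (.one (nameCell T.unit)) T.ext (cart T.carrier T.carrier)
      (Category.id_comp _) (Category.id_comp _) (Category.id_comp _) (Category.id_comp _)
      (Category.id_comp _) (Category.id_comp _)
    rw [T.unit_ext] at h2
    have h3 : act T.ext T.unit (Category.id_comp _) (Category.id_comp _) = cellOne T.carrier :=
      h2.trans (lift_cart _ _ _)
    refine Eq.trans (b := act (adj.postcompExt T.ext) (act adj.sharp T.unit (Category.comp_id _)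
      rfl) (Category.id_comp _) (Category.id_comp _)) rfl ?_
    rw [act_postcompExt adj T.ext _ _ (Category.id_comp _) rfl, act_flat_sharp, h3, push_cellOne]
    exact (lift_cart _ _ _).symm
  assoc := adj.postcompExt_assoc T.ext T.ext T.assoc

/-- The postcomposition of an algebra for an `l`-relative monad by the right adjoint of `l ⊣ r`. -/
noncomputable def postcompAlgebra {T : RelativeMonad l} {D : X} (a : T.Algebra D) :
    (adj.postcompMonad T).Algebra D where
  carrier := a.carrier ≫ r
  ext := adj.postcompExt a.ext
  ext_unit := adj.postcompExt_unit T.unit a.ext a.ext_unit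
  assoc := adj.postcompExt_assoc T.ext a.ext a.assoc

end RelativeAdjunction

theorem comp₁_expand_cart {D D' E : X} {e : D ⟶ E} {e' : D' ⟶ E} {ps : LooseChain Loose D D'}
    (φ : Cell (𝟙 D) ps (𝟙 D') (Hom e e')) :
    comp₁ (expand φ) (cart (𝟙 E) e') (Category.id_comp (𝟙 E)) (Category.id_comp e') =
      cellMul (cart (𝟙 E) e) (comp₁ φ (cart e e') (Category.id_comp e) (Category.id_comp e'))
        (rs := .cons (Hom (𝟙 E) e) ps) rfl := by
  have h := comp₂_compHom (idCell (Hom (𝟙 E) e)) φ (rs := .cons (Hom (𝟙 E) e) ps) rfl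
    (Category.id_comp (𝟙 E)) (Category.id_comp e) (Category.id_comp e')
  have h0 : comp₁ (idCell (Hom (𝟙 E) e)) (cart (𝟙 E) e) (Category.id_comp _)
    (Category.id_comp e) = cart (𝟙 E) e := ids_cellComp _
  rw [h0] at h
  exact h

theorem resLeft_expand {A D D' E : X} {e : D ⟶ E} {e' : D' ⟶ E} {ps : LooseChain Loose D D'}
    (φ : Cell (𝟙 D) ps (𝟙 D') (Hom e e')) (f : A ⟶ E) :
    comp₁ (resLeft (expand φ) f) (cart f e') (Category.id_comp f) (Category.id_comp e') =
      cellMul (cart f e) (comp₁ φ (cart e e') (Category.id_comp e) (Category.id_comp e'))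
        (rs := .cons (Hom f e) ps) rfl := by
  unfold resLeft
  rw [lift_cart, comp₁_expand_cart]
  have h := cellMul_natural
    (.one (lift (cart f e) (Category.comp_id f) (Category.id_comp e) :
      Cell f (.one (Hom f e)) (𝟙 D) (Hom (𝟙 E) e))) (CellSeq.ids idCell ps)
    (cart (𝟙 E) e) (comp₁ φ (cart e e') (Category.id_comp e) (Category.id_comp e'))
    (rs := .cons (Hom (𝟙 E) e) ps) rfl (rs' := .cons (Hom f e) ps) rfl (Category.comp_id f)
    (Category.id_comp e) (Category.id_comp e')
  rw [lift_cart, ids_cellComp] at h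
  exact h

theorem extract_expand {D D' E : X} {e : D ⟶ E} {e' : D' ⟶ E} {ps : LooseChain Loose D D'}
    (φ : Cell (𝟙 D) ps (𝟙 D') (Hom e e')) : extract (expand φ) = φ := by
  apply cart_ext (Category.id_comp e) (Category.id_comp e')
  unfold extract
  rw [lift_cart, comp₁_expand_cart]
  have h := cellMul_natural
    (.one (lift (cellOne e) (Category.comp_id e) (Category.id_comp e) :
      Cell e (.nil D) (𝟙 D) (Hom (𝟙 E) e))) (CellSeq.ids idCell ps)
    (cart (𝟙 E) e) (comp₁ φ (cart e e') (Category.id_comp e) (Category.id_comp e'))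
    (rs := .cons (Hom (𝟙 E) e) ps) rfl (rs' := ps) (LooseChain.nil_append _) (Category.comp_id e)
    (Category.id_comp e) (Category.id_comp e')
  rw [lift_cart, ids_cellComp] at h
  exact h.trans (cellOne_cellMul _ _)

namespace RelativeMonad

variable {A E : X} {j : A ⟶ E} {T : RelativeMonad j}

theorem expand_compat {D D' : X} (a : T.Algebra D) (b : T.Algebra D') {ps : LooseChain Loose D D'}
    (φ : Cell (𝟙 D) ps (𝟙 D') (Hom a.carrier b.carrier))
    (H : act b.ext (cellMul (cart j a.carrier) (comp₁ φ (cart a.carrier b.carrier)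
          (Category.id_comp _) (Category.id_comp _)) (rs := .cons (Hom j a.carrier) ps) rfl)
        (Category.id_comp _) (Category.id_comp _) =
      cellMul (act a.ext (cart j a.carrier) (Category.id_comp _) (Category.id_comp _))
        (comp₁ φ (cart a.carrier b.carrier) (Category.id_comp _) (Category.id_comp _))
        (rs := .cons (Hom j a.carrier) ps) rfl) :
    comp₁ (resLeft (expand φ) j) b.ext (Category.id_comp _) (Category.id_comp _) =
      cellComp (.cons a.ext (CellSeq.ids idCell ps) rfl) (resLeft (expand φ) T.carrier)
        (Category.id_comp _) (Category.id_comp _) := by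
  apply cart_ext (Category.id_comp _) (Category.id_comp _)
  have h1 := comp_comp₁ (.one (resLeft (expand φ) j)) b.ext (cart T.carrier b.carrier)
    (Category.id_comp _) (Category.id_comp _) (Category.id_comp _) (Category.id_comp _)
    (Category.id_comp (𝟙 A)) (Category.id_comp (𝟙 D'))
  let S : CellSeq Cell (𝟙 A) (.cons (Hom j a.carrier) ps) (𝟙 D')
    (.cons (Hom T.carrier a.carrier) ps) := .cons a.ext (CellSeq.ids idCell ps) rfl
  have h2 := comp_comp₁ S (resLeft (expand φ) T.carrier) (cart T.carrier b.carrier)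
    (Category.id_comp _) (Category.id_comp _) (Category.id_comp _) (Category.id_comp _)
    (Category.id_comp (𝟙 A)) (Category.id_comp (𝟙 D'))
  refine (h1.symm.trans ?_).trans h2
  rw [← act_comp_cart b.ext _ (Category.id_comp _) (Category.id_comp _), resLeft_expand,
    resLeft_expand]
  refine H.trans ?_
  rw [act_cart]
  have h3 := cellMul_natural (.one a.ext) (CellSeq.ids idCell ps) (cart T.carrier a.carrier)
    (comp₁ φ (cart a.carrier b.carrier) (Category.id_comp _) (Category.id_comp _))
    (rs := .cons (Hom T.carrier a.carrier) ps) rfl (rs' := .cons (Hom j a.carrier) ps) rfl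
    (Category.id_comp _) (Category.id_comp _) (Category.id_comp _)
  rw [ids_cellComp] at h3
  exact h3.symm

theorem act_ext_unit (T : RelativeMonad j) :
    act T.ext T.unit (Category.id_comp _) (Category.id_comp _) = cellOne T.carrier := by
  have h2 := comp_comp₁ (.one (nameCell T.unit)) T.ext (cart T.carrier T.carrier)
    (Category.id_comp _) (Category.id_comp _) (Category.id_comp _) (Category.id_comp _)
    (Category.id_comp _) (Category.id_comp _)
  rw [T.unit_ext] at h2
  exact h2.trans (lift_cart _ _ _)

/-- A relative monad as an algebra for itself. -/
def selfAlgebra (T : RelativeMonad j) : T.Algebra A where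
  carrier := T.carrier
  ext := T.ext
  ext_unit := T.ext_unit
  assoc := T.assoc

theorem Algebra.mediates_id {M : X} (U : T.Algebra M) : U.Mediates U (𝟙 M) := by
  refine ⟨Category.id_comp _, cart_ext (Category.id_comp _) (Category.id_comp _) ?_⟩
  unfold resRight
  rw [lift_cart, act_cart]

namespace IsAlgebraObject

variable {M : X} {U : T.Algebra M} (hU : IsAlgebraObject U)

theorem existsUnique_hom {M : X} {U : T.Algebra M} (hU : IsAlgebraObject U) {D D' : X} (a : T.Algebra D) (b : T.Algebra D') {h : D ⟶ M} {h' : D' ⟶ M}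
    (m : U.Mediates a h) (m' : U.Mediates b h') {ps : LooseChain Loose D D'}
    (φ : Cell (𝟙 D) ps (𝟙 D') (Hom a.carrier b.carrier))
    (H : act b.ext (cellMul (cart j a.carrier) (comp₁ φ (cart a.carrier b.carrier)
          (Category.id_comp _) (Category.id_comp _)) (rs := .cons (Hom j a.carrier) ps) rfl)
        (Category.id_comp _) (Category.id_comp _) =
      cellMul (act a.ext (cart j a.carrier) (Category.id_comp _) (Category.id_comp _))
        (comp₁ φ (cart a.carrier b.carrier) (Category.id_comp _) (Category.id_comp _))
        (rs := .cons (Hom j a.carrier) ps) rfl) :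
    ∃! σ : Cell (𝟙 D) ps (𝟙 D') (Hom h h'),
      comp₁ σ (mapHom U.carrier h h' m.choose m'.choose) (Category.id_comp _)
        (Category.id_comp _) = φ := by
  obtain ⟨σ, hσ, huniq⟩ := hU.existsUnique_cell a b m m' ⟨expand φ, expand_compat a b φ H⟩
  refine ⟨extract σ, ?_, ?_⟩
  · have := congrArg extract hσ
    simp only [whisker] at this
    rwa [extract_expand, extract_expand] at this
  · intro τ hτ
    have h1 : expand τ = σ := by
      apply huniq
      simp only [whisker]
      rw [extract_expand]
      exact congrArg expand hτ
    rw [← h1, extract_expand]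

/-- The tight-cell `f_T` into the algebra object induced by `T` regarded as an algebra. -/
noncomputable def free : A ⟶ M :=
  (hU.existsUnique_tight T.selfAlgebra).choose

theorem mediates_free : U.Mediates T.selfAlgebra hU.free :=
  (hU.existsUnique_tight T.selfAlgebra).choose_spec.1

theorem free_comp : hU.free ≫ U.carrier = T.carrier :=
  hU.mediates_free.choose

theorem act_ext_free {ps : LooseChain Loose A A} (a : Cell j ps T.carrier (looseId E)) :
    act U.ext a hU.free_comp hU.free_comp = act T.ext a (Category.id_comp _)
      (Category.id_comp _) := by
  have h := hU.mediates_free.choose_spec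
  have h1 := act_resRight U.ext hU.free hU.free_comp hU.free_comp a (Category.id_comp _)
    (Category.id_comp _) (Category.id_comp _)
  rw [← h1]
  exact congrArg (fun z => act z a _ _) h

theorem existsUnique_flat :
    ∃! σ : Cell (𝟙 A) (.one (Hom j U.carrier)) (𝟙 M) (Hom hU.free (𝟙 M)),
      comp₁ σ (mapHom U.carrier hU.free (𝟙 M) hU.free_comp (Category.id_comp _))
        (Category.id_comp _) (Category.id_comp _) = U.ext := by
  refine hU.existsUnique_hom T.selfAlgebra U hU.mediates_free U.mediates_id U.ext ?_
  have h := ext_law_general _ _ U.assoc (cart j T.carrier) (cart j U.carrier)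
    (rs := .cons (Hom j T.carrier) (.one (Hom j U.carrier))) rfl (Category.id_comp _)
  rw [act_cart U.ext] at h
  exact h

theorem push_cart_compat :
    act U.ext (cellMul (cart j T.carrier) (push U.carrier (cart hU.free (𝟙 M)) hU.free_comp
        (Category.id_comp _)) (rs := .cons (Hom j T.carrier) (.one (Hom hU.free (𝟙 M)))) rfl)
        (Category.id_comp _) (Category.id_comp _) =
      cellMul (act T.ext (cart j T.carrier) (Category.id_comp _) (Category.id_comp _))
        (push U.carrier (cart hU.free (𝟙 M)) hU.free_comp (Category.id_comp _)) rfl := by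
  refine (act_cellMul_push U.ext _ _ _ hU.free_comp hU.free_comp _ _).trans ?_
  rw [act_ext_free]
  rfl

theorem existsUnique_mapHom :
    ∃! σ : Cell (𝟙 A) (.one (Hom hU.free (𝟙 M))) (𝟙 M) (Hom hU.free (𝟙 M)),
      comp₁ σ (mapHom U.carrier hU.free (𝟙 M) hU.free_comp (Category.id_comp _))
        (Category.id_comp _) (Category.id_comp _) =
      mapHom U.carrier hU.free (𝟙 M) hU.free_comp (Category.id_comp _) := by
  refine hU.existsUnique_hom T.selfAlgebra U hU.mediates_free U.mediates_id
    (mapHom U.carrier hU.free (𝟙 M) hU.free_comp (Category.id_comp _)) ?_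
  have h : comp₁ (mapHom U.carrier hU.free (𝟙 M) hU.free_comp (Category.id_comp _))
    (cart T.carrier U.carrier) (Category.id_comp _) (Category.id_comp _) = _ := lift_cart _ _ _
  have h' := hU.push_cart_compat
  rw [← h] at h'
  exact h'

/-- The relative adjunction `f_T ⊣ u_T` given by an algebra object. Its transposition operator is
the composite `Alg(T)(f_T, 1) ⇒ E(t, u_T) ⇒ E(j, u_T)` of the action of `u_T` and precomposition
with the unit. -/
noncomputable def adjunction : RelativeAdjunction j hU.free U.carrier where
  sharp := comp₁ (mapHom U.carrier hU.free (𝟙 M) hU.free_comp (Category.id_comp _))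
    (preHom T.unit U.carrier) (Category.id_comp _) (Category.id_comp _)
  flat := hU.existsUnique_flat.choose
  flat_sharp := by
    rw [comp_comp₁ _ _ _ _ _ _ _ (Category.id_comp _) (Category.id_comp _),
      hU.existsUnique_flat.choose_spec.1, U.ext_unit]
  sharp_flat := by
    refine hU.existsUnique_mapHom.unique ?_ (ids_cellComp _)
    have h1 := comp_comp₁ (.one (comp₁ (mapHom U.carrier hU.free (𝟙 M) hU.free_comp
      (Category.id_comp _)) (preHom T.unit U.carrier) (Category.id_comp _) (Category.id_comp _)))
      hU.existsUnique_flat.choose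
      (mapHom U.carrier hU.free (𝟙 M) hU.free_comp (Category.id_comp _)) (Category.id_comp _)
      (Category.id_comp _) (Category.id_comp _) (Category.id_comp _) (Category.id_comp _)
      (Category.id_comp _)
    rw [← h1, hU.existsUnique_flat.choose_spec.1]
    apply comp_cart_eq_act
    rw [act_act _ _ _ _ (Category.id_comp _), act_act _ _ _ _ (Category.id_comp _), act_preHom,
      act_mapHom, act_cellMul_push U.ext _ _ _ hU.free_comp hU.free_comp, act_ext_free,
      act_ext_unit, cellOne_cellMul]

end IsAlgebraObject

/-- The trivial relative monad on `j`. -/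
def trivial {A E : X} (j : A ⟶ E) : RelativeMonad j where
  carrier := j
  unit := cellOne j
  ext := idCell (Hom j j)
  ext_unit := by
    rw [unit_law_iff, act_id, cellOne_cellMul]
  unit_ext := cellComp_idCell _
  assoc := by
    rw [ext_law_iff, act_id, act_id]

end RelativeMonad

namespace RelativeAdjunction

variable {A C E : X} {j : A ⟶ E} {l : A ⟶ C} {r : C ⟶ E}

theorem postcompExt_idCell (adj : RelativeAdjunction j l r) :
    adj.postcompExt (idCell (Hom l l)) =
      comp₁ (resRight adj.flat l rfl (Category.comp_id l)) (mapHom r l l rfl rfl)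
        (Category.id_comp _) (Category.id_comp _) := by
  unfold postcompExt
  rw [cellComp_idCell]

/-- The relative monad induced by a relative adjunction, with extension operator
`E(j, l r) ≅ C(l, l) ⇒ E(l r, l r)`. -/
noncomputable def monad (adj : RelativeAdjunction j l r) : RelativeMonad j where
  carrier := l ≫ r
  unit := act adj.sharp (cellOne l) (Category.comp_id l) rfl
  ext := comp₁ (resRight adj.flat l rfl (Category.comp_id l)) (mapHom r l l rfl rfl)
    (Category.id_comp _) (Category.id_comp _)
  ext_unit := by
    rw [← postcompExt_idCell]
    exact (adj.postcompMonad (.trivial l)).ext_unit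
  unit_ext := by
    rw [← postcompExt_idCell]
    exact (adj.postcompMonad (.trivial l)).unit_ext
  assoc := by
    rw [← postcompExt_idCell]
    exact (adj.postcompMonad (.trivial l)).assoc

/-- The pasting of a `j`-adjunction `l' ⊣ r'` and an `l'`-adjunction `l ⊣ r`. -/
noncomputable def paste {D : X} {l' : A ⟶ D} {r' : D ⟶ E} {r : C ⟶ D}
    (adj' : RelativeAdjunction j l' r') (adj : RelativeAdjunction l' l r) :
    RelativeAdjunction j l (r ≫ r') where
  sharp := comp₁ adj.sharp (resRight adj'.sharp r (Category.comp_id r) rfl) (Category.id_comp _)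
    (Category.id_comp _)
  flat := comp₁ (resRight adj'.flat r rfl (Category.comp_id r)) adj.flat (Category.id_comp _)
    (Category.id_comp _)
  sharp_flat := by
    apply comp_cart_eq_act
    rw [act_act _ _ _ _ (Category.id_comp _), act_act _ _ _ _ (Category.id_comp _),
      act_act _ _ _ _ (Category.id_comp _), act_resRight _ _ _ _ _ _ _ (Category.id_comp _),
      act_resRight _ _ _ _ _ _ _ (Category.id_comp _), act_flat_sharp, act_flat_sharp, act_id]
  flat_sharp := by
    apply comp_cart_eq_act
    rw [act_act _ _ _ _ (Category.id_comp _), act_act _ _ _ _ (Category.id_comp _),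
      act_act _ _ _ _ (Category.id_comp _), act_resRight _ _ _ _ _ _ _ (Category.id_comp _),
      act_resRight _ _ _ _ _ _ _ (Category.id_comp _), act_sharp_flat, act_sharp_flat, act_id]

/-- A tight-cell `c` between the apices is a morphism of resolutions when it commutes with the
left and the right adjoints and with the transposition operators: `♯` is the composite
`C(l, 1) ⇒ C'(l', c) ⇒ E(j, r)` of the action of `c` and `♯'(1, c)`. -/
structure IsResolutionMorphism {C' : X} {l' : A ⟶ C'} {r' : C' ⟶ E}
    (adj : RelativeAdjunction j l r) (adj' : RelativeAdjunction j l' r') (c : C ⟶ C') : Prop where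
  left : l ≫ c = l'
  right : c ≫ r' = r
  sharp : adj.sharp = comp₁ (mapHom c l (𝟙 C) left (Category.id_comp c))
    (resRight adj'.sharp c (Category.comp_id c) right) (Category.id_comp _) (Category.id_comp _)

/-- A relative adjunction is strictly monadic when the relative monad `T` that it induces admits an
algebra object, and it is isomorphic to `f_T ⊣ u_T` as a resolution of `T`. -/
def IsStrictlyMonadic (adj : RelativeAdjunction j l r) : Prop :=
  ∃ (M : X) (U : adj.monad.Algebra M) (hU : RelativeMonad.IsAlgebraObject U) (c : C ⟶ M)
    (d : M ⟶ C), adj.IsResolutionMorphism hU.adjunction c ∧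
      hU.adjunction.IsResolutionMorphism adj d ∧ c ≫ d = 𝟙 C ∧ d ≫ c = 𝟙 M

end RelativeAdjunction

end RelativeMonads

/-! All calculations take place among 2-cells into loose-identities. A 2-cell out of `E(f, g)` is
known from its action (`act`) on such 2-cells, and a tight-cell `u` acts on them by `push u`. By a
Yoneda argument resting on `cellMul_cart_eval`, a graded morphism `E(1, e), p₁, …, pₙ ⇒ E(1, e')` is
the same as a 2-cell `p₁, …, pₙ ⇒ E(1, 1)` framed by `e` and `e'` that satisfies one equation,
`IsHom`. An algebra object `u` is then a universal algebra for which `push u` is a bijection onto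
homomorphisms (`isAlgebraObject_iff`).

First statement. Write `u : M ⟶ E` for the algebra object of `T'` and `T₁` for `(T ; u)`, with
carrier `t₁`. Applying `u` to the unit of `T` gives a 2-cell `β : t' ⇒ t₁` (`baseUnit`), which is a
morphism of monads from `T'` to `T₁`. Hence every `T₁`-algebra `b` has an underlying `T'`-algebra
`base` with the same carrier, and `T₁`-homomorphisms are `T'`-homomorphisms. If `b` is the
postcomposition of a `T`-algebra `a`, the unit law of `a` shows that the carrier of `a` mediates
`base`. So this carrier is forced, and the operator of `a` is forced as well because `push u` is
injective. Conversely, let `h` mediate the `base` of an arbitrary `b` with carrier `e`.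
Transposition `M(l, h) ≅ E(j, e)` turns the operator of `b` into a 2-cell out of `M(l, h)` from `t₁`
to `e`. The associativity law of `b` says that this is a homomorphism from `T₁` to `b` graded by
`M(l, h)`, so it lifts through `u` to an operator on `h`, whose laws follow by injectivity.
Homomorphisms are lifted in the same way.

Of the adjunction, only the properties in `Algebra.IsCompatible` are used. They hold for `f_T' ⊣
u_T'`, and also for every relative adjunction together with the algebra carried by its right adjoint
(`rightAlgebra`).

Second statement. A relative adjunction is strictly monadic exactly when its `rightAlgebra` is an
algebra object (`isStrictlyMonadic_iff`). The `rightAlgebra` of a pasting is the postcomposition of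
the inner one, and by the bijections above postcomposition preserves and reflects algebra objects
(`isAlgebraObject_iff_of_isPostcompAlgebra`). Finally, every `j`-adjunction with adjoints `l` and
`(r ; r')` is a pasting, since the transposition operators of `l' ⊣ r'` are invertible
(`exists_paste_eq`). -/

/-! ### Composition with sequences of identity 2-cells -/

namespace CellSeq

variable {Ob : Type u} [Category.{v} Ob] {L : Ob → Ob → Type w}
  {K : ∀ ⦃A B A' B' : Ob⦄, (A ⟶ A') → LooseChain L A B → (B ⟶ B') → L A' B' → Type z}

/-- The sequence of identity 2-cells on a chain, above itself. -/
def idsTwo (ι : ∀ {A B : Ob} (p : L A B), K (𝟙 A) (.one p) (𝟙 B) p) :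
    ∀ {A B : Ob} (ps : LooseChain L A B), CellSeqTwo K (𝟙 A) (𝟙 A) ps ps (𝟙 B) (𝟙 B) ps
  | _, _, .nil A => .nil (𝟙 A) (𝟙 A)
  | _, _, .cons p ps => .cons (.one (ι p)) (ι p) (idsTwo ι ps) rfl rfl

theorem top_idsTwo (ι : ∀ {A B : Ob} (p : L A B), K (𝟙 A) (.one p) (𝟙 B) p) {A B : Ob}
    (ps : LooseChain L A B) : (idsTwo (K := K) ι ps).top = ids ι ps := by
  induction ps with
  | nil => rfl
  | cons p ps ih =>
    simp only [idsTwo, CellSeqTwo.top, ih, ids]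
    rfl

theorem bottom_idsTwo (ι : ∀ {A B : Ob} (p : L A B), K (𝟙 A) (.one p) (𝟙 B) p) {A B : Ob}
    (ps : LooseChain L A B) : (idsTwo (K := K) ι ps).bottom = ids ι ps := by
  induction ps with
  | nil => rfl
  | cons p ps ih => simp only [idsTwo, CellSeqTwo.bottom, ih, ids]

/-- Frames such as `f ≫ 𝟙` and `f` are equal only propositionally, so sequences over them are
compared heterogeneously. -/
theorem cons_heq_cons {A B C A' B' C' : Ob} {f f₁ : A ⟶ A'} {g g₁ : B ⟶ B'} {k k₁ : C ⟶ C'}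
    {ps : LooseChain L A B} {ps' : LooseChain L B C} {q : L A' B'} {qs : LooseChain L B' C'}
    {rs : LooseChain L A C} {φ : K f ps g q} {φ₁ : K f₁ ps g₁ q} {S : CellSeq K g ps' k qs}
    {S₁ : CellSeq K g₁ ps' k₁ qs} (hf : f = f₁) (hg : g = g₁) (hk : k = k₁) (hφ : φ ≍ φ₁)
    (hS : S ≍ S₁) (h : ps.append ps' = rs) : cons φ S h ≍ cons φ₁ S₁ h := by
  subst hf hg hk
  rw [eq_of_heq hφ, eq_of_heq hS]

end CellSeq

namespace VirtualDoubleCategory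

variable {X : Type u} [VirtualDoubleCategory.{u, v, w, z} X]

theorem cellComp_heq {A B A' B' A'' B'' : X} {f f₁ : A ⟶ A'} {ps : LooseChain Loose A B}
    {g g₁ : B ⟶ B'} {qs : LooseChain Loose A' B'} {f' : A' ⟶ A''} {g' : B' ⟶ B''}
    {r : Loose A'' B''} {f'' f₁'' : A ⟶ A''} {g'' g₁'' : B ⟶ B''} {S : CellSeq Cell f ps g qs}
    {S₁ : CellSeq Cell f₁ ps g₁ qs} (φ : Cell f' qs g' r) (hf : f = f₁) (hg : g = g₁)
    (hS : S ≍ S₁) (e : f ≫ f' = f'') (e' : g ≫ g' = g'') (e₁ : f₁ ≫ f' = f₁'')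
    (e₁' : g₁ ≫ g' = g₁'') : cellComp S φ e e' ≍ cellComp S₁ φ e₁ e₁' := by
  subst hf hg e e' e₁ e₁'
  rw [eq_of_heq hS]

theorem total_idsTwo {A B : X} (ps : LooseChain Loose A B) :
    (CellSeq.idsTwo (K := Cell) idCell ps).total cellComp ≍ CellSeq.ids idCell ps := by
  induction ps with
  | nil A =>
    simp only [CellSeq.idsTwo, CellSeqTwo.total, CellSeq.ids]
    rw [Category.comp_id]
  | cons p ps ih =>
    simp only [CellSeq.idsTwo, CellSeqTwo.total, CellSeq.ids]
    refine CellSeq.cons_heq_cons (Category.comp_id _) (Category.comp_id _) (Category.comp_id _) ?_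
      ih rfl
    have h : cellComp (.one (idCell p)) (idCell p) (Category.comp_id _) (Category.comp_id _) =
      idCell p := cellComp_idCell (idCell p)
    exact (cellComp_heq (idCell p) rfl rfl HEq.rfl _ _ _ _).trans (heq_of_eq h)

/-- Composition with identities on all but the first loose-cell. -/
theorem comp_cons_ids {A B C A' A'' A''' C''' : X} {f : A ⟶ A'} {f' : A' ⟶ A''} {k : A'' ⟶ A'''}
    {l : C ⟶ C'''} {a : A ⟶ A''} {x : A' ⟶ A'''} {y : A ⟶ A'''}
    {rs : LooseChain Loose A B} {qs : LooseChain Loose A' B} {p : Loose A'' B}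
    {ps : LooseChain Loose B C} {s : Loose A''' C'''} {rs' : LooseChain Loose A C}
    {qs' : LooseChain Loose A' C}
    (S : CellSeq Cell f rs (𝟙 B) qs) (φ : Cell f' qs (𝟙 B) p) (ψ : Cell k (.cons p ps) l s)
    (e : rs.append ps = rs') (e' : qs.append ps = qs') (e₁ : f' ≫ k = x) (e₂ : f ≫ x = y)
    (e₃ : f ≫ f' = a) :
    cellComp (S.append (CellSeq.ids idCell ps) e e')
        (cellComp (.cons φ (CellSeq.ids idCell ps) e') ψ e₁ (Category.id_comp l)) e₂
        (Category.id_comp l) =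
      cellComp (.cons (cellComp S φ e₃ (Category.comp_id (𝟙 B))) (CellSeq.ids idCell ps) e) ψ
        (by rw [← e₃, ← e₂, ← e₁, Category.assoc]) (Category.id_comp l) := by
  subst e₁ e₂ e₃
  -- Associativity for the two-layer sequence that is `S` over `φ` at the head and identities over
  -- identities on `ps`.
  have h := cellComp_assoc (.cons S φ (CellSeq.idsTwo idCell ps) e e') ψ
  simp only [CellSeqTwo.top, CellSeqTwo.bottom, CellSeqTwo.total, CellSeq.top_idsTwo,
    CellSeq.bottom_idsTwo] at h
  apply eq_of_heq
  refine HEq.trans ?_ ((heq_of_eq h).trans (cellComp_heq ψ rfl (Category.comp_id _)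
    (CellSeq.cons_heq_cons rfl (Category.comp_id _) (Category.comp_id _) ?_ (total_idsTwo ps) e)
    _ _ _ _))
  -- Associativity produces the right frame `𝟙 ≫ (𝟙 ≫ l)`. Naming the two composites `m` and `n`
  -- allows both to be replaced by `l`.
  · have : ∀ {m n : C ⟶ C'''} (hm : 𝟙 C ≫ l = m) (hn : 𝟙 C ≫ m = n), l = m ∧ l = n := by
      intro m n hm hn
      rw [Category.id_comp] at hm hn
      exact ⟨hm, hm.trans hn⟩
    have key : ∀ {m n : C ⟶ C'''} (hm : 𝟙 C ≫ l = m) (hn : 𝟙 C ≫ m = n),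
      cellComp (S.append (CellSeq.ids idCell ps) e e')
        (cellComp (.cons φ (CellSeq.ids idCell ps) e') ψ rfl (Category.id_comp l)) rfl
        (Category.id_comp l) ≍ cellComp (S.append (CellSeq.ids idCell ps) e e')
        (cellComp (.cons φ (CellSeq.ids idCell ps) e') ψ rfl hm) rfl hn := by
      intro m n hm hn
      obtain ⟨h1, h2⟩ := this hm hn
      subst h1 h2
      rfl
    exact key rfl rfl
  · exact cellComp_heq φ rfl rfl HEq.rfl _ _ _ _

end VirtualDoubleCategory

/-! ### Linearity of 2-cells out of `E(1, e)`, and composition of actions -/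

namespace VirtualEquipment

variable {X : Type u} [VirtualDoubleCategory.{u, v, w, z} X] [VirtualEquipment X]

/-- Every 2-cell `E(1, e), p₁, …, pₙ ⇒ E(1, 1)` is linear in its first argument. -/
theorem cellMul_cart_eval {D D' E : X} {e : D ⟶ E} {e' : D' ⟶ E} {ps : LooseChain Loose D D'}
    (ψ : Cell (𝟙 E) (.cons (Hom (𝟙 E) e) ps) e' (looseId E)) :
    cellMul (cart (𝟙 E) e) (cellComp (.cons (lift (cellOne e) (Category.comp_id e)
        (Category.id_comp e) : Cell e (.nil D) (𝟙 D) (Hom (𝟙 E) e)) (CellSeq.ids idCell ps) rfl)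
        ψ (Category.comp_id e) (Category.id_comp e')) (rs := .cons (Hom (𝟙 E) e) ps) rfl = ψ := by
  -- The left action of `E(1, 1)` on `E(1, e)`.
  let lam : Cell (𝟙 E) (.cons (looseId E) (.one (Hom (𝟙 E) e))) (𝟙 D) (Hom (𝟙 E) e) :=
    lift (cellMul (idCell (looseId E)) (cart (𝟙 E) e) rfl) (Category.id_comp _) (Category.id_comp _)
  -- Multiplying the value of `ψ` on the left agrees with multiplying its first argument. By the
  -- universal property of the loose-identity it suffices to insert an identity, and then both sides
  -- become `ψ`.
  have linear : cellMul (idCell (looseId E)) ψ (rs := .cons (looseId E) (.cons (Hom (𝟙 E) e) ps))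
      rfl = cellComp (.cons lam (CellSeq.ids idCell ps) rfl) ψ (Category.id_comp _)
        (Category.id_comp _) := by
    apply cons_ext
    have h1 := cellMul_natural (.one (looseIdCell E))
      (CellSeq.ids idCell (.cons (Hom (𝟙 E) e) ps)) (idCell (looseId E)) ψ
      (rs := .cons (looseId E) (.cons (Hom (𝟙 E) e) ps)) (rs' := .cons (Hom (𝟙 E) e) ps)
      rfl rfl (Category.id_comp _) (Category.id_comp _) (Category.id_comp _)
    rw [ids_cellComp, cellComp_idCell] at h1
    have h4 : cellOne (𝟙 E) = looseIdCell E := ids_cellComp (looseIdCell E)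
    rw [← h4] at h1
    replace h1 := h1.trans (cellOne_cellMul ψ (LooseChain.nil_append _))
    have h2 := comp_cons_ids
      (.cons (looseIdCell E) (CellSeq.ids idCell (.one (Hom (𝟙 E) e))) rfl) lam ψ
      (rs' := .cons (Hom (𝟙 E) e) ps) (qs' := .cons (looseId E) (.cons (Hom (𝟙 E) e) ps)) rfl rfl
      (Category.id_comp _) (Category.id_comp _) (Category.comp_id _)
    have h3 : cellComp (.cons (looseIdCell E) (CellSeq.ids idCell (.one (Hom (𝟙 E) e))) rfl) lam
        (Category.comp_id _) (Category.comp_id _) = idCell (Hom (𝟙 E) e) := by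
      apply cart_ext (Category.id_comp _) (Category.id_comp _)
      have h5 := comp_comp₁ (.cons (looseIdCell E) (CellSeq.ids idCell (.one (Hom (𝟙 E) e))) rfl)
        lam (cart (𝟙 E) e) (Category.id_comp _) (Category.id_comp _) (Category.id_comp _)
        (Category.id_comp _) (Category.comp_id _) (Category.comp_id _)
      rw [← h5, lift_cart]
      have h6 := cellMul_natural (.one (looseIdCell E))
        (CellSeq.ids idCell (.one (Hom (𝟙 E) e))) (idCell (looseId E)) (cart (𝟙 E) e)
        (rs := .cons (looseId E) (.one (Hom (𝟙 E) e))) (rs' := .one (Hom (𝟙 E) e))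
        rfl rfl (Category.id_comp _) (Category.id_comp _) (Category.id_comp _)
      rw [ids_cellComp, cellComp_idCell, ← h4] at h6
      rw [← h4]
      exact (h6.trans (cellOne_cellMul _ (LooseChain.nil_append _))).trans (ids_cellComp _).symm
    rw [h3] at h2
    rw [h4] at h1
    exact h1.trans (h2.trans (ids_cellComp ψ)).symm
  let ev : Cell e (.nil D) (𝟙 D) (Hom (𝟙 E) e) :=
    lift (cellOne e) (Category.comp_id e) (Category.id_comp e)
  -- Linearity is now evaluated at the generic element `cart` and the identity `ev` on `e`. One side
  -- is the desired product. On the other, `lam` multiplies `cart` by an identity, so it contributes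
  -- the identity 2-cell on `E(1, e)`.
  have h1 := cellMul_natural (.one (cart (𝟙 E) e)) (.cons ev (CellSeq.ids idCell ps) rfl)
    (idCell (looseId E)) ψ (rs := .cons (looseId E) (.cons (Hom (𝟙 E) e) ps))
    (rs' := .cons (Hom (𝟙 E) e) ps) rfl rfl (Category.comp_id _) (Category.comp_id _)
    (Category.id_comp _)
  rw [cellComp_idCell, linear] at h1
  refine h1.symm.trans ?_
  have h2 := comp_cons_ids (.cons (cart (𝟙 E) e) (.one ev) rfl) lam ψ
      (rs' := .cons (Hom (𝟙 E) e) ps) (qs' := .cons (looseId E) (.cons (Hom (𝟙 E) e) ps)) rfl rfl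
      (Category.id_comp _) (Category.id_comp _) (Category.comp_id _)
  have h3 : cellComp (.cons (cart (𝟙 E) e) (.one ev) rfl) lam
      (Category.comp_id _) (Category.comp_id _) = idCell (Hom (𝟙 E) e) := by
    apply cart_ext (Category.id_comp _) (Category.id_comp _)
    have h5 := comp_comp₁ (.cons (cart (𝟙 E) e) (.one ev) rfl)
      lam (cart (𝟙 E) e) (Category.id_comp _) (Category.id_comp _) (Category.id_comp _)
      (Category.id_comp _) (Category.comp_id _) (Category.comp_id _)
    rw [← h5, lift_cart]
    have h6 := cellMul_natural (.one (cart (𝟙 E) e)) (.one ev) (idCell (looseId E)) (cart (𝟙 E) e)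
      (rs := .cons (looseId E) (.one (Hom (𝟙 E) e))) (rs' := .one (Hom (𝟙 E) e))
      rfl rfl (Category.comp_id _) (Category.comp_id _) (Category.id_comp _)
    rw [cellComp_idCell, lift_cart] at h6
    exact (h6.trans (cellMul_cellOne _ (LooseChain.append_nil _))).trans (ids_cellComp _).symm
  rw [h3] at h2
  exact h2.trans (ids_cellComp ψ)

/-- 2-cells out of a loose-identity are determined by their value on the identity, and both sides
send it to the identity on `u ≫ w`. -/
theorem functoriality_comp {M E F : X} (u : M ⟶ E) (w : E ⟶ F) :
    comp₁ (functoriality u) (functoriality w) rfl rfl = functoriality (u ≫ w) := by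
  apply cons_ext
  have h := comp_comp₁ (.one (looseIdCell M)) (functoriality u) (functoriality w) rfl rfl
    (Category.id_comp _) (Category.id_comp _) (Category.id_comp _) (Category.id_comp _)
  rw [looseIdCell_functoriality] at h
  exact h.trans ((push_cellOne w rfl rfl).trans (looseIdCell_functoriality (u ≫ w)).symm)

theorem push_push {A B M E F : X} (u : M ⟶ E) (w : E ⟶ F) {x : M ⟶ F} {f : A ⟶ M} {g : B ⟶ M}
    {f' : A ⟶ E} {g' : B ⟶ E} {f'' : A ⟶ F} {g'' : B ⟶ F}
    {ps : LooseChain Loose A B} (a : Cell f ps g (looseId M)) (e₁ : f ≫ u = f') (e₂ : g ≫ u = g')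
    (e₃ : f' ≫ w = f'') (e₄ : g' ≫ w = g'') (hx : u ≫ w = x) (e₅ : f ≫ x = f'')
    (e₆ : g ≫ x = g'') : push w (push u a e₁ e₂) e₃ e₄ = push x a e₅ e₆ := by
  subst hx
  unfold push
  rw [← functoriality_comp, comp_comp₁]

end VirtualEquipment

theorem LooseChain.one_append {Ob : Type u} {L : Ob → Ob → Type w} {A B C : Ob} (p : L A B)
    (ps : LooseChain L B C) : (LooseChain.one p).append ps = .cons p ps := rfl

/-! ### Graded morphisms as 2-cells into loose-identities -/

section RelativeMonads

variable {X : Type u} [VirtualDoubleCategory.{u, v, w, z} X] [VirtualEquipment X]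

/-- The nontrivial half of the Yoneda correspondence: linearity in the first argument recovers a
2-cell from its value at the identity on `e`. -/
theorem expand_extract {D D' E : X} {e : D ⟶ E} {e' : D' ⟶ E} {ps : LooseChain Loose D D'}
    (ε : Cell (𝟙 E) (.cons (Hom (𝟙 E) e) ps) (𝟙 D') (Hom (𝟙 E) e')) :
    expand (extract ε) = ε := by
  apply cart_ext (Category.id_comp _) (Category.id_comp _)
  rw [comp₁_expand_cart]
  unfold extract
  rw [lift_cart]
  exact cellMul_cart_eval _

/-- 2-cells `E(1, e), p₁, …, pₙ ⇒ E(1, e')` correspond to 2-cells `p₁, …, pₙ ⇒ E(1, 1)` framed by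
`e` and `e'`. -/
noncomputable def evalCellEquiv {D D' E : X} (e : D ⟶ E) (e' : D' ⟶ E) (ps : LooseChain Loose D D') :
    Cell (𝟙 E) (.cons (Hom (𝟙 E) e) ps) (𝟙 D') (Hom (𝟙 E) e') ≃ Cell e ps e' (looseId E) where
  toFun ε := comp₁ (extract ε) (cart e e') (Category.id_comp _) (Category.id_comp _)
  invFun s := expand (lift s (Category.id_comp _) (Category.id_comp _))
  left_inv ε := by
    dsimp only
    rw [lift_comp_cart, expand_extract]
  right_inv s := by
    dsimp only
    rw [extract_expand, lift_cart]

theorem evalCellEquiv_expand {D D' E : X} {e : D ⟶ E} {e' : D' ⟶ E} {ps : LooseChain Loose D D'}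
    (φ : Cell (𝟙 D) ps (𝟙 D') (Hom e e')) : evalCellEquiv e e' ps (expand φ) =
      comp₁ φ (cart e e') (Category.id_comp _) (Category.id_comp _) := by
  simp only [evalCellEquiv, Equiv.coe_fn_mk, extract_expand]

/-- This replaces postcomposition by `push` in the second clause of the definition of algebra
object. -/
theorem evalCellEquiv_whisker {D D' M E : X} (u : M ⟶ E) {x : D ⟶ M} {x' : D' ⟶ M} {e : D ⟶ E}
    {e' : D' ⟶ E} (h : x ≫ u = e) (h' : x' ≫ u = e') {ps : LooseChain Loose D D'}
    (σ : Cell (𝟙 M) (.cons (Hom (𝟙 M) x) ps) (𝟙 D') (Hom (𝟙 M) x')) :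
    evalCellEquiv e e' ps (whisker u h h' σ) = push u (evalCellEquiv x x' ps σ) h h' := by
  unfold whisker
  rw [evalCellEquiv_expand]
  have h1 := comp_comp₁ (.one (extract σ)) (mapHom u x x' h h') (cart e e') (Category.id_comp _)
    (Category.id_comp _) (Category.id_comp _) (Category.id_comp _) (Category.id_comp _)
    (Category.id_comp _)
  refine h1.symm.trans ?_
  unfold mapHom
  rw [lift_cart]
  exact push_natural u _ _ _ _ _ _ _ _

/-! ### Homomorphisms, mediating tight-cells and algebra objects -/

namespace RelativeMonad

variable {A E : X} {j : A ⟶ E} {T : RelativeMonad j}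

/-- A 2-cell `p₁, …, pₙ ⇒ E(1, 1)` framed by the carriers of two algebras is a homomorphism when it
commutes with the extension operators. -/
def Algebra.IsHom {D D' : X} (a : T.Algebra D) (b : T.Algebra D') {ps : LooseChain Loose D D'}
    (s : Cell a.carrier ps b.carrier (looseId E)) : Prop :=
  act b.ext (cellMul (cart j a.carrier) s (rs := .cons (Hom j a.carrier) ps) (LooseChain.one_append _ _))
      (Category.id_comp _) (Category.id_comp _) =
    cellMul (act a.ext (cart j a.carrier) (Category.id_comp _) (Category.id_comp _)) s
      (rs := .cons (Hom j a.carrier) ps) (LooseChain.one_append _ _)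

/-- `IsHom` speaks of the generic element `cart` only. Any `c` is obtained from `cart` by
precomposing with its lift, and both sides are natural. -/
theorem Algebra.IsHom.act_cellMul {D D' : X} {a : T.Algebra D} {b : T.Algebra D'}
    {ps : LooseChain Loose D D'} {s : Cell a.carrier ps b.carrier (looseId E)} (H : a.IsHom b s)
    {qs : LooseChain Loose A D} {rs : LooseChain Loose A D'} (c : Cell j qs a.carrier (looseId E))
    (h : qs.append ps = rs) :
    act b.ext (cellMul c s h) (Category.id_comp _) (Category.id_comp _) =
      cellMul (act a.ext c (Category.id_comp _) (Category.id_comp _)) s h := by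
  let S : CellSeq Cell (𝟙 A) qs (𝟙 D) (.one (Hom j a.carrier)) :=
    .one (lift c (Category.id_comp j) (Category.id_comp _))
  have h1 := cellMul_natural S (CellSeq.ids idCell ps) (cart j a.carrier) s
    (rs := .cons (Hom j a.carrier) ps) rfl h (Category.id_comp _) (Category.id_comp _)
    (Category.id_comp _)
  have h2 := cellMul_natural S (CellSeq.ids idCell ps)
    (act a.ext (cart j a.carrier) (Category.id_comp _) (Category.id_comp _)) s
    (rs := .cons (Hom j a.carrier) ps) rfl h (Category.id_comp _) (Category.id_comp _)
    (Category.id_comp _)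
  have hc : cellComp S (cart j a.carrier) (Category.id_comp _) (Category.id_comp _) = c :=
    lift_cart c _ _
  have hc' : cellComp S (act a.ext (cart j a.carrier) (Category.id_comp _) (Category.id_comp _))
      (Category.id_comp _) (Category.id_comp _) =
      act a.ext c (Category.id_comp _) (Category.id_comp _) := by
    rw [act_natural a.ext S _ _ _ _ (Category.id_comp _) (Category.id_comp _), hc]
  rw [ids_cellComp, hc] at h1
  rw [ids_cellComp, hc'] at h2
  rw [← h1, ← h2, ← show _ = _ from H]
  exact (act_natural b.ext _ _ _ _ _ (Category.id_comp _) (Category.id_comp _)).symm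

/-- Both directions compare the two sides after composition with the cartesian 2-cell into `E(1,
1)`, where the restrictions along `j` and `t` become products with `φ`. -/
theorem compat_expand_iff {D D' : X} (a : T.Algebra D) (b : T.Algebra D')
    {ps : LooseChain Loose D D'} (φ : Cell (𝟙 D) ps (𝟙 D') (Hom a.carrier b.carrier)) :
    comp₁ (resLeft (expand φ) j) b.ext (Category.id_comp _) (Category.id_comp _) =
      cellComp (.cons a.ext (CellSeq.ids idCell ps) rfl) (resLeft (expand φ) T.carrier)
        (Category.id_comp _) (Category.id_comp _) ↔
    a.IsHom b (comp₁ φ (cart a.carrier b.carrier) (Category.id_comp _) (Category.id_comp _)) := by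
  refine ⟨fun H => ?_, fun H => expand_compat a b φ H⟩
  have H' := congrArg (fun y => comp₁ y (cart T.carrier b.carrier) (Category.id_comp _)
    (Category.id_comp _)) H
  have h1 := comp_comp₁ (.one (resLeft (expand φ) j)) b.ext (cart T.carrier b.carrier)
    (Category.id_comp _) (Category.id_comp _) (Category.id_comp _) (Category.id_comp _)
    (Category.id_comp (𝟙 A)) (Category.id_comp (𝟙 D'))
  let S : CellSeq Cell (𝟙 A) (.cons (Hom j a.carrier) ps) (𝟙 D')
    (.cons (Hom T.carrier a.carrier) ps) := .cons a.ext (CellSeq.ids idCell ps) rfl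
  have h2 := comp_comp₁ S (resLeft (expand φ) T.carrier) (cart T.carrier b.carrier)
    (Category.id_comp _) (Category.id_comp _) (Category.id_comp _) (Category.id_comp _)
    (Category.id_comp (𝟙 A)) (Category.id_comp (𝟙 D'))
  have h4 := h1.trans (H'.trans h2.symm)
  rw [← act_comp_cart b.ext _ (Category.id_comp _) (Category.id_comp _), resLeft_expand,
    resLeft_expand] at h4
  refine h4.trans ?_
  rw [act_cart]
  have h3 := cellMul_natural (.one a.ext) (CellSeq.ids idCell ps) (cart T.carrier a.carrier)
    (comp₁ φ (cart a.carrier b.carrier) (Category.id_comp _) (Category.id_comp _))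
    (rs := .cons (Hom T.carrier a.carrier) ps) rfl (rs' := .cons (Hom j a.carrier) ps) rfl
    (Category.id_comp _) (Category.id_comp _) (Category.id_comp _)
  rw [ids_cellComp] at h3
  exact h3

/-- Graded morphisms correspond to homomorphisms. -/
noncomputable def gradedEquiv {D D' : X} (a : T.Algebra D) (b : T.Algebra D')
    (ps : LooseChain Loose D D') :
    GradedMorphism a b ps ≃ {s : Cell a.carrier ps b.carrier (looseId E) // a.IsHom b s} where
  toFun ε := ⟨evalCellEquiv _ _ ps ε.cell, (compat_expand_iff a b _).1 (by
    rw [expand_extract]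
    exact ε.compat)⟩
  invFun s := ⟨(evalCellEquiv _ _ ps).symm s.1, (compat_expand_iff a b _).2 (by
    rw [lift_cart]
    exact s.2)⟩
  left_inv ε := by
    cases ε
    simp only [Equiv.symm_apply_apply]
  right_inv s := by simp only [Equiv.apply_symm_apply]

/-- The restriction of an algebra along a tight-cell between domains. -/
noncomputable def Algebra.restrict {D D' : X} (a : T.Algebra D) (h : D' ⟶ D) : T.Algebra D' where
  carrier := h ≫ a.carrier
  ext := resRight a.ext h rfl rfl
  ext_unit := by
    rw [unit_law_iff, act_resRight _ _ _ _ _ _ _ (Category.id_comp h),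
      unit_law_general _ _ a.ext_unit]
  assoc := by
    rw [ext_law_iff, act_resRight _ _ _ _ _ _ _ (Category.id_comp h),
      act_resRight _ _ _ _ _ _ _ (Category.id_comp h), ext_law_general _ _ a.assoc]

theorem Algebra.mediates_restrict {D D' : X} (a : T.Algebra D) (h : D' ⟶ D) :
    a.Mediates (a.restrict h) h := ⟨rfl, rfl⟩

/-- Operators out of `E(j, e)` agree as soon as they agree on the generic element, so no restricted
operator has to be handled. -/
theorem Algebra.mediates_iff {M D : X} (U : T.Algebra M) (a : T.Algebra D) (h : D ⟶ M) :
    U.Mediates a h ↔ ∃ e : h ≫ U.carrier = a.carrier, act U.ext (cart j a.carrier) e e =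
      act a.ext (cart j a.carrier) (Category.id_comp _) (Category.id_comp _) := by
  constructor
  · rintro ⟨e, he⟩
    refine ⟨e, ?_⟩
    rw [← he, act_resRight _ _ _ _ _ _ _ (Category.id_comp h)]
  · rintro ⟨e, he⟩
    refine ⟨e, comp_cart_eq_act ?_⟩
    rw [← he, act_resRight _ _ _ _ _ _ _ (Category.id_comp h)]

theorem Algebra.Mediates.act_eq {M D B : X} {U : T.Algebra M} {a : T.Algebra D} {h : D ⟶ M}
    (m : U.Mediates a h) {k : B ⟶ D} {y : B ⟶ E} {ps : LooseChain Loose A B}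
    (c : Cell j ps y (looseId E)) {l : B ⟶ M} (hl : k ≫ h = l) (e : l ≫ U.carrier = y)
    (e' : k ≫ a.carrier = y) : act U.ext c e e = act a.ext c e' e' := by
  obtain ⟨e₀, he⟩ := m
  rw [← he, act_resRight _ _ _ _ _ _ _ hl]

/-- A way to prove equality of algebras whose carriers are not syntactically equal: mediation by the
identity compares the operators without transport, and the laws are propositions. -/
theorem Algebra.eq_of_mediates_id {D : X} {a b : T.Algebra D} (m : a.Mediates b (𝟙 D)) :
    a = b := by
  obtain ⟨e, he⟩ := (mediates_iff _ _ _).1 m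
  obtain ⟨ac, ax, _, _⟩ := a
  obtain ⟨bc, bx, _, _⟩ := b
  dsimp only at e he
  rw [Category.id_comp] at e
  subst e
  have := comp_cart_eq_act he
  subst this
  rfl

/-- Actions of tight-cells into the domain of an algebra are homomorphisms. -/
theorem Algebra.Mediates.isHom_push {M D D' : X} {U : T.Algebra M} {a : T.Algebra D}
    {b : T.Algebra D'} {h : D ⟶ M} {h' : D' ⟶ M} (m : U.Mediates a h) (m' : U.Mediates b h')
    {ps : LooseChain Loose D D'} (σ : Cell h ps h' (looseId M)) :
    a.IsHom b (push U.carrier σ m.choose m'.choose) := by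
  unfold Algebra.IsHom
  rw [← m.act_eq _ (Category.id_comp _) m.choose, ← m'.act_eq _ (Category.id_comp _) m'.choose]
  exact act_cellMul_push U.ext _ _ _ _ _ _ _

/-- The second clause of the definition, carried across `gradedEquiv` and `evalCellEquiv`. -/
theorem isAlgebraObject_iff {M : X} (U : T.Algebra M) : IsAlgebraObject U ↔
    (∀ {D : X} (a : T.Algebra D), ∃! h : D ⟶ M, U.Mediates a h) ∧
    ∀ {D D' : X} (a : T.Algebra D) (b : T.Algebra D') {h : D ⟶ M} {h' : D' ⟶ M}
      (m : U.Mediates a h) (m' : U.Mediates b h') {ps : LooseChain Loose D D'}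
      (s : Cell a.carrier ps b.carrier (looseId E)), a.IsHom b s →
      ∃! σ : Cell h ps h' (looseId M), push U.carrier σ m.choose m'.choose = s := by
  constructor
  · intro hU
    refine ⟨hU.existsUnique_tight, fun {D D'} a b {h h'} m m' {ps} s hs => ?_⟩
    obtain ⟨σ, hσ, uniq⟩ := hU.existsUnique_cell a b m m' ((gradedEquiv a b ps).symm ⟨s, hs⟩)
    refine ⟨evalCellEquiv _ _ _ σ, ?_, fun τ hτ => ?_⟩
    · dsimp only at hσ ⊢
      rw [← evalCellEquiv_whisker, hσ]
      exact (evalCellEquiv _ _ ps).apply_symm_apply s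
    · rw [← Equiv.symm_apply_eq]
      apply uniq
      apply (evalCellEquiv _ _ _).injective
      rw [evalCellEquiv_whisker, Equiv.apply_symm_apply, hτ]
      exact ((evalCellEquiv _ _ ps).apply_symm_apply s).symm
  · rintro ⟨h1, h2⟩
    refine ⟨h1, fun {D D'} a b {h h'} m m' {ps} ε => ?_⟩
    obtain ⟨σ, hσ, uniq⟩ := h2 a b m m' (gradedEquiv a b ps ε).1 (gradedEquiv a b ps ε).2
    refine ⟨(evalCellEquiv _ _ _).symm σ, ?_, fun τ hτ => ?_⟩
    · apply (evalCellEquiv _ _ _).injective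
      rw [evalCellEquiv_whisker, Equiv.apply_symm_apply]
      exact hσ
    · rw [Equiv.eq_symm_apply]
      apply uniq
      dsimp only at hτ ⊢
      rw [← evalCellEquiv_whisker, hτ]
      rfl

namespace IsAlgebraObject

variable {M : X} {U : T.Algebra M}

/-- Any tight-cells `h` and `h'` mediate the restrictions of `U` along them. For these restrictions
`push τ` is a homomorphism, and both `σ` and `τ` lift it. -/
theorem push_injective (hU : IsAlgebraObject U) {D D' : X} {h : D ⟶ M} {h' : D' ⟶ M} {e : D ⟶ E} {e' : D' ⟶ E}
    {ps : LooseChain Loose D D'} (σ τ : Cell h ps h' (looseId M)) (he : h ≫ U.carrier = e)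
    (he' : h' ≫ U.carrier = e') (H : push U.carrier σ he he' = push U.carrier τ he he') :
    σ = τ := by
  subst he he'
  exact (((isAlgebraObject_iff U).1 hU).2 (U.restrict h) (U.restrict h') (U.mediates_restrict h)
    (U.mediates_restrict h') _ ((U.mediates_restrict h).isHom_push (U.mediates_restrict h') τ)).unique
    H rfl

theorem exists_push_eq (hU : IsAlgebraObject U) {D D' : X} {a : T.Algebra D} {b : T.Algebra D'} {h : D ⟶ M} {h' : D' ⟶ M}
    (m : U.Mediates a h) (m' : U.Mediates b h') {ps : LooseChain Loose D D'}
    {s : Cell a.carrier ps b.carrier (looseId E)} (hs : a.IsHom b s) :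
    ∃ σ : Cell h ps h' (looseId M), push U.carrier σ m.choose m'.choose = s :=
  (((isAlgebraObject_iff U).1 hU).2 a b m m' s hs).exists

end IsAlgebraObject

end RelativeMonad

/-! ### Postcomposition of monads and algebras, as a relation -/

namespace RelativeAdjunction

variable {A M E : X} {j : A ⟶ E} {l : A ⟶ M} {r : M ⟶ E}

/-- `T₁` is, up to equality of its carrier, the postcomposite of `T` and the right adjoint. -/
structure IsPostcompMonad (adj : RelativeAdjunction j l r) (T : RelativeMonad l)
    (T₁ : RelativeMonad j) : Prop where
  carrier : T.carrier ≫ r = T₁.carrier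
  unit : act adj.sharp T.unit (Category.comp_id _) carrier = T₁.unit
  act_ext : ∀ {B : X} {k : B ⟶ A} {x : B ⟶ M} {y : B ⟶ E} {ps : LooseChain Loose A B}
    (c : Cell j ps y (looseId E)) (e : k ≫ T₁.carrier = y) (h : k ≫ T.carrier = x)
    (h' : x ≫ r = y), act T₁.ext c e e =
      push r (act T.ext (act adj.flat c h' (Category.comp_id x)) h h) carrier h'

/-- `b` is, up to equality of its carrier, the postcomposition of `a` by the right adjoint. -/
structure IsPostcompAlgebra (adj : RelativeAdjunction j l r) {T : RelativeMonad l}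
    {T₁ : RelativeMonad j} (P : adj.IsPostcompMonad T T₁) {D : X} (a : T.Algebra D)
    (b : T₁.Algebra D) : Prop where
  carrier : a.carrier ≫ r = b.carrier
  act_ext : ∀ {B : X} {k : B ⟶ D} {x : B ⟶ M} {y : B ⟶ E} {ps : LooseChain Loose A B}
    (c : Cell j ps y (looseId E)) (e : k ≫ b.carrier = y) (h : k ≫ a.carrier = x)
    (h' : x ≫ r = y), act b.ext c e e =
      push r (act a.ext (act adj.flat c h' (Category.comp_id x)) h h) P.carrier h'

theorem isPostcompMonad_postcompMonad (adj : RelativeAdjunction j l r) (T : RelativeMonad l) :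
    adj.IsPostcompMonad T (adj.postcompMonad T) where
  carrier := rfl
  unit := rfl
  act_ext c e h h' := adj.act_postcompExt T.ext c e h h'

theorem isPostcompAlgebra_postcompAlgebra (adj : RelativeAdjunction j l r) {T : RelativeMonad l}
    {D : X} (a : T.Algebra D) :
    adj.IsPostcompAlgebra (adj.isPostcompMonad_postcompMonad T) a (adj.postcompAlgebra a) where
  carrier := rfl
  act_ext c e h h' := adj.act_postcompExt a.ext c e h h'

theorem IsPostcompMonad.selfAlgebra {adj : RelativeAdjunction j l r} {T : RelativeMonad l}
    {T₁ : RelativeMonad j} (P : adj.IsPostcompMonad T T₁) :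
    adj.IsPostcompAlgebra P T.selfAlgebra T₁.selfAlgebra where
  carrier := P.carrier
  act_ext := P.act_ext

/-- `postcompAlgebra` gives an algebra for the literal postcomposite. Here the carrier of `T₁` is
equal to `T.carrier ≫ r` only propositionally, so the operator is rebuilt over it. -/
theorem IsPostcompMonad.exists_isPostcompAlgebra {adj : RelativeAdjunction j l r}
    {T : RelativeMonad l} {T₁ : RelativeMonad j} (P : adj.IsPostcompMonad T T₁) {D : X}
    (a : T.Algebra D) : ∃ b : T₁.Algebra D, adj.IsPostcompAlgebra P a b := by
  let φ : Cell (𝟙 A) (.one (Hom j (a.carrier ≫ r))) (𝟙 D) (Hom T₁.carrier (a.carrier ≫ r)) :=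
    lift (push r (act a.ext (act adj.flat (cart j (a.carrier ≫ r)) rfl (Category.comp_id _))
      (Category.id_comp _) (Category.id_comp _)) P.carrier rfl) (Category.id_comp _)
      (Category.id_comp _)
  -- `φ` prescribes the formula on the generic element; naturality extends it to all elements.
  have hφ : ∀ {B : X} {k : B ⟶ D} {x : B ⟶ M} {y : B ⟶ E} {ps : LooseChain Loose A B}
    (c : Cell j ps y (looseId E)) (e : k ≫ a.carrier ≫ r = y) (h : k ≫ a.carrier = x)
    (h' : x ≫ r = y), act φ c e e =
      push r (act a.ext (act adj.flat c h' (Category.comp_id x)) h h) P.carrier h' := by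
    intro B k x y ps c e h h'
    rw [act_lift, push_natural r _ _ _ _ _ _ (Category.id_comp _) h,
      act_natural a.ext _ _ _ _ _ h (Category.comp_id k), act_natural adj.flat _ _ _ _ _ e h,
      lift_cart]
  refine ⟨⟨a.carrier ≫ r, φ, ?_, ?_⟩, ⟨rfl, hφ⟩⟩
  -- As the unit of `T₁` is the transpose of the unit of `T`, the product is the transpose of a
  -- product to which the unit law of `a` applies.
  · rw [unit_law_iff, hφ _ _ (Category.id_comp _) rfl, ← P.unit, ← act_sharp_cellMul,
      unit_law_general _ _ a.ext_unit, act_sharp_flat]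
  · rw [ext_law_iff, hφ _ _ (Category.id_comp _) rfl, hφ _ _ (Category.id_comp _) rfl,
      P.act_ext _ _ (Category.id_comp _) P.carrier, adj.act_flat_cellMul _ _ _ P.carrier rfl,
      ext_law_general _ _ a.assoc, push_cellMul]

/-- The formula `act_ext` expresses the operator of the postcomposition through `a` alone. -/
theorem IsPostcompAlgebra.unique {adj : RelativeAdjunction j l r} {T : RelativeMonad l}
    {T₁ : RelativeMonad j} {P : adj.IsPostcompMonad T T₁} {D : X} {a : T.Algebra D}
    {b b' : T₁.Algebra D} (h : adj.IsPostcompAlgebra P a b) (h' : adj.IsPostcompAlgebra P a b') :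
    b = b' := by
  apply RelativeMonad.Algebra.eq_of_mediates_id
  have e : 𝟙 D ≫ b.carrier = b'.carrier :=
    (Category.id_comp _).trans (h.carrier.symm.trans h'.carrier)
  refine (RelativeMonad.Algebra.mediates_iff _ _ _).2 ⟨e, ?_⟩
  rw [h.act_ext _ e (Category.id_comp _) h'.carrier,
    h'.act_ext _ (Category.id_comp _) (Category.id_comp _) h'.carrier]

end RelativeAdjunction

/-! ### Algebras compatible with a relative adjunction -/

namespace RelativeMonad

variable {A M E : X} {j : A ⟶ E}

/-- A relative adjunction whose right adjoint carries a `T`-algebra is compatible with it when the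
extension operator of the algebra is the action of the right adjoint on transposes, and the left
adjoint mediates `T` as an algebra, with the unit as transpose of the identity. -/
structure Algebra.IsCompatible {T : RelativeMonad j} (U : T.Algebra M) {l : A ⟶ M}
    (adj : RelativeAdjunction j l U.carrier) : Prop where
  left : l ≫ U.carrier = T.carrier
  act_ext : ∀ {ps : LooseChain Loose A A} (c : Cell j ps T.carrier (looseId E)),
    act U.ext c left left = act T.ext c (Category.id_comp _) (Category.id_comp _)
  push_flat : ∀ {B : X} {x : B ⟶ M} {y : B ⟶ E} {ps : LooseChain Loose A B}
    (c : Cell j ps y (looseId E)) (e : x ≫ U.carrier = y),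
    push U.carrier (act adj.flat c e (Category.comp_id x)) left e = act U.ext c e e
  unit : act adj.sharp (cellOne l) (Category.comp_id l) left = T.unit

/-- The instance needed for the first statement. The clause `push_flat` is the property by which `♭`
was chosen: it lifts the operator of `U` through the action of `u`. -/
theorem IsAlgebraObject.isCompatible_adjunction {T : RelativeMonad j} {U : T.Algebra M}
    (hU : IsAlgebraObject U) : U.IsCompatible hU.adjunction where
  left := hU.free_comp
  act_ext := hU.act_ext_free
  push_flat {B x y ps} c e := by
    have h : comp₁ hU.adjunction.flat (mapHom U.carrier hU.free (𝟙 M) hU.free_comp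
        (Category.id_comp _)) (Category.id_comp _) (Category.id_comp _) = U.ext :=
      hU.existsUnique_flat.choose_spec.1
    rw [← h, act_act _ _ _ e (Category.comp_id x) e, act_mapHom]
  unit := by
    have h : hU.adjunction.sharp = comp₁ (mapHom U.carrier hU.free (𝟙 M) hU.free_comp
        (Category.id_comp _)) (preHom T.unit U.carrier) (Category.id_comp _)
        (Category.id_comp _) := rfl
    rw [h, act_act _ _ _ _ hU.free_comp, act_mapHom, act_preHom, push_cellOne]
    exact cellMul_cellOne _ _

/-! ### Algebras and homomorphisms of a postcomposite, compared with those of `T` -/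

namespace Algebra.IsCompatible

variable {T' : RelativeMonad j} {U : T'.Algebra M} {l : A ⟶ M}
  {adj : RelativeAdjunction j l U.carrier} {T : RelativeMonad l} {T₁ : RelativeMonad j}

/-- The 2-cell `T' ⇒ (T ; u)` induced by the unit of `T`. -/
noncomputable def baseUnit (H : U.IsCompatible adj) (P : adj.IsPostcompMonad T T₁) :
    TightTwoCell T'.carrier T₁.carrier :=
  push U.carrier T.unit H.left P.carrier

/-- Naturality of `♯`, applied to the unit of `T` written as its product with the identity on `l`.
-/
theorem unit_baseUnit (H : U.IsCompatible adj) (P : adj.IsPostcompMonad T T₁) :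
    cellMul T'.unit (H.baseUnit P) (LooseChain.nil_append _) = T₁.unit := by
  have h := adj.act_sharp_cellMul (cellOne l) T.unit (LooseChain.nil_append _) H.left P.carrier
  rw [cellOne_cellMul, H.unit, P.unit] at h
  exact h.symm

/-- Precomposition of the extension operator of a postcomposite with the induced unit is the
extension operator of `u`. -/
theorem baseUnit_act_ext (H : U.IsCompatible adj) {P : adj.IsPostcompMonad T T₁} {D : X}
    {a : T.Algebra D} {b : T₁.Algebra D} (hab : adj.IsPostcompAlgebra P a b)
    {B : X} {k : B ⟶ D} {x : B ⟶ M} {y : B ⟶ E} {ps : LooseChain Loose A B}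
    (c : Cell j ps y (looseId E)) (e : k ≫ b.carrier = y) (h : k ≫ a.carrier = x)
    (h' : x ≫ U.carrier = y) :
    cellMul (rs := ps) (H.baseUnit P) (act b.ext c e e) (LooseChain.nil_append _) =
      act U.ext c h' h' := by
  rw [hab.act_ext c e h h']
  unfold baseUnit
  -- Moved inside `push`, the induced 2-cell becomes the unit of `T`, which cancels the operator of
  -- `a`. What remains is the image of `♭` of `c`, which compatibility identifies.
  rw [← push_cellMul, unit_law_general _ _ a.ext_unit _ h, H.push_flat]

/-- With `unit_baseUnit`, this makes the induced 2-cell a morphism of monads from `T'` to `T₁`. Both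
sides equal the operator of `U` at the product of `c` with the image of the unit of `T`: one by
`baseUnit_act_ext`, the other because operators commute with multiplication on the right by images
of 2-cells. -/
theorem ext_baseUnit (H : U.IsCompatible adj) (P : adj.IsPostcompMonad T T₁)
    {ps : LooseChain Loose A A} (c : Cell j ps T'.carrier (looseId E)) :
    cellMul (act T'.ext c (Category.id_comp _) (Category.id_comp _)) (H.baseUnit P)
        (LooseChain.append_nil ps) =
      cellMul (rs := ps) (H.baseUnit P) (act T₁.ext
        (cellMul c (H.baseUnit P) (LooseChain.append_nil ps))
        (Category.id_comp _) (Category.id_comp _)) (LooseChain.nil_append _) := by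
  refine Eq.trans ?_ (H.baseUnit_act_ext P.selfAlgebra _ (Category.id_comp _)
    (Category.id_comp _) P.carrier).symm
  rw [← H.act_ext]
  exact (act_cellMul_push U.ext c T.unit _ H.left H.left P.carrier P.carrier).symm

/-- The `T'`-algebra underlying a `(T ; u)`-algebra. -/
noncomputable def base (H : U.IsCompatible adj) (P : adj.IsPostcompMonad T T₁) {D : X}
    (b : T₁.Algebra D) : T'.Algebra D where
  carrier := b.carrier
  ext := comp₁ b.ext (preHom (H.baseUnit P) b.carrier) (Category.id_comp _) (Category.id_comp _)
  ext_unit := by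
    rw [unit_law_iff, act_act _ _ _ _ (Category.id_comp _), act_preHom,
      ← cellMul_assoc T'.unit (H.baseUnit P) _ (LooseChain.nil_append _)
        (LooseChain.nil_append _) _ _, unit_baseUnit]
    exact unit_law_general _ _ b.ext_unit _ _
  assoc := by
    rw [ext_law_iff, act_act _ _ _ _ (Category.id_comp _), act_preHom,
      act_act _ _ _ _ (Category.id_comp _), act_preHom,
      ← cellMul_assoc (cart j T'.carrier) (H.baseUnit P) _ (LooseChain.append_nil _) rfl _ _,
      ext_law_general _ _ b.assoc,
      ← cellMul_assoc (H.baseUnit P) _ _ (LooseChain.nil_append _) rfl _ _,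
      ← cellMul_assoc _ (H.baseUnit P) _ (LooseChain.append_nil _) rfl _ _]
    -- After reassociation and the extension law of `b`, only compatibility of the induced 2-cell
    -- with the extension operators is left.
    exact congrArg (fun y => cellMul y _ _) (H.ext_baseUnit P _).symm

theorem act_base_ext (H : U.IsCompatible adj) (P : adj.IsPostcompMonad T T₁) {D : X}
    (b : T₁.Algebra D) {B : X} {k : B ⟶ D} {y : B ⟶ E}
    {ps : LooseChain Loose A B} (c : Cell j ps y (looseId E)) (e : k ≫ b.carrier = y) :
    act (H.base P b).ext c e e =
      cellMul (rs := ps) (H.baseUnit P) (act b.ext c e e) (LooseChain.nil_append _) := by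
  refine Eq.trans (act_act _ _ _ e e e) ?_
  rw [act_preHom]

theorem mediates_base_iff (H : U.IsCompatible adj) (P : adj.IsPostcompMonad T T₁) {D : X}
    (b : T₁.Algebra D) (h : D ⟶ M) :
    U.Mediates (H.base P b) h ↔ ∃ e : h ≫ U.carrier = b.carrier,
      act U.ext (cart j b.carrier) e e = cellMul (H.baseUnit P)
        (act b.ext (cart j b.carrier) (Category.id_comp _) (Category.id_comp _))
        (rs := .one (Hom j b.carrier)) (LooseChain.nil_append _) := by
  rw [mediates_iff]
  refine exists_congr fun e => ?_
  rw [← act_base_ext]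
  rfl

/-- Hence the carrier of `a` can be recovered from `b`, through uniqueness of mediating tight-cells
into an algebra object. -/
theorem mediates_base (H : U.IsCompatible adj) {P : adj.IsPostcompMonad T T₁} {D : X}
    {a : T.Algebra D} {b : T₁.Algebra D} (hab : adj.IsPostcompAlgebra P a b) :
    U.Mediates (H.base P b) a.carrier :=
  (H.mediates_base_iff P b _).2 ⟨hab.carrier,
    (H.baseUnit_act_ext hab _ _ (Category.id_comp _) _).symm⟩

/-- The operator of `base` multiplies that of `b` on the left, while a homomorphism multiplies on
the right; associativity separates the two. -/
theorem isHom_base (H : U.IsCompatible adj) (P : adj.IsPostcompMonad T T₁) {D D' : X}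
    {b : T₁.Algebra D} {b' : T₁.Algebra D'} {ps : LooseChain Loose D D'}
    {s : Cell b.carrier ps b'.carrier (looseId E)} (hs : b.IsHom b' s) :
    (H.base P b).IsHom (H.base P b') s := by
  refine (H.act_base_ext P b' _ _).trans ?_
  refine Eq.trans ?_ (congrArg (fun y => cellMul y _ _) (H.act_base_ext P b _ _).symm)
  refine (congrArg (fun y => cellMul (H.baseUnit P) y _) (hs.act_cellMul _ _)).trans ?_
  exact (cellMul_assoc _ _ _ _ _ _ _).symm

/-- Carriers agree because both mediate the same `T'`-algebra. Operators agree because their images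
under the injective `push u` are both given by the operator of `b`. -/
theorem eq_of_isPostcompAlgebra (H : U.IsCompatible adj) (hU : IsAlgebraObject U)
    {P : adj.IsPostcompMonad T T₁} {D : X} {a a' : T.Algebra D} {b : T₁.Algebra D}
    (hab : adj.IsPostcompAlgebra P a b) (hab' : adj.IsPostcompAlgebra P a' b) : a = a' := by
  apply eq_of_mediates_id
  have hc : a.carrier = a'.carrier :=
    (hU.existsUnique_tight (H.base P b)).unique (H.mediates_base hab) (H.mediates_base hab')
  have e : 𝟙 D ≫ a.carrier = a'.carrier := (Category.id_comp _).trans hc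
  refine (mediates_iff _ _ _).2 ⟨e, ?_⟩
  apply hU.push_injective _ _ P.carrier hab'.carrier
  -- `act_ext` evaluates the operators of `a` and `a'` at `♭` of its argument; taking the argument
  -- to be a `♯` makes this the generic element.
  have h1 := hab.act_ext (act adj.sharp (cart l a'.carrier) (Category.comp_id _) hab'.carrier)
    (Category.id_comp _) e hab'.carrier
  have h2 := hab'.act_ext (act adj.sharp (cart l a'.carrier) (Category.comp_id _) hab'.carrier)
    (Category.id_comp _) (Category.id_comp _) hab'.carrier
  rw [adj.act_flat_sharp] at h1 h2
  exact h1.symm.trans h2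

/-- The transposed operator of `b` is a homomorphism graded by `M(l, h)`, and the algebra object
lifts it through `u` to an operator on `h`. -/
theorem exists_lift_ext (H : U.IsCompatible adj) (hU : IsAlgebraObject U)
    (P : adj.IsPostcompMonad T T₁) {D : X} (b : T₁.Algebra D) {h : D ⟶ M}
    (m : U.Mediates (H.base P b) h) (e : h ≫ U.carrier = b.carrier) :
    ∃ φ : Cell (𝟙 A) (.one (Hom l h)) (𝟙 D) (Hom T.carrier h),
      ∀ {B : X} {k : B ⟶ D} {x : B ⟶ M} {y : B ⟶ E} {ps : LooseChain Loose A B}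
        (c : Cell l ps x (looseId M)) (e₁ : k ≫ h = x) (e₂ : k ≫ b.carrier = y)
        (e₃ : x ≫ U.carrier = y), push U.carrier (act φ c e₁ e₁) P.carrier e₃ =
          act b.ext (act adj.sharp c (Category.comp_id _) e₃) e₂ e₂ := by
  -- The homomorphism equation is the associativity law of `b`, with the single loose-cell `M(l, h)`
  -- as grade.
  have hs : T₁.selfAlgebra.IsHom b (act b.ext (act adj.sharp (cart l h) (Category.comp_id _) e)
      (Category.id_comp _) (Category.id_comp _)) := ext_law_general _ _ b.assoc _ _ _ _
  -- `T₁` as its own algebra is the postcomposition of `T` as its own algebra, so `T.carrier`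
  -- mediates its `base`.
  obtain ⟨σ, hσ⟩ : ∃ σ : Cell T.carrier (.one (Hom l h)) h (looseId M),
      push U.carrier σ P.carrier e = act b.ext (act adj.sharp (cart l h) (Category.comp_id _) e)
        (Category.id_comp _) (Category.id_comp _) :=
    hU.exists_push_eq (H.mediates_base P.selfAlgebra) m (H.isHom_base P hs)
  refine ⟨lift σ (Category.id_comp _) (Category.id_comp _), fun {B k x y ps} c e₁ e₂ e₃ => ?_⟩
  rw [act_lift, ← push_natural U.carrier _ σ P.carrier e (Category.id_comp _) e₂, hσ,
    act_natural b.ext _ _ _ _ _ e₂ (Category.comp_id k), act_natural adj.sharp _ _ _ _ _ e₁ e₁,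
    lift_cart]

/-- The carrier comes from the algebra object and the operator from `exists_lift_ext`. The laws hold
after applying `push u`, hence before. -/
theorem exists_isPostcompAlgebra (H : U.IsCompatible adj) (hU : IsAlgebraObject U)
    (P : adj.IsPostcompMonad T T₁) {D : X} (b : T₁.Algebra D) :
    ∃ a : T.Algebra D, adj.IsPostcompAlgebra P a b := by
  obtain ⟨h, m, -⟩ := hU.existsUnique_tight (H.base P b)
  obtain ⟨e, he⟩ := (H.mediates_base_iff P b h).1 m
  obtain ⟨φ, hφ⟩ := H.exists_lift_ext hU P b m e
  refine ⟨⟨h, φ, ?_, ?_⟩, ⟨e, fun {B k x y ps} c e₁ e₂ e₃ => ?_⟩⟩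
  · rw [unit_law_iff]
    apply hU.push_injective _ _ H.left e
    rw [push_cellMul _ _ _ _ H.left P.carrier e, hφ _ _ (Category.id_comp _) e]
    -- The image of the left-hand side is the operator of `base`, which is that of `U` since `h`
    -- mediates. By `push_flat` it is then the image of `♭` of a `♯`, that is, of the generic
    -- element.
    refine (H.act_base_ext P b _ _).symm.trans ?_
    refine (m.act_eq _ (Category.id_comp _) e _).symm.trans ?_
    rw [← H.push_flat _ e, adj.act_flat_sharp]
  · rw [ext_law_iff]
    apply hU.push_injective _ _ P.carrier e
    -- Under `push u` both sides turn into the two sides of the extension law of `b` at transposed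
    -- elements.
    rw [hφ _ _ (Category.id_comp _) e, adj.act_sharp_cellMul _ _ _ P.carrier e,
      hφ _ _ (Category.id_comp _) e,
      ext_law_general _ _ b.assoc, push_cellMul _ _ _ _ P.carrier P.carrier e,
      hφ _ _ (Category.id_comp _) e,
      P.act_ext _ (Category.id_comp _) (Category.id_comp _) P.carrier, adj.act_flat_sharp]
  · exact (by rw [adj.act_sharp_flat] : act b.ext c e₁ e₁ = act b.ext (act adj.sharp
      (act adj.flat c e₃ (Category.comp_id x)) (Category.comp_id x) e₃) e₁ e₁).trans
      (hφ _ e₂ e₁ e₃).symm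

/-- At an element `c`, the two sides of the equation for the image of `s` are the images of the two
sides of the equation for `s` at `♭` of `c`. One direction then needs injectivity of `push u`, at
`c` the `♯` of the generic element. -/
theorem _root_.RelativeMonad.IsAlgebraObject.isHom_push_iff (hU : IsAlgebraObject U)
    {P : adj.IsPostcompMonad T T₁} {D D' : X} {a : T.Algebra D} {a' : T.Algebra D'}
    {b : T₁.Algebra D} {b' : T₁.Algebra D'} (hab : adj.IsPostcompAlgebra P a b)
    (hab' : adj.IsPostcompAlgebra P a' b') {ps : LooseChain Loose D D'}
    (s : Cell a.carrier ps a'.carrier (looseId M)) :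
    b.IsHom b' (push U.carrier s hab.carrier hab'.carrier) ↔ a.IsHom a' s := by
  have key : ∀ {qs : LooseChain Loose A D} {rs : LooseChain Loose A D'}
      (c : Cell j qs b.carrier (looseId E)) (h : qs.append ps = rs),
      act b'.ext (cellMul c (push U.carrier s hab.carrier hab'.carrier) h)
        (Category.id_comp _) (Category.id_comp _) =
      push U.carrier (act a'.ext (cellMul (act adj.flat c hab.carrier (Category.comp_id _)) s h)
        (Category.id_comp _) (Category.id_comp _)) P.carrier hab'.carrier := by
    intro qs rs c h
    rw [hab'.act_ext _ _ (Category.id_comp _) hab'.carrier, adj.act_flat_cellMul]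
  have key' : ∀ {qs : LooseChain Loose A D} {rs : LooseChain Loose A D'}
      (c : Cell j qs b.carrier (looseId E)) (h : qs.append ps = rs),
      cellMul (act b.ext c (Category.id_comp _) (Category.id_comp _))
        (push U.carrier s hab.carrier hab'.carrier) h =
      push U.carrier (cellMul (act a.ext (act adj.flat c hab.carrier (Category.comp_id _))
        (Category.id_comp _) (Category.id_comp _)) s h) P.carrier hab'.carrier := by
    intro qs rs c h
    rw [push_cellMul _ _ _ _ P.carrier hab.carrier hab'.carrier,
      hab.act_ext _ _ (Category.id_comp _) hab.carrier]
  constructor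
  · intro h
    have h1 := h.act_cellMul (act adj.sharp (cart l a.carrier) (Category.comp_id _) hab.carrier)
      (LooseChain.one_append _ ps)
    rw [key, key', adj.act_flat_sharp] at h1
    exact hU.push_injective _ _ P.carrier hab'.carrier h1
  · intro h
    refine (key _ _).trans (Eq.trans ?_ (key' _ _).symm)
    rw [h.act_cellMul]

/-- A `T₁`-homomorphism is a `T'`-homomorphism, so it lifts through the algebra object; the lift is
a `T`-homomorphism by reflection. -/
theorem exists_push_eq_of_isHom (H : U.IsCompatible adj) (hU : IsAlgebraObject U)
    {P : adj.IsPostcompMonad T T₁} {D D' : X} {a : T.Algebra D} {a' : T.Algebra D'}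
    {b : T₁.Algebra D} {b' : T₁.Algebra D'} (hab : adj.IsPostcompAlgebra P a b)
    (hab' : adj.IsPostcompAlgebra P a' b') {ps : LooseChain Loose D D'}
    {s : Cell b.carrier ps b'.carrier (looseId E)} (hs : b.IsHom b' s) :
    ∃ t : Cell a.carrier ps a'.carrier (looseId M), a.IsHom a' t ∧
      push U.carrier t hab.carrier hab'.carrier = s := by
  obtain ⟨t, ht⟩ : ∃ t : Cell a.carrier ps a'.carrier (looseId M),
      push U.carrier t hab.carrier hab'.carrier = s :=
    hU.exists_push_eq (H.mediates_base hab) (H.mediates_base hab') (H.isHom_base P hs)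
  exact ⟨t, (hU.isHom_push_iff hab hab' t).1 (ht ▸ hs), ht⟩

theorem bijective_postcompAlgebra (H : U.IsCompatible adj) (hU : IsAlgebraObject U)
    (T : RelativeMonad l) (D : X) :
    Function.Bijective (fun a : T.Algebra D => adj.postcompAlgebra a) := by
  refine ⟨fun a b h => H.eq_of_isPostcompAlgebra hU (adj.isPostcompAlgebra_postcompAlgebra a) ?_,
    fun b => ?_⟩
  · rw [show adj.postcompAlgebra a = adj.postcompAlgebra b from h]
    exact adj.isPostcompAlgebra_postcompAlgebra b
  · obtain ⟨a, ha⟩ := H.exists_isPostcompAlgebra hU (adj.isPostcompMonad_postcompMonad T) b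
    exact ⟨a, (adj.isPostcompAlgebra_postcompAlgebra a).unique ha⟩

theorem exists_gradedMorphism_equiv (H : U.IsCompatible adj) (hU : IsAlgebraObject U)
    {P : adj.IsPostcompMonad T T₁} {D D' : X} {a : T.Algebra D} {a' : T.Algebra D'}
    {b : T₁.Algebra D} {b' : T₁.Algebra D'} (hab : adj.IsPostcompAlgebra P a b)
    (hab' : adj.IsPostcompAlgebra P a' b') (ps : LooseChain Loose D D') :
    ∃ Φ : GradedMorphism a a' ps ≃ GradedMorphism b b' ps,
      ∀ χ, (Φ χ).cell = whisker U.carrier hab.carrier hab'.carrier χ.cell := by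
  let Q : {s : Cell a.carrier ps a'.carrier (looseId M) // a.IsHom a' s} ≃
      {s : Cell b.carrier ps b'.carrier (looseId E) // b.IsHom b' s} :=
    Equiv.ofBijective
      (fun s => ⟨push U.carrier s.1 hab.carrier hab'.carrier,
        (hU.isHom_push_iff hab hab' s.1).2 s.2⟩) (by
        refine ⟨fun s t h => Subtype.ext (hU.push_injective _ _ _ _ (congrArg Subtype.val h)),
          fun s => ?_⟩
        obtain ⟨t, ht, ht'⟩ := H.exists_push_eq_of_isHom hU hab hab' s.2
        exact ⟨⟨t, ht⟩, Subtype.ext ht'⟩)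
  refine ⟨(gradedEquiv a a' ps).trans (Q.trans (gradedEquiv b b' ps).symm), fun χ => ?_⟩
  apply (evalCellEquiv _ _ ps).injective
  rw [evalCellEquiv_whisker]
  exact (evalCellEquiv _ _ ps).apply_symm_apply _

end Algebra.IsCompatible

end RelativeMonad

/-! ### Invariance of algebra objects under isomorphism -/

namespace RelativeMonad

variable {A M N E : X} {j : A ⟶ E} {T : RelativeMonad j}

/-- `R` is the restriction of `U` along `c`, so restricting `R` along `g` is restricting `U` along
`g ≫ c`. -/
theorem Algebra.Mediates.mediates_iff_comp {U : T.Algebra M} {R : T.Algebra N} {c : N ⟶ M}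
    (m : U.Mediates R c) {D : X} (a : T.Algebra D) (g : D ⟶ N) :
    R.Mediates a g ↔ U.Mediates a (g ≫ c) := by
  have hc : c ≫ U.carrier = R.carrier := m.choose
  rw [mediates_iff, mediates_iff]
  constructor
  · rintro ⟨e, he⟩
    have e' : (g ≫ c) ≫ U.carrier = a.carrier := by rw [Category.assoc, hc, e]
    exact ⟨e', (m.act_eq _ rfl e' e).trans he⟩
  · rintro ⟨e', he⟩
    have e : g ≫ R.carrier = a.carrier := by rw [← hc, ← Category.assoc, e']
    exact ⟨e, (m.act_eq _ rfl e' e).symm.trans he⟩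

/-- Algebra objects are invariant under isomorphism. -/
theorem IsAlgebraObject.of_iso {U : T.Algebra M} (hU : IsAlgebraObject U) {R : T.Algebra N}
    {c : N ⟶ M} (m : U.Mediates R c) {d : M ⟶ N} (hcd : c ≫ d = 𝟙 N) (hdc : d ≫ c = 𝟙 M) :
    IsAlgebraObject R := by
  have hc : c ≫ U.carrier = R.carrier := m.choose
  have hd : d ≫ R.carrier = U.carrier := by rw [← hc, ← Category.assoc, hdc, Category.id_comp]
  refine (isAlgebraObject_iff R).2 ⟨fun {D} a => ?_, fun {D D'} a b {g g'} n n' {ps} s hs => ?_⟩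
  · obtain ⟨h, hh, uniq⟩ := hU.existsUnique_tight a
    refine ⟨h ≫ d, ?_, fun g hg => ?_⟩
    · dsimp only
      rw [m.mediates_iff_comp, Category.assoc, hdc, Category.comp_id]
      exact hh
    · rw [← uniq _ ((m.mediates_iff_comp a g).1 hg), Category.assoc, hcd, Category.comp_id]
  · have n₁ := (m.mediates_iff_comp a g).1 n
    have n₁' := (m.mediates_iff_comp b g').1 n'
    obtain ⟨σ, hσ⟩ : ∃ σ : Cell (g ≫ c) ps (g' ≫ c) (looseId M),
        push U.carrier σ n₁.choose n₁'.choose = s := hU.exists_push_eq n₁ n₁' hs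
    have hg : (g ≫ c) ≫ d = g := by rw [Category.assoc, hcd, Category.comp_id]
    have hg' : (g' ≫ c) ≫ d = g' := by rw [Category.assoc, hcd, Category.comp_id]
    -- The lift through `U` has frame `g ≫ c`, `g' ≫ c`; acting with the inverse `d` brings it back
    -- to `g`, `g'`.
    refine ⟨push d σ hg hg', ?_, fun τ hτ => ?_⟩
    · dsimp only
      rw [push_push d R.carrier σ hg hg' _ _ hd n₁.choose n₁'.choose]
      exact hσ
    · have h1 : push c τ rfl rfl = σ := by
        apply hU.push_injective _ _ n₁.choose n₁'.choose
        rw [hσ, push_push c U.carrier τ rfl rfl _ _ hc n.choose n'.choose]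
        exact hτ
      rw [← h1, push_push c d τ rfl rfl hg hg' hcd (Category.comp_id _) (Category.comp_id _),
        push_id]

end RelativeMonad

/-! ### Strict monadicity through the algebra carried by the right adjoint -/

namespace RelativeAdjunction

variable {A C E : X} {j : A ⟶ E} {l : A ⟶ C} {r : C ⟶ E}

theorem monad_carrier (adj : RelativeAdjunction j l r) : l ≫ r = adj.monad.carrier := rfl

theorem monad_unit (adj : RelativeAdjunction j l r) :
    act adj.sharp (cellOne l) (Category.comp_id l) adj.monad_carrier = adj.monad.unit := rfl

theorem act_monad_ext (adj : RelativeAdjunction j l r) {B : X} {k : B ⟶ A} {x : B ⟶ C} {y : B ⟶ E}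
    {ps : LooseChain Loose A B} (c : Cell j ps y (looseId E)) (e : k ≫ adj.monad.carrier = y)
    (h : k ≫ l = x) (h' : x ≫ r = y) : act adj.monad.ext c e e =
      push r (act adj.flat c h' (Category.comp_id x)) adj.monad_carrier h' := by
  refine (act_act _ _ _ e h e).trans ((act_mapHom r l l rfl rfl _ h e).trans ?_)
  exact congrArg (fun z => push r z _ _) (act_resRight _ _ _ _ _ _ _ h)

/-- The transpose of a 2-cell is the composite of its image with the unit. -/
theorem act_sharp_eq (adj : RelativeAdjunction j l r) {B : X} {x : B ⟶ C} {y : B ⟶ E}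
    {ps : LooseChain Loose A B} (c : Cell l ps x (looseId C)) (e : x ≫ r = y) :
    act adj.sharp c (Category.comp_id x) e =
      cellMul (rs := ps) adj.monad.unit (push r c adj.monad_carrier e)
        (LooseChain.nil_append _) := by
  have h := adj.act_sharp_cellMul (cellOne l) c (LooseChain.nil_append _) rfl e
  rw [cellOne_cellMul] at h
  exact h

/-- The right adjoint as an algebra for the induced relative monad. -/
noncomputable def rightAlgebra (adj : RelativeAdjunction j l r) : adj.monad.Algebra C where
  carrier := r
  ext := comp₁ adj.flat (mapHom r l (𝟙 C) adj.monad_carrier (Category.id_comp r))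
    (Category.id_comp _) (Category.id_comp _)
  ext_unit := by
    rw [unit_law_iff, act_act _ _ _ _ (Category.id_comp _), act_mapHom, ← act_sharp_eq,
      act_sharp_flat]
  assoc := by
    rw [ext_law_iff, act_act _ _ _ _ (Category.id_comp _), act_mapHom,
      act_act _ _ _ _ (Category.id_comp _), act_mapHom,
      act_flat_cellMul _ _ _ _ adj.monad_carrier, push_cellMul _ _ _ _ _ adj.monad_carrier,
      adj.act_monad_ext _ _ (Category.id_comp _) adj.monad_carrier]

theorem act_rightAlgebra_ext (adj : RelativeAdjunction j l r) {B : X} {x : B ⟶ C} {y : B ⟶ E}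
    {ps : LooseChain Loose A B} (c : Cell j ps y (looseId E)) (e : x ≫ r = y) :
    act adj.rightAlgebra.ext c e e =
      push r (act adj.flat c e (Category.comp_id x)) adj.monad_carrier e := by
  refine (act_act _ _ _ e (Category.comp_id x) e).trans ?_
  rw [act_mapHom]

/-- The instance needed for the second statement. It requires no monadicity, and it avoids replacing
the apex by a chosen algebra object. -/
theorem isCompatible_rightAlgebra (adj : RelativeAdjunction j l r) :
    adj.rightAlgebra.IsCompatible adj where
  left := adj.monad_carrier
  act_ext c := (adj.act_rightAlgebra_ext c adj.monad_carrier).trans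
    (adj.act_monad_ext c (Category.id_comp _) (Category.id_comp _) adj.monad_carrier).symm
  push_flat c e := (adj.act_rightAlgebra_ext c e).symm
  unit := adj.monad_unit

theorem IsResolutionMorphism.act_sharp {adj : RelativeAdjunction j l r} {C' : X} {l' : A ⟶ C'}
    {r' : C' ⟶ E} {adj' : RelativeAdjunction j l' r'} {c : C ⟶ C'}
    (h : adj.IsResolutionMorphism adj' c) {B : X} {x : B ⟶ C} {x' : B ⟶ C'} {y : B ⟶ E}
    {ps : LooseChain Loose A B} (a : Cell l ps x (looseId C)) (e : x ≫ r = y) (e' : x ≫ c = x')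
    (e'' : x' ≫ r' = y) :
    act adj.sharp a (Category.comp_id x) e =
      act adj'.sharp (push c a h.left e') (Category.comp_id x') e'' := by
  rw [h.sharp, act_act _ _ _ _ e', act_resRight _ _ _ _ _ _ _ e', act_mapHom]

theorem isResolutionMorphism_of_act_sharp {adj : RelativeAdjunction j l r} {C' : X} {l' : A ⟶ C'}
    {r' : C' ⟶ E} {adj' : RelativeAdjunction j l' r'} {c : C ⟶ C'} (hl : l ≫ c = l')
    (hr : c ≫ r' = r)
    (h : act adj.sharp (cart l (𝟙 C)) (Category.comp_id _) (Category.id_comp _) =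
      act adj'.sharp (push c (cart l (𝟙 C)) hl (Category.id_comp c)) (Category.comp_id c) hr) :
    adj.IsResolutionMorphism adj' c where
  left := hl
  right := hr
  sharp := by
    apply comp_cart_eq_act
    rw [act_act _ _ _ _ (Category.id_comp _), act_resRight _ _ _ _ _ _ _ (Category.id_comp _),
      act_mapHom]
    exact h

/-- A relative adjunction is strictly monadic when its right adjoint is an algebra object. -/
theorem isStrictlyMonadic_iff (adj : RelativeAdjunction j l r) :
    adj.IsStrictlyMonadic ↔ RelativeMonad.IsAlgebraObject adj.rightAlgebra := by
  constructor
  · rintro ⟨M, U, hU, c, d, hc, hd, hcd, hdc⟩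
    refine hU.of_iso (c := c) ?_ hcd hdc
    rw [RelativeMonad.Algebra.mediates_iff]
    refine ⟨hc.right, ?_⟩
    refine Eq.trans ?_ (adj.act_rightAlgebra_ext (cart j r) (Category.id_comp r)).symm
    -- At `♭` of the generic element, compatibility of `c` says that `cart` is the transpose, for
    -- `f_T ⊣ u_T`, of the image under `c` of its transpose. Substituted in `push_flat`, this
    -- identifies the operator of `U` with that of `rightAlgebra`.
    have h := hc.act_sharp (act adj.flat (cart j r) (Category.id_comp r) (Category.comp_id _))
      (Category.id_comp r) (Category.id_comp c) hc.right
    rw [act_sharp_flat] at h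
    have hU' := hU.isCompatible_adjunction.push_flat (cart j r) hc.right
    rw [h, act_flat_sharp, push_push c U.carrier _ _ _ _ _ hc.right adj.monad_carrier
      (Category.id_comp r), ← h] at hU'
    exact hU'.symm
  · intro hU
    -- Both tight-cells mediate the monad as an algebra for itself.
    have hl : hU.free = l := by
      refine (hU.existsUnique_tight adj.monad.selfAlgebra).unique hU.mediates_free ?_
      rw [RelativeMonad.Algebra.mediates_iff]
      exact ⟨adj.monad_carrier, adj.isCompatible_rightAlgebra.act_ext _⟩
    have hf : hU.free ≫ r = adj.monad.carrier := hU.free_comp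
    -- Transposition for `hU.adjunction` follows the formula of `act_sharp_eq`. It is stated over
    -- `hU.free`, so that this need not be replaced by `l` inside the frames.
    have hs : ∀ {B : X} {x : B ⟶ C} {y : B ⟶ E} {ps : LooseChain Loose A B}
        (c : Cell hU.free ps x (looseId C)) (e : x ≫ r = y),
        act hU.adjunction.sharp c (Category.comp_id x) e =
          cellMul (rs := ps) adj.monad.unit (push r c hf e)
            (LooseChain.nil_append _) := by
      intro B x y ps c e
      have h := hU.adjunction.act_sharp_cellMul (cellOne _) c (LooseChain.nil_append _)
        hU.free_comp e
      rw [cellOne_cellMul, hU.isCompatible_adjunction.unit] at h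
      exact h
    -- The identity is a morphism of resolutions both ways, since both transpositions multiply the
    -- same unit by the image under `r`.
    refine ⟨C, adj.rightAlgebra, hU, 𝟙 C, 𝟙 C,
      isResolutionMorphism_of_act_sharp ((Category.comp_id _).trans hl.symm) (Category.id_comp _) ?_,
      isResolutionMorphism_of_act_sharp ((Category.comp_id _).trans hl) (Category.id_comp _) ?_,
      Category.comp_id _, Category.comp_id _⟩
    · refine Eq.trans ?_ (hs _ _).symm
      rw [act_sharp_eq]
      exact congrArg (fun z => cellMul adj.monad.unit z _) (push_push (𝟙 C) r _ _ _ _ _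
        (Category.id_comp r) adj.monad_carrier (Category.id_comp r)).symm
    · refine (hs _ _).trans (Eq.trans ?_ (act_sharp_eq adj _ _).symm)
      exact congrArg (fun z => cellMul adj.monad.unit z _) (push_push (𝟙 C) r _ _ _ _ _
        (Category.id_comp r) hf (Category.id_comp r)).symm

end RelativeAdjunction

/-! ### Postcomposition preserves and reflects algebra objects -/

namespace RelativeMonad

variable {A M N E : X} {j : A ⟶ E}

namespace Algebra.IsCompatible

variable {T' : RelativeMonad j} {U : T'.Algebra M} {l : A ⟶ M}
  {adj : RelativeAdjunction j l U.carrier} {T : RelativeMonad l} {T₁ : RelativeMonad j}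

/-- Postcomposition commutes with restriction along `h`. If `h` mediates `b`, then `b` is the
postcomposition of `R` restricted along `h`, which is therefore `a` by injectivity of
postcomposition. -/
theorem mediates_iff_of_isPostcompAlgebra (H : U.IsCompatible adj) (hU : IsAlgebraObject U)
    {P : adj.IsPostcompMonad T T₁} {D : X} {R : T.Algebra N} {R₁ : T₁.Algebra N}
    (hR : adj.IsPostcompAlgebra P R R₁) {a : T.Algebra D} {b : T₁.Algebra D}
    (hab : adj.IsPostcompAlgebra P a b) (h : D ⟶ N) : R₁.Mediates b h ↔ R.Mediates a h := by
  constructor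
  · intro m
    have e : h ≫ R₁.carrier = b.carrier := m.choose
    have hr : adj.IsPostcompAlgebra P (R.restrict h) b := by
      refine ⟨(Category.assoc _ _ _).trans ((congrArg (h ≫ ·) hR.carrier).trans e), ?_⟩
      intro B k x y ps c e₁ e₂ e₃
      have e₄ : (k ≫ h) ≫ R₁.carrier = y := by rw [Category.assoc, e, e₁]
      have e₅ : (k ≫ h) ≫ R.carrier = x := (Category.assoc _ _ _).trans e₂
      rw [← m.act_eq c rfl e₄ e₁, hR.act_ext c e₄ e₅ e₃,
        (R.mediates_restrict h).act_eq _ rfl e₅ e₂]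
    rw [← H.eq_of_isPostcompAlgebra hU hr hab]
    exact R.mediates_restrict h
  · intro m
    have e : h ≫ R.carrier = a.carrier := m.choose
    have e₁ : h ≫ R₁.carrier = b.carrier := by
      rw [← hR.carrier, ← Category.assoc, e, hab.carrier]
    rw [mediates_iff]
    refine ⟨e₁, ?_⟩
    rw [hR.act_ext _ e₁ e hab.carrier,
      hab.act_ext _ (Category.id_comp _) (Category.id_comp _) hab.carrier,
      m.act_eq _ (Category.id_comp _) e]

/-- Postcomposition by the right adjoint preserves and reflects algebra objects. -/
theorem isAlgebraObject_iff_of_isPostcompAlgebra (H : U.IsCompatible adj)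
    (hU : IsAlgebraObject U) {P : adj.IsPostcompMonad T T₁} {R : T.Algebra N} {R₁ : T₁.Algebra N}
    (hR : adj.IsPostcompAlgebra P R R₁) : IsAlgebraObject R ↔ IsAlgebraObject R₁ := by
  constructor
  · intro hR'
    refine (isAlgebraObject_iff R₁).2 ⟨fun {D} b => ?_, fun {D D'} b b' {h h'} m m' {ps} s hs => ?_⟩
    · obtain ⟨a, hab⟩ := H.exists_isPostcompAlgebra hU P b
      refine (existsUnique_congr fun h => ?_).1 (hR'.existsUnique_tight a)
      exact (H.mediates_iff_of_isPostcompAlgebra hU hR hab h).symm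
    · obtain ⟨a, hab⟩ := H.exists_isPostcompAlgebra hU P b
      obtain ⟨a', hab'⟩ := H.exists_isPostcompAlgebra hU P b'
      have n := (H.mediates_iff_of_isPostcompAlgebra hU hR hab h).1 m
      have n' := (H.mediates_iff_of_isPostcompAlgebra hU hR hab' h').1 m'
      -- The lift through `R₁` has two stages: through `U` to a `T`-homomorphism `t`, then through
      -- `R`.
      obtain ⟨t, ht, rfl⟩ := H.exists_push_eq_of_isHom hU hab hab' hs
      obtain ⟨σ, hσ⟩ : ∃ σ : Cell h ps h' (looseId N),
        push R.carrier σ n.choose n'.choose = t := hR'.exists_push_eq n n' ht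
      have key : ∀ τ : Cell h ps h' (looseId N), push R₁.carrier τ m.choose m'.choose =
          push U.carrier (push R.carrier τ n.choose n'.choose) hab.carrier hab'.carrier :=
        fun τ => (push_push R.carrier U.carrier τ _ _ _ _ hR.carrier _ _).symm
      refine ⟨σ, ?_, fun τ hτ => ?_⟩
      · dsimp only
        rw [key, hσ]
      · dsimp only at hτ
        rw [key] at hτ
        exact hR'.push_injective _ _ n.choose n'.choose
          ((hU.push_injective _ _ _ _ hτ).trans hσ.symm)
  · intro hR'
    refine (isAlgebraObject_iff R).2 ⟨fun {D} a => ?_, fun {D D'} a a' {h h'} n n' {ps} s hs => ?_⟩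
    · obtain ⟨b, hab⟩ := P.exists_isPostcompAlgebra a
      refine (existsUnique_congr fun h => ?_).1 (hR'.existsUnique_tight b)
      exact H.mediates_iff_of_isPostcompAlgebra hU hR hab h
    · obtain ⟨b, hab⟩ := P.exists_isPostcompAlgebra a
      obtain ⟨b', hab'⟩ := P.exists_isPostcompAlgebra a'
      have m := (H.mediates_iff_of_isPostcompAlgebra hU hR hab h).2 n
      have m' := (H.mediates_iff_of_isPostcompAlgebra hU hR hab' h').2 n'
      have key : ∀ τ : Cell h ps h' (looseId N), push R₁.carrier τ m.choose m'.choose =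
          push U.carrier (push R.carrier τ n.choose n'.choose) hab.carrier hab'.carrier :=
        fun τ => (push_push R.carrier U.carrier τ _ _ _ _ hR.carrier _ _).symm
      -- Here the homomorphism is first sent forward along `U`, then lifted through `R₁`; the action
      -- of `U` is cancelled at the end.
      obtain ⟨σ, hσ⟩ : ∃ σ : Cell h ps h' (looseId N), push R₁.carrier σ m.choose m'.choose =
          push U.carrier s hab.carrier hab'.carrier :=
        hR'.exists_push_eq m m' ((hU.isHom_push_iff hab hab' s).2 hs)
      refine ⟨σ, ?_, fun τ hτ => ?_⟩
      · rw [key] at hσ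
        exact hU.push_injective _ _ _ _ hσ
      · apply hR'.push_injective _ _ m.choose m'.choose
        rw [hσ, key]
        exact congrArg (fun y => push U.carrier y _ _) hτ

end Algebra.IsCompatible

end RelativeMonad

/-! ### Pasting of relative adjunctions -/

namespace RelativeAdjunction

variable {A C D E : X} {j : A ⟶ E} {l' : A ⟶ D} {r' : D ⟶ E} {l : A ⟶ C} {r : C ⟶ D}

theorem act_paste_flat (adj' : RelativeAdjunction j l' r') (adj : RelativeAdjunction l' l r)
    {B : X} {x : B ⟶ C} {y : B ⟶ D} {y' : B ⟶ E} {ps : LooseChain Loose A B}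
    (c : Cell j ps y' (looseId E)) (e : x ≫ r ≫ r' = y') (h : x ≫ r = y) (h' : y ≫ r' = y') :
    act (adj'.paste adj).flat c e (Category.comp_id x) =
      act adj.flat (act adj'.flat c h' (Category.comp_id y)) h (Category.comp_id x) := by
  refine (act_act _ _ _ e h (Category.comp_id x)).trans ?_
  rw [act_resRight _ _ _ _ _ _ _ h]

/-- The carriers `(l ≫ r) ≫ r'` and `l ≫ (r ≫ r')` agree only by associativity, which is why
postcomposition is treated as a relation. The operators agree because `♭` of a pasting transposes
twice and `push` respects composition of tight-cells. -/
theorem isPostcompMonad_paste (adj' : RelativeAdjunction j l' r')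
    (adj : RelativeAdjunction l' l r) :
    adj'.IsPostcompMonad adj.monad (adj'.paste adj).monad where
  carrier := Category.assoc l r r'
  unit := by
    have h := act_act adj.sharp (resRight adj'.sharp r (Category.comp_id r) rfl) (cellOne l)
      (Category.comp_id l) rfl rfl
    rw [act_resRight _ _ _ _ _ _ _ rfl] at h
    exact h.symm
  act_ext {B k x y ps} c e h h' := by
    have h₁ : (k ≫ l) ≫ r = x := (Category.assoc _ _ _).trans h
    have h₂ : (k ≫ l) ≫ r ≫ r' = y := by rw [← Category.assoc, h₁, h']
    rw [act_monad_ext _ c e rfl h₂, adj.act_monad_ext _ h rfl h₁,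
      act_paste_flat adj' adj c h₂ h₁ h']
    exact (push_push r r' _ _ _ _ _ rfl _ _).symm

/-- This reduces strict monadicity of a pasting to the comparison of algebra objects under
postcomposition. -/
theorem isPostcompAlgebra_paste (adj' : RelativeAdjunction j l' r')
    (adj : RelativeAdjunction l' l r) :
    adj'.IsPostcompAlgebra (adj'.isPostcompMonad_paste adj) adj.rightAlgebra
      (adj'.paste adj).rightAlgebra where
  carrier := rfl
  act_ext {B k x y ps} c e h h' := by
    refine (act_rightAlgebra_ext _ c e).trans ?_
    refine Eq.trans ?_ (congrArg (fun y => push r' y _ _) (adj.act_rightAlgebra_ext _ h).symm)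
    refine (congrArg (fun z => push (r ≫ r') z _ _) (act_paste_flat adj' adj c e h h')).trans ?_
    exact (push_push r r' _ _ _ _ _ rfl _ _).symm

/-- Pasting with a strictly monadic relative adjunction preserves and reflects strict
monadicity. -/
theorem isStrictlyMonadic_paste_iff (adj' : RelativeAdjunction j l' r')
    (h' : adj'.IsStrictlyMonadic) (adj : RelativeAdjunction l' l r) :
    adj.IsStrictlyMonadic ↔ (adj'.paste adj).IsStrictlyMonadic := by
  rw [isStrictlyMonadic_iff, isStrictlyMonadic_iff]
  exact adj'.isCompatible_rightAlgebra.isAlgebraObject_iff_of_isPostcompAlgebra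
    ((isStrictlyMonadic_iff adj').1 h') (adj'.isPostcompAlgebra_paste adj)

/-- Every `j`-adjunction whose right adjoint factors through that of `l' ⊣ r'` is a pasting. -/
theorem exists_paste_eq (adj' : RelativeAdjunction j l' r')
    (adj₁ : RelativeAdjunction j l (r ≫ r')) :
    ∃ adj : RelativeAdjunction l' l r, adj'.paste adj = adj₁ := by
  -- The operators of `adj₁` with those of `adj'` cancelled: `♭'` after `♯₁`, and `♭₁` after `♯'`.
  refine ⟨⟨comp₁ adj₁.sharp (resRight adj'.flat r rfl (Category.comp_id r)) (Category.id_comp _)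
      (Category.id_comp _), comp₁ (resRight adj'.sharp r (Category.comp_id r) rfl) adj₁.flat
      (Category.id_comp _) (Category.id_comp _), ?_, ?_⟩, ?_⟩
  · apply comp_cart_eq_act
    rw [act_act _ _ _ _ (Category.id_comp _), act_act _ _ _ _ (Category.id_comp _),
      act_act _ _ _ _ (Category.id_comp _), act_resRight _ _ _ _ _ _ _ (Category.id_comp _),
      act_resRight _ _ _ _ _ _ _ (Category.id_comp _), act_sharp_flat, act_flat_sharp, act_id]
  · apply comp_cart_eq_act
    rw [act_act _ _ _ _ (Category.id_comp _), act_act _ _ _ _ (Category.id_comp _),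
      act_act _ _ _ _ (Category.id_comp _), act_resRight _ _ _ _ _ _ _ (Category.id_comp _),
      act_resRight _ _ _ _ _ _ _ (Category.id_comp _), act_sharp_flat, act_flat_sharp, act_id]
  -- Since the inverse laws are propositions, it is enough to compare the two operators.
  · obtain ⟨s, f, h₁, h₂⟩ := adj₁
    unfold paste
    congr 1
    · apply comp_cart_eq_act
      rw [act_act _ _ _ _ (Category.id_comp _), act_act _ _ _ _ (Category.id_comp _),
        act_resRight _ _ _ _ _ _ _ (Category.id_comp _),
        act_resRight _ _ _ _ _ _ _ (Category.id_comp _), act_sharp_flat]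
    · apply comp_cart_eq_act
      rw [act_act _ _ _ _ (Category.id_comp _), act_act _ _ _ _ (Category.id_comp _),
        act_resRight _ _ _ _ _ _ _ (Category.id_comp _),
        act_resRight _ _ _ _ _ _ _ (Category.id_comp _), act_sharp_flat]

end RelativeAdjunction

end RelativeMonads

/-! ### The two statements -/

theorem mainTheorem9 {X : Type u} [VirtualDoubleCategory.{u, v, w, z} X] [VirtualEquipment X] :
    (∀ {A C M E : X} {j : A ⟶ E} (T' : RelativeMonad j) (U : T'.Algebra M)
      (hU : RelativeMonad.IsAlgebraObject U) (l : A ⟶ C) (r : C ⟶ M)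
      (adj : RelativeAdjunction hU.free l r),
      (∀ D : X, Function.Bijective
        (fun a : adj.monad.Algebra D => hU.adjunction.postcompAlgebra a)) ∧
      ∀ {D D' : X} (a : adj.monad.Algebra D) (b : adj.monad.Algebra D') (ps : LooseChain Loose D D'),
        ∃ Φ : GradedMorphism a b ps ≃
            GradedMorphism (hU.adjunction.postcompAlgebra a) (hU.adjunction.postcompAlgebra b) ps,
          ∀ χ, (Φ χ).cell = whisker U.carrier rfl rfl χ.cell) ∧
    (∀ {A C D E : X} {j : A ⟶ E} {l' : A ⟶ D} {r' : D ⟶ E} (adj' : RelativeAdjunction j l' r'),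
      adj'.IsStrictlyMonadic → ∀ (l : A ⟶ C) (r : C ⟶ D),
        ((∃ adj : RelativeAdjunction l' l r, adj.IsStrictlyMonadic) ↔
          ∃ adj : RelativeAdjunction j l (r ≫ r'), adj.IsStrictlyMonadic) ∧
        ∀ adj : RelativeAdjunction l' l r,
          adj.IsStrictlyMonadic ↔ (adj'.paste adj).IsStrictlyMonadic) := by 
  refine ⟨fun {A C M E j} T' U hU l r adj => ⟨fun D => ?_, fun {D D'} a b ps => ?_⟩,
    fun {A C D E j l' r'} adj' h' l r => ⟨⟨?_, ?_⟩, fun adj => ?_⟩⟩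
  · exact hU.isCompatible_adjunction.bijective_postcompAlgebra hU adj.monad D
  · exact hU.isCompatible_adjunction.exists_gradedMorphism_equiv hU
      (hU.adjunction.isPostcompAlgebra_postcompAlgebra a)
      (hU.adjunction.isPostcompAlgebra_postcompAlgebra b) ps
  · rintro ⟨adj, h⟩
    exact ⟨adj'.paste adj, (adj'.isStrictlyMonadic_paste_iff h' adj).1 h⟩
  · rintro ⟨adj₁, h⟩
    obtain ⟨adj, rfl⟩ := adj'.exists_paste_eq adj₁
    exact ⟨adj, (adj'.isStrictlyMonadic_paste_iff h' adj).2 h⟩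
  · exact adj'.isStrictlyMonadic_paste_iff h' adj
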